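/- **Theorem 6.2 (Comparison principle).** Let $\alpha,\beta\in\mathbb R$ with $\beta>0$, $\alpha+\beta>0$, and consider for $\varepsilon>0$ the Landau–Lifshitz equation $$u_t=-u\times\Big(u\times\big(\Delta u-\tfrac1{\varepsilon^2}H(u)\big)\Big),\qquad u\in S^2,\qquad H(u)=(\alpha u_1u_3^2,\ \alpha u_2u_3^2,\ \alpha u_1^2u_3+\alpha u_2^2u_3+\beta u_3). \tag{1.1}$$ *Control maps.* Put $\mu=\sqrt{\alpha+\beta}/\varepsilon$. Let $v=v^\varepsilon:\mathbb R\to S^2$ be one of the following two maps. Map I: with $X=e^{\mu\rho\cos\varepsilon^2}$, $\theta=\mu\rho\sin\varepsilon^2$ and $D=\sqrt{(X^2+\alpha+\frac\beta2)^2-\alpha(\alpha+\beta)\cos^2\varepsilon^2}$, $$v(\rho)=\tfrac1D\Big((\alpha+\beta)\sin\varepsilon^2\cos(\varepsilon^2+\theta)-\sin\theta\,(X^2-\tfrac\beta2),\ (\alpha+\beta)\sin\varepsilon^2\sin(\varepsilon^2+\theta)+\cos\theta\,(X^2-\tfrac\beta2),\ \sqrt{2(\alpha+\beta)}\,\cos\varepsilon^2\,X\Big).$$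 Map II: for a constant $k\in\mathbb R$, with $X=e^{\mu\rho}$ and $D=\sqrt{(X^2+\frac\beta2)^2+2\alpha X^2}$, $$v(\rho)=\tfrac1D\Big((X^2-\tfrac\beta2)\cos k,\ (X^2-\tfrac\beta2)\sin k,\ \sqrt{2(\alpha+\beta)}\,X\Big).$$ *Reduced equations.* For smooth $r$, $u=v(r(x,t))$ leads to two equations of the form $a(r)(r_t-\Delta r)-b(r)|\nabla r|^2+c(r)=0$, namely $$\text{(E1)}\quad a=v_2v_1'-v_1v_2',\quad b=v_2v_1''-v_1v_2'',\quad c=0;$$ $$\text{(E2)}\quad a=v_3',\quad b=v_3''+|v'|^2v_3,\quad c=\tfrac1{\varepsilon^2}v_3(1-v_3^2)(\alpha+\beta-2\alpha v_3^2).$$ Write $Q(\rho,p)=(b(\rho)|p|^2-c(\rho))/a(\rho)$ where $a(\rho)\ne0$. *δ-viscosity super- and subsolutions.* Let $\delta,t^*>0$. For a lower semicontinuous $r$ on $\mathbb R^n\times[0,t^*]$, $v(r)$ is a δ-viscosity supersolution of (1.1) if, whenever $\phi\in C^2$ and $r-\phi$ has a local minimum with value $0$ at a point of $\mathbb R^n\times(0,t^*)$,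 then at that point, with $\rho=r$, $p=\nabla\phi$, $\tau=\phi_t-\Delta\phi$, the following holds for (E2), and, provided $\rho\notin(\frac\delta4,\frac\delta2)$, also for (E1): if $a(\rho)\neq0$, then $\tau\ge Q(\rho,p)$; if $a(\rho)=0$, then $b(\rho)|p|^2-c(\rho)=0$ and, unless $a$ vanishes identically near $\rho$, $\tau\ge\liminf Q(\rho',p')$ as $(\rho',p')\to(\rho,p)$ with $a(\rho')\ne0$. For an upper semicontinuous $s$, $v(s)$ is a δ-viscosity subsolution if the same holds with local maxima of $s-\phi$, with $\rho=s$, with $\tau\le Q(\rho,p)$, respectively $\tau\le\limsup Q(\rho',p')$, and with the interval $(-\frac\delta2,-\frac\delta4)$ in place of $(\frac\delta4,\frac\delta2)$. *Claim.* For all $\alpha,\beta$ as above and every $\delta>0$ there is $\varepsilon_0>0$ such that the following holds for all $0<\varepsilon\le\varepsilon_0$, for $v^\varepsilon$ either of the above maps (any $k$), for every $t^*>0$ with $\delta<2\sqrt{6t^*}$ and every $n$. Let $v^\varepsilon(r)$ be a δ-viscosity supersolution and $v^\varepsilon(s)$ a δ-viscosity subsolution of (1.1), with $r,s$ continuous on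 $\mathbb R^n\times[0,t^*]$. Assume that there are $M>0$ and $(\tilde x,\tilde t)\in U_M\times[0,t^*]$, $U_M=\{x\in\mathbb R^n : |x|<M\}$, such that $$s(x,t)\le r(\tilde x,\tilde t)\le r(x,t)\qquad\text{for all }x\notin U_M,\ t\in[0,t^*],$$ and that $s\le r$ on $\mathbb R^n\times\{t=0\}$. Then $s(x,t)\le r(x,t)$ at every $(x,t)\in\mathbb R^n\times[0,t^*]$ with $r(x,t)\notin[\frac\delta4,\frac\delta2]$ and $s(x,t)\notin[-\frac\delta2,-\frac\delta4]$. -/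

import Mathlib

noncomputable section

namespace LandauLifshitz

/-- The space `ℝⁿ` with its Euclidean norm. -/
abbrev Space (n : ℕ) : Type := EuclideanSpace ℝ (Fin n)

/-! ### The reduced equations for `u = v (r (x, t))` -/

/-- A scalar equation `a(r) (r_t - Δ r) - b(r) |∇ r|² + c(r) = 0` for an unknown `r(x, t)`. -/
structure ScalarEquation where
  a : ℝ → ℝ
  b : ℝ → ℝ
  c : ℝ → ℝ

/-- `(v₂ v₁' - v₁ v₂') (r_t - Δ r) - (v₂ v₁'' - v₁ v₂'') |∇ r|² = 0`
(components are numbered from `0` in the code). -/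
def firstEquation (v : ℝ → EuclideanSpace ℝ (Fin 3)) : ScalarEquation where
  a ρ := v ρ 1 * deriv (fun σ => v σ 0) ρ - v ρ 0 * deriv (fun σ => v σ 1) ρ
  b ρ := v ρ 1 * iteratedDeriv 2 (fun σ => v σ 0) ρ - v ρ 0 * iteratedDeriv 2 (fun σ => v σ 1) ρ
  c _ := 0

/-- `v₃' (r_t - Δ r) - (v₃'' + |v'|² v₃) |∇ r|² + ε⁻² v₃ (1 - v₃²) (α + β - 2 α v₃²) = 0`. -/
def secondEquation (α β ε : ℝ) (v : ℝ → EuclideanSpace ℝ (Fin 3)) : ScalarEquation where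
  a ρ := deriv (fun σ => v σ 2) ρ
  b ρ := iteratedDeriv 2 (fun σ => v σ 2) ρ + ‖deriv v ρ‖ ^ 2 * v ρ 2
  c ρ := 1 / ε ^ 2 * (v ρ 2 * (1 - v ρ 2 ^ 2) * (α + β - 2 * α * v ρ 2 ^ 2))

/-- Where `a(r) ≠ 0`, the equation reads `r_t - Δ r = (b(r) |∇ r|² - c(r)) / a(r)`; this is its
right-hand side at the value `ρ = r` and the gradient `p = ∇ r`. -/
def ScalarEquation.rhs (eq : ScalarEquation) {n : ℕ} (ρ : ℝ) (p : Space n) : ℝ :=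
  (eq.b ρ * ‖p‖ ^ 2 - eq.c ρ) / eq.a ρ

/-- The supersolution inequality at a touching point, for the value `ρ`, the gradient `p` and
the value `τ` of `φ_t - Δ φ` of the test function. Where the equation degenerates
(`a ρ = 0`), its zeroth and first order part has to vanish, and `τ` has to lie above the lower
semicontinuous envelope of the right-hand side at `(ρ, p)`; the latter says nothing if the
equation degenerates on a whole neighbourhood of `ρ`. -/
def ScalarEquation.SuperIneq (eq : ScalarEquation) {n : ℕ} (ρ : ℝ) (p : Space n) (τ : ℝ) :
    Prop :=
  (eq.a ρ ≠ 0 → eq.rhs ρ p ≤ τ) ∧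
  (eq.a ρ = 0 → eq.b ρ * ‖p‖ ^ 2 - eq.c ρ = 0 ∧
    ((∃ᶠ ρ' in nhds ρ, eq.a ρ' ≠ 0) → ∀ m : ℝ,
      (∀ᶠ z : ℝ × Space n in nhds (ρ, p), eq.a z.1 ≠ 0 → m ≤ eq.rhs z.1 z.2) → m ≤ τ))

/-- The subsolution inequality at a touching point, mirror image of `SuperIneq`. -/
def ScalarEquation.SubIneq (eq : ScalarEquation) {n : ℕ} (ρ : ℝ) (p : Space n) (τ : ℝ) :
    Prop :=
  (eq.a ρ ≠ 0 → τ ≤ eq.rhs ρ p) ∧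
  (eq.a ρ = 0 → eq.b ρ * ‖p‖ ^ 2 - eq.c ρ = 0 ∧
    ((∃ᶠ ρ' in nhds ρ, eq.a ρ' ≠ 0) → ∀ m : ℝ,
      (∀ᶠ z : ℝ × Space n in nhds (ρ, p), eq.a z.1 ≠ 0 → eq.rhs z.1 z.2 ≤ m) → τ ≤ m))

/-! ### δ-viscosity super- and subsolutions -/

/-- The spatial gradient of `φ`. -/
def spaceGrad {n : ℕ} (φ : Space n × ℝ → ℝ) (z : Space n × ℝ) : Space n :=
  gradient (fun x => φ (x, z.2)) z.1

/-- The heat operator `φ_t - Δ φ`. -/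
def heatOp {n : ℕ} (φ : Space n × ℝ → ℝ) (z : Space n × ℝ) : ℝ :=
  deriv (fun t => φ (z.1, t)) z.2 - Laplacian.laplacian (fun x => φ (x, z.2)) z.1

/-- `v(r)` is a viscosity supersolution on `ℝⁿ × (0, T)` of the equation `eq`, as far as the
values of `r` in `V` are concerned. -/
def IsViscositySuper (eq : ScalarEquation) {n : ℕ} (T : ℝ) (V : Set ℝ)
    (r : Space n × ℝ → ℝ) : Prop :=
  ∀ φ : Space n × ℝ → ℝ, ContDiff ℝ 2 φ → ∀ z : Space n × ℝ, z.2 ∈ Set.Ioo 0 T →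
    IsLocalMin (fun y => r y - φ y) z → r z = φ z → r z ∈ V →
    eq.SuperIneq (r z) (spaceGrad φ z) (heatOp φ z)

/-- `v(r)` is a viscosity subsolution on `ℝⁿ × (0, T)` of the equation `eq`, as far as the
values of `r` in `V` are concerned. -/
def IsViscositySub (eq : ScalarEquation) {n : ℕ} (T : ℝ) (V : Set ℝ)
    (r : Space n × ℝ → ℝ) : Prop :=
  ∀ φ : Space n × ℝ → ℝ, ContDiff ℝ 2 φ → ∀ z : Space n × ℝ, z.2 ∈ Set.Ioo 0 T →
    IsLocalMax (fun y => r y - φ y) z → r z = φ z → r z ∈ V →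
    eq.SubIneq (r z) (spaceGrad φ z) (heatOp φ z)

/-- `v(r)` is a δ-viscosity supersolution of
`u_t = - u × (u × (Δ u - ε⁻² H(u)))`, `|u| = 1`, on `ℝⁿ × (0, T)`, where
`H(u) = (α u₁ u₃², α u₂ u₃², α u₁² u₃ + α u₂² u₃ + β u₃)`. -/
structure IsDeltaSuper (α β ε δ T : ℝ) {n : ℕ} (v : ℝ → EuclideanSpace ℝ (Fin 3))
    (r : Space n × ℝ → ℝ) : Prop where
  contDiff : ContDiff ℝ 2 v
  sphere : ∀ ρ, ‖v ρ‖ = 1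
  lsc : LowerSemicontinuousOn r (Set.univ ×ˢ Set.Icc 0 T)
  first : IsViscositySuper (firstEquation v) T (Set.Ioo (δ / 4) (δ / 2))ᶜ r
  second : IsViscositySuper (secondEquation α β ε v) T Set.univ r

/-- `v(s)` is a δ-viscosity subsolution of the same equation on `ℝⁿ × (0, T)`. -/
structure IsDeltaSub (α β ε δ T : ℝ) {n : ℕ} (v : ℝ → EuclideanSpace ℝ (Fin 3))
    (s : Space n × ℝ → ℝ) : Prop where
  contDiff : ContDiff ℝ 2 v
  sphere : ∀ ρ, ‖v ρ‖ = 1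
  usc : UpperSemicontinuousOn s (Set.univ ×ˢ Set.Icc 0 T)
  first : IsViscositySub (firstEquation v) T (Set.Ioo (-(δ / 2)) (-(δ / 4)))ᶜ s
  second : IsViscositySub (secondEquation α β ε v) T Set.univ s

/-! ### The global control maps `v^ε` -/

/-- `μ = √(α + β) / ε`. -/
def mu (α β ε : ℝ) : ℝ := √(α + β) / ε

/-- The common denominator of the components of the first control map. -/
def denI (α β ε ρ : ℝ) : ℝ :=
  √((Real.exp (2 * mu α β ε * ρ * Real.cos (ε ^ 2)) + α + β / 2) ^ 2
    - α * (α + β) * Real.cos (ε ^ 2) ^ 2)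

/-- The global control map I. -/
def controlMapI (α β ε ρ : ℝ) : EuclideanSpace ℝ (Fin 3) :=
  let θ := mu α β ε * ρ * Real.sin (ε ^ 2)
  let X := Real.exp (mu α β ε * ρ * Real.cos (ε ^ 2))
  !₂[((α + β) * Real.sin (ε ^ 2) * Real.cos (ε ^ 2 + θ) - Real.sin θ * (X ^ 2 - β / 2))
        / denI α β ε ρ,
     ((α + β) * Real.sin (ε ^ 2) * Real.sin (ε ^ 2 + θ) + Real.cos θ * (X ^ 2 - β / 2))
        / denI α β ε ρ,
     √(2 * (α + β)) * Real.cos (ε ^ 2) * X / denI α β ε ρ]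

/-- The common denominator of the components of the second control map. -/
def denII (α β ε ρ : ℝ) : ℝ :=
  √((Real.exp (2 * mu α β ε * ρ) + β / 2) ^ 2 + 2 * α * Real.exp (2 * mu α β ε * ρ))

/-- The global control map II, with its constant `k`. -/
def controlMapII (α β ε k ρ : ℝ) : EuclideanSpace ℝ (Fin 3) :=
  let X := Real.exp (mu α β ε * ρ)
  !₂[(X ^ 2 - β / 2) / denII α β ε ρ * Real.cos k,
     (X ^ 2 - β / 2) / denII α β ε ρ * Real.sin k,
     √(2 * (α + β)) * X / denII α β ε ρ]

/-- `v` is one of the global control maps `v^ε`. -/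
def IsControlMap (α β ε : ℝ) (v : ℝ → EuclideanSpace ℝ (Fin 3)) : Prop :=
  v = controlMapI α β ε ∨ ∃ k : ℝ, v = controlMapII α β ε k

end LandauLifshitz

end

/-!
A control map `v` takes the unknown `u = v(r)` of the Landau–Lifshitz equation to a scalar `r`
satisfying two equations in the heat operator `τ = r_t - Δ r` and `|∇ r|²`. In the second one the
coefficients `b` and `c` agree, so that it reads `τ = f (|∇ r|² - 1)` with `f = b / a`. For the
second map the first equation is empty, and for the first map it is the heat equation `τ = 0`, for
values outside the excluded interval. In both cases `s ≤ r` holds everywhere.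

For a `C²` change of unknown `G` with `G' = G₁ > 0`, `G₂ = G₁'`, the heat operator of `G(r)` is
`G₁ τ - G₂ |∇ r|²`. The general comparison principle `le_of_viscosity_pair` asks for an inequality
between these quantities for the sub- and the supersolution, at different values and almost equal
gradients of `G(s)` and `G(r)`. The test functions for `s` and `r` come from
`exists_touching_quadratics`, which regularizes by sup- and inf-convolution and then uses Jensen's
lemma `exists_differentiable_contact`. The place of Alexandrov's theorem is taken by Stepanov's
theorem, applied to the supergradient of a semiconcave function on a set of contact points where
it is Lipschitz (`eventually_abs_taylor_le` turns a derivative of the supergradient into a second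
order expansion).

*Second map* (`le_of_isControlMapII`). The quotient `f` is a smooth function, `a` vanishes at a
single value, and the choice `G₂ = f G₁` removes the gradient term. What remains is a zeroth order
term that is Lipschitz in `G`.

*First map* (`le_of_isControlMapI`). The quotient `f` has a pole near zero. For small `ε` it
is close to `-μ / cos ε²` for `ρ ≥ d` and to `μ / cos ε²` for `ρ ≤ -d`, up to exponentially small
errors, where `d = δ / 8` (`IsSteep`, `exists_isSteep_firstMapQuotient`). Take `G₁ = 1 / g` with
`g = 1 + dist(ρ, [-d, d])²`. The supersolution satisfies the heat inequality unless its value lies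
in `(2 d, 4 d)`, the subsolution unless its value lies in `(-4 d, -2 d)`. Let the value `σ` of the
subsolution exceed the value `ρ` of the supersolution. If `ρ ≥ 2 d`, or `σ ≤ -2 d`, the second
equation holds for both, and the factor of the squared gradient, `f g + g'`, is decreasing there.
Otherwise the heat inequality holds for both. If the gradient is bounded, this suffices, since
`g'` is Lipschitz. If it is large, the heat inequality near zero and the second equation away from
zero show that the subsolution term is nonpositive and the supersolution term almost nonnegative
(`IsSteep.le_of_lt`).
-/

namespace LandauLifshitz

open Filter Topology MeasureTheory Set
open scoped RealInnerProductSpace NNReal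

/-! ### Semiconcave functions and differentiability of Lipschitz maps -/

section Semiconvex

variable {F : Type*} [NormedAddCommGroup F] [InnerProductSpace ℝ F]

theorem norm_slope_sub_le_mul {C : ℝ} (hC : 0 ≤ C) {g : F → ℝ} {x y a b : F} {ρ : ℝ} (h0 : 0 < ρ)
    (hρ : ‖x - y‖ ≤ ρ)
    (hx : ∀ z, ‖z - x‖ ≤ ρ → g x + ⟪a, z - x⟫ - C * ‖z - x‖ ^ 2 ≤ g z)
    (hy : ∀ z, ‖z - x‖ ≤ ρ → g z ≤ g y + ⟪b, z - y⟫ + C * ‖z - y‖ ^ 2)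
    (hxy : g y + ⟪b, x - y⟫ - C * ‖x - y‖ ^ 2 ≤ g x) : ‖a - b‖ ≤ 6 * C * ρ := by
  by_cases hab : a - b = 0
  · rw [hab, norm_zero]; positivity
  have hn : 0 < ‖a - b‖ := norm_pos_iff.2 hab
  set d : F := (ρ / ‖a - b‖) • (a - b) with hd
  have hdn : ‖d‖ = ρ := by
    rw [hd, norm_smul, Real.norm_of_nonneg (by positivity)]
    field_simp
  have hzx : x + d - x = d := by abel
  have hzy : x + d - y = d + (x - y) := by abel
  have h1 := hx (x + d) (by rw [hzx, hdn])
  have h2 := hy (x + d) (by rw [hzx, hdn])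
  rw [hzx, hdn] at h1
  rw [hzy, inner_add_right] at h2
  have h3 : ⟪a, d⟫ - ⟪b, d⟫ = ρ * ‖a - b‖ := by
    rw [← inner_sub_left, hd, inner_smul_right, real_inner_self_eq_norm_sq]
    field_simp
  have h4 : ‖d + (x - y)‖ ≤ 2 * ρ := by
    calc _ ≤ ‖d‖ + ‖x - y‖ := norm_add_le _ _
      _ ≤ _ := by linarith
  have h5 : ‖d + (x - y)‖ ^ 2 ≤ 4 * ρ ^ 2 := by
    nlinarith [norm_nonneg (d + (x - y))]
  have h6 : ‖x - y‖ ^ 2 ≤ ρ ^ 2 := by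
    nlinarith [norm_nonneg (x - y)]
  have h7 : ρ * ‖a - b‖ ≤ ρ * (6 * C * ρ) := by
    nlinarith [mul_le_mul_of_nonneg_left h5 hC, mul_le_mul_of_nonneg_left h6 hC]
  exact le_of_mul_le_mul_left h7 h0

/-- If `g` lies above a paraboloid with slope `a` at `x`, and is enclosed between two paraboloids
with slope `b` at `y`, then `a` and `b` differ by at most a multiple of the distance of `x`
and `y`. -/
theorem norm_slope_sub_le {C : ℝ} (hC : 0 ≤ C) {g : F → ℝ} {x y a b : F} {ρ : ℝ}
    (hρ : ‖x - y‖ < ρ)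
    (hx : ∀ z, ‖z - x‖ ≤ ρ → g x + ⟪a, z - x⟫ - C * ‖z - x‖ ^ 2 ≤ g z)
    (hy : ∀ z, ‖z - x‖ ≤ ρ → g z ≤ g y + ⟪b, z - y⟫ + C * ‖z - y‖ ^ 2)
    (hxy : g y + ⟪b, x - y⟫ - C * ‖x - y‖ ^ 2 ≤ g x) : ‖a - b‖ ≤ 6 * C * ‖x - y‖ := by
  have hlim : Tendsto (fun σ : ℝ => 6 * C * σ) (𝓝[>] ‖x - y‖) (𝓝 (6 * C * ‖x - y‖)) :=
    ((continuous_const.mul continuous_id).tendsto _).mono_left nhdsWithin_le_nhds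
  refine ge_of_tendsto hlim ?_
  filter_upwards [self_mem_nhdsWithin, Ioo_mem_nhdsGT hρ] with σ h1 h2
  exact norm_slope_sub_le_mul hC ((norm_nonneg _).trans_lt h1) h1.le
    (fun z hz => hx z (hz.trans h2.2.le)) (fun z hz => hy z (hz.trans h2.2.le)) hxy

/-- A quadratic error in the increments disappears when `[0, 1]` is subdivided. -/
theorem abs_sub_le_of_quadratic_error {m : ℝ → ℝ} {a b : ℝ}
    (h : ∀ t ∈ Icc (0 : ℝ) 1, ∀ t' ∈ Icc (0 : ℝ) 1, t ≤ t' →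
      |m t' - m t| ≤ a * (t' - t) + b * (t' - t) ^ 2) : |m 1 - m 0| ≤ a := by
  have key : ∀ N : ℕ, |m 1 - m 0| ≤ a + b / ((N : ℝ) + 1) := by
    intro N
    have hN : (0 : ℝ) < (N : ℝ) + 1 := by positivity
    have h1 : m 1 - m 0 = ∑ i ∈ Finset.range (N + 1),
        (m (((i + 1 : ℕ) : ℝ) / (N + 1)) - m ((i : ℝ) / (N + 1))) := by
      rw [Finset.sum_range_sub (fun i : ℕ => m ((i : ℝ) / (N + 1)))]
      push_cast
      rw [div_self hN.ne', zero_div]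
    rw [h1]
    calc _ ≤ ∑ i ∈ Finset.range (N + 1),
        |m (((i + 1 : ℕ) : ℝ) / (N + 1)) - m ((i : ℝ) / (N + 1))| := Finset.abs_sum_le_sum_abs _ _
      _ ≤ ∑ i ∈ Finset.range (N + 1), (a / (N + 1) + b / (N + 1) ^ 2) := by
        refine Finset.sum_le_sum fun i hi => ?_
        have hi' : ((i : ℝ) + 1) ≤ N + 1 := by
          exact_mod_cast Finset.mem_range.1 hi
        have e : ((i + 1 : ℕ) : ℝ) / (N + 1) - (i : ℝ) / (N + 1) = 1 / (N + 1) := by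
          push_cast; field_simp; ring
        have := h ((i : ℝ) / (N + 1)) ⟨by positivity, by rw [div_le_one hN]; linarith⟩
          (((i + 1 : ℕ) : ℝ) / (N + 1)) ⟨by positivity, by rw [div_le_one hN]; push_cast; linarith⟩
          (by push_cast; gcongr; linarith)
        rw [e] at this
        refine this.trans (le_of_eq ?_)
        field_simp
      _ = _ := by
        rw [Finset.sum_const, Finset.card_range, nsmul_eq_mul]
        push_cast
        field_simp
  have hlim : Tendsto (fun N : ℕ => a + b / ((N : ℝ) + 1)) atTop (𝓝 (a + 0)) :=
    tendsto_const_nhds.add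
      (tendsto_const_nhds.div_atTop (tendsto_atTop_add_const_right _ _ tendsto_natCast_atTop_atTop))
  rw [add_zero] at hlim
  exact ge_of_tendsto' hlim key

/-- A semiconcave function has a second order Taylor expansion at every point where its
supergradient `q` is differentiable. The linear map `A` need not be known to be symmetric. -/
theorem eventually_abs_taylor_le {w : F → ℝ} {q : F → F} {C : ℝ} {y : F} {A : F →L[ℝ] F}
    {K : Set F}
    (hw : ∀ x ∈ K, ∀ z ∈ K, w z ≤ w x + ⟪q x, z - x⟫ + C * ‖z - x‖ ^ 2) (hK : K ∈ 𝓝 y)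
    (hq : HasFDerivAt q A y) {η : ℝ} (hη : 0 < η) :
    ∀ᶠ h in 𝓝 (0 : F), |w (y + h) - w y - ⟪q y, h⟫ - 1 / 2 * ⟪A h, h⟫| ≤ η * ‖h‖ ^ 2 := by
  obtain ⟨r, hr, hrK⟩ := Metric.mem_nhds_iff.1 hK
  have hlo := (hasFDerivAt_iff_isLittleO_nhds_zero.1 hq).def hη
  obtain ⟨r', hr', hq'⟩ := Metric.eventually_nhds_iff.1 hlo
  refine Metric.eventually_nhds_iff.2 ⟨min r r', lt_min hr hr', fun h hh => ?_⟩
  rw [dist_zero_right] at hh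
  have hmem : ∀ t ∈ Icc (0 : ℝ) 1, y + t • h ∈ K ∧
      ‖q (y + t • h) - q y - A (t • h)‖ ≤ η * ‖h‖ := by
    intro t ht
    have h1 : ‖t • h‖ ≤ ‖h‖ := by
      rw [norm_smul, Real.norm_of_nonneg ht.1]
      exact mul_le_of_le_one_left (norm_nonneg _) ht.2
    refine ⟨hrK ?_, ?_⟩
    · rw [Metric.mem_ball, dist_eq_norm, add_sub_cancel_left]
      exact h1.trans_lt (hh.trans_le (min_le_left _ _))
    · refine (hq' (y := t • h) ?_).trans (by gcongr)
      rw [dist_zero_right]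
      exact h1.trans_lt (hh.trans_le (min_le_right _ _))
  set m : ℝ → ℝ := fun t => w (y + t • h) - t * ⟪q y, h⟫ - t ^ 2 / 2 * ⟪A h, h⟫ with hm
  have hA : |⟪A h, h⟫| ≤ ‖A h‖ * ‖h‖ := abs_real_inner_le_norm _ _
  have hstep : ∀ t ∈ Icc (0 : ℝ) 1, ∀ t' ∈ Icc (0 : ℝ) 1,
      w (y + t' • h) - w (y + t • h) - (t' - t) * ⟪q y, h⟫ - t * (t' - t) * ⟪A h, h⟫
        ≤ η * ‖h‖ ^ 2 * |t' - t| + C * ‖h‖ ^ 2 * (t' - t) ^ 2 := by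
    intro t ht t' ht'
    have h1 := hw _ (hmem t ht).1 _ (hmem t' ht').1
    have e : y + t' • h - (y + t • h) = (t' - t) • h := by rw [sub_smul]; abel
    rw [e, inner_smul_right, norm_smul, mul_pow, Real.norm_eq_abs, sq_abs] at h1
    have h2 : ⟪q (y + t • h), h⟫ = ⟪q y, h⟫ + t * ⟪A h, h⟫
        + ⟪q (y + t • h) - q y - A (t • h), h⟫ := by
      rw [inner_sub_left, inner_sub_left, map_smul, inner_smul_left]
      simp
    have h3 : |⟪q (y + t • h) - q y - A (t • h), h⟫| ≤ η * ‖h‖ * ‖h‖ :=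
      (abs_real_inner_le_norm _ _).trans (by gcongr; exact (hmem t ht).2)
    have h4 : (t' - t) * ⟪q (y + t • h) - q y - A (t • h), h⟫ ≤ |t' - t| * (η * ‖h‖ * ‖h‖) := by
      refine (le_abs_self _).trans ?_
      rw [abs_mul]
      gcongr
    rw [h2] at h1
    nlinarith
  have hfin := abs_sub_le_of_quadratic_error (m := m) (a := η * ‖h‖ ^ 2)
    (b := C * ‖h‖ ^ 2 + ‖A h‖ * ‖h‖) (fun t ht t' ht' htt => by
      have h1 := hstep t ht t' ht'
      have h2 := hstep t' ht' t ht
      rw [abs_of_nonneg (sub_nonneg.2 htt)] at h1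
      rw [abs_sub_comm, abs_of_nonneg (sub_nonneg.2 htt)] at h2
      have hA' := abs_le.1 hA
      rw [abs_le]
      simp only [hm]
      have h3 : 0 ≤ (t' - t) ^ 2 := sq_nonneg _
      constructor
      · nlinarith [mul_le_mul_of_nonneg_left hA'.1 h3, mul_le_mul_of_nonneg_left hA'.2 h3]
      · nlinarith [mul_le_mul_of_nonneg_left hA'.1 h3, mul_le_mul_of_nonneg_left hA'.2 h3])
  simp only [hm, one_smul, zero_smul, add_zero] at hfin
  convert hfin using 2
  ring

variable [FiniteDimensional ℝ F] [MeasurableSpace F] [BorelSpace F]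

/-- Maly's argument for Stepanov's theorem: on `S`, the function `g` is squeezed between its
smallest and its largest `L`-Lipschitz extension, and both are differentiable almost everywhere. -/
theorem ae_differentiableAt_of_lipschitz_at {μ : Measure F} [μ.IsAddHaarMeasure] {S : Set F}
    {g : F → ℝ} {L : ℝ≥0} (hL : ∀ y ∈ S, ∀ x, |g x - g y| ≤ L * ‖x - y‖) :
    ∀ᵐ y ∂μ, y ∈ S → DifferentiableAt ℝ g y := by
  rcases S.eq_empty_or_nonempty with rfl | ⟨y₀, hy₀⟩
  · exact Eventually.of_forall fun y hy => hy.elim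
  have : Nonempty S := ⟨⟨y₀, hy₀⟩⟩
  have ext : ∀ g : F → ℝ, (∀ y ∈ S, ∀ x, |g x - g y| ≤ L * ‖x - y‖) →
      ∃ G : F → ℝ, LipschitzWith L G ∧ (∀ x, g x ≤ G x) ∧ ∀ y ∈ S, G y = g y := by
    intro g hg
    have hle : ∀ x, ∀ y : S, g x ≤ g y + L * ‖x - (y : F)‖ := fun x y => by
      linarith [(abs_le.1 (hg y y.2 x)).2]
    have hbdd : ∀ x, BddBelow (range fun y : S => g y + L * ‖x - (y : F)‖) := fun x =>
      ⟨g x, by rintro _ ⟨y, rfl⟩; exact hle x y⟩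
    refine ⟨fun x => ⨅ y : S, (g y + L * ‖x - (y : F)‖), ?_, fun x => le_ciInf (hle x),
      fun y hy => ?_⟩
    · refine LipschitzWith.of_le_add_mul L fun x x' => ?_
      rw [← sub_le_iff_le_add]
      refine le_ciInf fun y => ?_
      rw [sub_le_iff_le_add]
      refine (ciInf_le (hbdd x) y).trans ?_
      have h1 : ‖x - (y : F)‖ ≤ ‖x' - (y : F)‖ + dist x x' := by
        rw [dist_eq_norm]
        calc ‖x - (y : F)‖ = ‖(x' - y) + (x - x')‖ := by congr 1; abel
          _ ≤ _ := norm_add_le _ _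
      nlinarith [mul_le_mul_of_nonneg_left h1 L.2]
    · refine le_antisymm ?_ (le_ciInf (hle y))
      refine (ciInf_le (hbdd y) ⟨y, hy⟩).trans ?_
      simp
  obtain ⟨G, hG, hgG, hGS⟩ := ext g hL
  obtain ⟨G', hG', hgG', hGS'⟩ := ext (fun x => -g x) (fun y hy x => by
    rw [neg_sub_neg, abs_sub_comm]; exact hL y hy x)
  filter_upwards [hG.ae_differentiableAt (μ := μ), hG'.ae_differentiableAt (μ := μ)] with y h1 h2 hy
  have hmin : IsLocalMin (fun x => G x + G' x) y := Eventually.of_forall fun x => by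
    have := hGS y hy; have := hGS' y hy; have := hgG x; have := hgG' x
    simp only at *
    linarith
  have hD : fderiv ℝ G y + fderiv ℝ G' y = 0 := by
    rw [← hmin.fderiv_eq_zero]
    exact (fderiv_add h1 h2).symm
  have hD' : fderiv ℝ G' y = -fderiv ℝ G y := eq_neg_of_add_eq_zero_right hD
  have e1 := h1.hasFDerivAt
  have e2 := h2.hasFDerivAt
  rw [hD'] at e2
  refine HasFDerivAt.differentiableAt (f' := fderiv ℝ G y) ?_
  rw [hasFDerivAt_iff_isLittleO_nhds_zero, Asymptotics.isLittleO_iff] at *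
  intro c hc
  filter_upwards [e1 hc, e2 hc] with h k1 k2
  rw [Real.norm_eq_abs, abs_le] at *
  have := hGS y hy; have := hGS' y hy; have := hgG (y + h); have := hgG' (y + h)
  simp only [neg_apply] at *
  constructor <;> linarith

/-- Stepanov's theorem on a set `S` of positive measure. -/
theorem exists_differentiableAt_of_lipschitz_at {μ : Measure F} [μ.IsAddHaarMeasure] {S : Set F}
    (hS : μ S ≠ 0) {q : F → F} {L : ℝ≥0} (hL : ∀ y ∈ S, ∀ x, ‖q x - q y‖ ≤ L * ‖x - y‖) :
    ∃ y ∈ S, DifferentiableAt ℝ q y := by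
  set e := stdOrthonormalBasis ℝ F
  have hae : ∀ i, ∀ᵐ y ∂μ, y ∈ S → DifferentiableAt ℝ (fun x => ⟪e i, q x⟫) y := fun i =>
    ae_differentiableAt_of_lipschitz_at (L := L) fun y hy x => by
      rw [← inner_sub_right]
      refine (abs_real_inner_le_norm _ _).trans ?_
      rw [e.norm_eq_one, one_mul]
      exact hL y hy x
  have hall := eventually_countable_forall.2 hae
  obtain ⟨y, hyS, hy⟩ : ∃ y ∈ S, ∀ i, y ∈ S → DifferentiableAt ℝ (fun x => ⟪e i, q x⟫) y := by
    by_contra hcon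
    push Not at hcon
    refine hS (measure_mono_null (fun y hy => ?_) (ae_iff.1 hall))
    obtain ⟨i, h1, h2⟩ := hcon y hy
    exact fun h => h2 (h i h1)
  refine ⟨y, hyS, ?_⟩
  have : q = fun x => ∑ i, ⟪e i, q x⟫ • e i := funext fun x => (e.sum_repr' (q x)).symm
  rw [this]
  exact DifferentiableAt.fun_sum fun i _ => (hy i hyS).smul_const _

end Semiconvex

/-! ### Contact points of semiconcave functions -/

section Jensen

variable {F : Type*} [NormedAddCommGroup F] [InnerProductSpace ℝ F] [FiniteDimensional ℝ F]

/-- Jensen's lemma. Let `u` be semiconvex and `w` semiconcave, with sub- and supergradients `p` and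
`q`. If `u - w` is negative outside `O` and nonnegative somewhere, there is a point with
`u - w ≥ -η` at which a slightly tilted `u - w` attains its maximum and `q` is differentiable. The
slope `p - q` maps the set of such maximum points onto a ball of tilts and is Lipschitz there, so
this set has positive measure, and Stepanov's theorem applies to `q` on it. -/
theorem exists_differentiable_contact {K O : Set F}
    (hK : IsCompact K) (hO : ∀ z ∈ O, Metric.closedBall z 1 ⊆ K) {u w : F → ℝ} {p q : F → F}
    {C B κ : ℝ} (hC : 0 < C)
    (hu : ∀ x ∈ K, ∀ z ∈ K, u x + ⟪p x, z - x⟫ - C * ‖z - x‖ ^ 2 ≤ u z)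
    (hw : ∀ x ∈ K, ∀ z ∈ K, w z ≤ w x + ⟪q x, z - x⟫ + C * ‖z - x‖ ^ 2)
    (hcont : ContinuousOn (fun z => u z - w z) K) (hB : ∀ x ∈ K, ‖q x‖ ≤ B) (hκ : 0 < κ)
    (hneg : ∀ z ∈ K \ O, u z - w z ≤ -κ) {z₀ : F} (hz₀ : z₀ ∈ K) (h₀ : 0 ≤ u z₀ - w z₀)
    {η : ℝ} (hη : 0 < η) :
    ∃ z ∈ O, ∃ e : F, ‖e‖ ≤ η ∧ -η ≤ u z - w z ∧
      (∀ x ∈ K, u x - w x ≤ u z - w z + ⟪e, x - z⟫) ∧ DifferentiableAt ℝ q z := by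
  borelize F
  have hOK : ∀ z ∈ O, z ∈ K := fun z hz => hO z hz (Metric.mem_closedBall_self zero_le_one)
  have hB0 : 0 ≤ B := (norm_nonneg _).trans (hB z₀ hz₀)
  obtain ⟨R, hR⟩ := hK.isBounded.exists_norm_le
  have hR0 : 0 ≤ R := (norm_nonneg _).trans (hR z₀ hz₀)
  obtain ⟨p₀, hp₀, hpη, hpC, hpR⟩ : ∃ p₀ : ℝ, 0 < p₀ ∧ p₀ ≤ η ∧ p₀ ≤ 6 * C ∧
      p₀ * (2 * R + 1) ≤ min η (κ / 2) := by
    have h2 : 0 < min η (κ / 2) := lt_min hη (by positivity)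
    refine ⟨min η (min (6 * C) (min η (κ / 2) / (2 * R + 1))), by positivity, min_le_left _ _,
      (min_le_right _ _).trans (min_le_left _ _), ?_⟩
    rw [← le_div_iff₀ (by positivity)]
    exact (min_le_right _ _).trans (min_le_right _ _)
  -- the maximum points of the tilted functions
  have hmax : ∀ e : F, ∃ z ∈ K, ∀ x ∈ K, u x - w x ≤ u z - w z + ⟪e, x - z⟫ := by
    intro e
    obtain ⟨z, hz, hzm⟩ := hK.exists_isMaxOn ⟨z₀, hz₀⟩
      (hcont.sub (Continuous.continuousOn (by fun_prop : Continuous fun x : F => ⟪e, x⟫)))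
    refine ⟨z, hz, fun x hx => ?_⟩
    have h1 := hzm hx
    simp only [mem_ofPred_eq, Pi.sub_apply, inner_sub_right] at h1 ⊢
    linarith
  choose Z hZK hZ using hmax
  set D := Metric.closedBall (0 : F) p₀ with hD
  have hin : ∀ e ∈ D, ∀ x ∈ K, ⟪e, x - Z e⟫ ≤ min η (κ / 2) ∧ -min η (κ / 2) ≤ ⟪e, x - Z e⟫ := by
    intro e he x hx
    have h1 : ‖x - Z e‖ ≤ 2 * R + 1 := by
      have := norm_sub_le x (Z e)
      linarith [hR x hx, hR _ (hZK e)]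
    have h2 : |⟪e, x - Z e⟫| ≤ min η (κ / 2) :=
      (abs_real_inner_le_norm _ _).trans
        ((mul_le_mul (by simpa [hD] using he) h1 (norm_nonneg _) hp₀.le).trans hpR)
    exact ⟨(abs_le.1 h2).2, (abs_le.1 h2).1⟩
  have hval : ∀ e ∈ D, -min η (κ / 2) ≤ u (Z e) - w (Z e) := fun e he => by
    have h1 := hZ e z₀ hz₀
    have h2 := (hin e he z₀ hz₀).1
    linarith
  have hZO : ∀ e ∈ D, Z e ∈ O := by
    intro e he
    by_contra hno
    have h1 := hneg _ ⟨hZK e, hno⟩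
    have h2 := hval e he
    have h3 := min_le_right η (κ / 2)
    linarith
  -- at these points, the slope of `u - w` is the tilt
  have hslope : ∀ e ∈ D, p (Z e) - q (Z e) = e := by
    intro e he
    have h1 := norm_slope_sub_le (C := 2 * C) (g := fun z => u z - w z) (x := Z e) (y := Z e)
      (a := p (Z e) - q (Z e)) (b := e) (ρ := 1) (by positivity) (by simp)
      (fun z hz => by
        have hzK : z ∈ K := hO _ (hZO e he) (by rwa [Metric.mem_closedBall, dist_eq_norm])
        have k1 := hu _ (hZK e) _ hzK
        have k2 := hw _ (hZK e) _ hzK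
        rw [inner_sub_left]
        linarith)
      (fun z hz => by
        have hzK : z ∈ K := hO _ (hZO e he) (by rwa [Metric.mem_closedBall, dist_eq_norm])
        have k1 := hZ e z hzK
        have : 0 ≤ 2 * C * ‖z - Z e‖ ^ 2 := by positivity
        linarith)
      (by simp)
    rw [sub_self, norm_zero, mul_zero] at h1
    exact sub_eq_zero.1 (norm_le_zero_iff.1 h1)
  have hlow : ∀ e ∈ D, ∀ z ∈ K,
      w (Z e) + ⟪q (Z e), z - Z e⟫ - C * ‖z - Z e‖ ^ 2 ≤ w z := by
    intro e he z hz
    have k1 := hu _ (hZK e) _ hz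
    have k2 := hZ e z hz
    have k3 : ⟪e, z - Z e⟫ = ⟪p (Z e), z - Z e⟫ - ⟪q (Z e), z - Z e⟫ := by
      rw [← inner_sub_left, hslope e he]
    linarith
  have hlip : ∀ e ∈ D, ∀ e' ∈ D, ‖e' - e‖ ≤ 12 * C * ‖Z e' - Z e‖ := by
    intro e he e' he'
    rcases lt_or_ge ‖Z e' - Z e‖ 1 with hlt | hge
    · have flow : ∀ e ∈ D, ∀ z ∈ K,
          (u (Z e) - w (Z e)) + ⟪e, z - Z e⟫ - 2 * C * ‖z - Z e‖ ^ 2 ≤ u z - w z := by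
        intro e he z hz
        have k1 := hu _ (hZK e) _ hz
        have k2 := hw _ (hZK e) _ hz
        have k3 : ⟪e, z - Z e⟫ = ⟪p (Z e), z - Z e⟫ - ⟪q (Z e), z - Z e⟫ := by
          rw [← inner_sub_left, hslope e he]
        linarith
      have h1 := norm_slope_sub_le (C := 2 * C) (g := fun z => u z - w z) (x := Z e') (y := Z e)
        (a := e') (b := e) (ρ := 1) (by positivity) hlt
        (fun z hz =>
          flow e' he' z (hO _ (hZO e' he') (by rwa [Metric.mem_closedBall, dist_eq_norm])))
        (fun z hz => by
          have k1 := hZ e z (hO _ (hZO e' he') (by rwa [Metric.mem_closedBall, dist_eq_norm]))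
          have : 0 ≤ 2 * C * ‖z - Z e‖ ^ 2 := by positivity
          linarith)
        (flow e he _ (hZK e'))
      linarith
    · have h1 : ‖e'‖ ≤ p₀ := by simpa [hD] using he'
      have h2 : ‖e‖ ≤ p₀ := by simpa [hD] using he
      have h3 := norm_sub_le e' e
      nlinarith
  set S := Z '' D with hS
  set μ : Measure F := Measure.hausdorffMeasure (Module.finrank ℝ F : ℝ) with hμ
  have hSμ : μ S ≠ 0 := by
    intro h0
    have hl : LipschitzOnWith (12 * C).toNNReal (fun x => p x - q x) S := by
      refine LipschitzOnWith.of_dist_le_mul ?_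
      rintro _ ⟨e, he, rfl⟩ _ ⟨e', he', rfl⟩
      simp only [hslope e he, hslope e' he', dist_eq_norm]
      rw [Real.coe_toNNReal _ (by positivity)]
      exact hlip e' he' e he
    have h1 := hl.hausdorffMeasure_image_le (d := (Module.finrank ℝ F : ℝ)) (by positivity)
    rw [← hμ, h0, mul_zero] at h1
    have h2 : D ⊆ (fun x => p x - q x) '' S := fun e he =>
      ⟨Z e, mem_image_of_mem _ he, hslope e he⟩
    have h3 : μ D = 0 := le_antisymm ((measure_mono h2).trans h1) bot_le
    exact (Metric.measure_closedBall_pos μ (0 : F) hp₀).ne' h3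
  -- `q` is Lipschitz at the points of `S`
  obtain ⟨y, ⟨e, he, rfl⟩, hy⟩ := exists_differentiableAt_of_lipschitz_at (μ := μ) hSμ
    (q := K.indicator q) (L := (6 * C + 4 * B).toNNReal) (by
      rintro _ ⟨e, he, rfl⟩ x
      rw [Real.coe_toNNReal _ (by positivity)]
      have hindB : ∀ x, ‖K.indicator q x‖ ≤ B := fun x => by
        by_cases hx : x ∈ K
        · rw [indicator_of_mem hx]; exact hB x hx
        · rw [indicator_of_notMem hx, norm_zero]; exact hB0
      have hnn := norm_nonneg (x - Z e)
      rcases lt_or_ge ‖x - Z e‖ (1 / 2) with hlt | hge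
      · have hxK : x ∈ K := hO _ (hZO e he)
          (by rw [Metric.mem_closedBall, dist_eq_norm]; linarith)
        rw [indicator_of_mem hxK, indicator_of_mem (hZK e)]
        have hzK : ∀ z, ‖z - x‖ ≤ 1 / 2 → z ∈ K := fun z hz => hO _ (hZO e he) (by
          rw [Metric.mem_closedBall, dist_eq_norm]
          have := norm_add_le (z - x) (x - Z e)
          rw [sub_add_sub_cancel] at this
          linarith)
        have h1 := norm_slope_sub_le (C := C) (g := fun z => -w z) (x := x) (y := Z e)
          (a := -q x) (b := -q (Z e)) (ρ := 1 / 2) hC.le hlt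
          (fun z hz => by
            have := hw x hxK z (hzK z hz)
            rw [inner_neg_left]; linarith)
          (fun z hz => by
            have := hlow e he z (hzK z hz)
            rw [inner_neg_left]; linarith)
          (by
            have := hw _ (hZK e) x hxK
            rw [inner_neg_left]; linarith)
        rw [neg_sub_neg, norm_sub_rev] at h1
        nlinarith
      · refine (norm_sub_le _ _).trans ?_
        nlinarith [hindB x, hindB (Z e)])
  have hKn : K ∈ 𝓝 (Z e) :=
    mem_of_superset (Metric.closedBall_mem_nhds _ one_pos) (hO _ (hZO e he))
  refine ⟨Z e, hZO e he, e, le_trans (by simpa [hD] using he) hpη,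
    le_trans (neg_le_neg (min_le_left _ _)) (hval e he), hZ e, hy.congr_of_eventuallyEq ?_⟩
  filter_upwards [hKn] with x hx
  rw [indicator_of_mem hx]

/-! ### Inf-convolutions -/

/-- The infimum defining the inf-convolution of a function bounded below is attained. -/
theorem exists_infConvolution_minimizer {W : F → ℝ} (hW : Continuous W) {b : ℝ}
    (hb : ∀ z, b ≤ W z) {N : ℝ} (hN : 0 < N) (z : F) :
    ∃ y, ∀ x, W y + N * ‖z - y‖ ^ 2 ≤ W x + N * ‖z - x‖ ^ 2 := by
  refine Continuous.exists_forall_le (f := fun x => W x + N * ‖z - x‖ ^ 2) (by fun_prop) ?_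
  refine tendsto_atTop_mono (f := fun x => b + N * ‖z - x‖ ^ 2) (fun x => by
    have := hb x; linarith) ?_
  refine tendsto_atTop_add_const_left _ _ (Tendsto.const_mul_atTop hN ?_)
  refine (tendsto_pow_atTop two_ne_zero).comp ?_
  have := tendsto_norm_cocompact_atTop (E := F)
  have h2 := this.comp (Homeomorph.subLeft z).isClosedEmbedding.tendsto_cocompact
  exact h2

/-- Inf-convolution of `W` with a steep paraboloid: a semiconcave function `V` close to `W` on
the compact set `K`. A paraboloid touching `V` from below at `z` also touches `W` from below, with
the same slope, at the minimizer `Y z`. -/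
theorem exists_infConvolution {K : Set F} (hK : IsCompact K) {W : F → ℝ}
    (hW : Continuous W) {b : ℝ} (hb : ∀ z, b ≤ W z) {ϱ : ℝ} (hϱ : 0 < ϱ) :
    ∃ N₀ : ℝ, 0 < N₀ ∧ ∀ N ≥ N₀, ∃ Y : F → F, ∃ V : F → ℝ,
      (∀ z, V z = W (Y z) + N * ‖z - Y z‖ ^ 2) ∧
      (∀ z y, V z ≤ W y + N * ‖z - y‖ ^ 2) ∧
      (∀ z ∈ K, ‖z - Y z‖ ≤ ϱ) ∧
      (∀ x z, V z ≤ V x + ⟪(2 * N) • (x - Y x), z - x⟫ + N * ‖z - x‖ ^ 2) ∧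
      (ContinuousOn V K) := by
  obtain ⟨D, hD⟩ : ∃ D, ∀ z ∈ K, W z ≤ D := by
    obtain ⟨D, hD⟩ := hK.bddAbove_image hW.continuousOn
    exact ⟨D, fun z hz => hD (mem_image_of_mem _ hz)⟩
  refine ⟨(|D - b| + 1) / ϱ ^ 2, by positivity, fun N hN => ?_⟩
  have hN0 : 0 < N := lt_of_lt_of_le (by positivity) hN
  choose Y hY using exists_infConvolution_minimizer hW hb hN0
  have hdist : ∀ z ∈ K, ‖z - Y z‖ ≤ ϱ := by
    intro z hz
    have h1 := hY z z
    rw [sub_self, norm_zero] at h1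
    have h2 := hb (Y z)
    have h3 := hD z hz
    have h4 : N * ‖z - Y z‖ ^ 2 ≤ N * ϱ ^ 2 := by
      have h5 : |D - b| + 1 ≤ N * ϱ ^ 2 := by
        rwa [ge_iff_le, div_le_iff₀ (by positivity)] at hN
      have := le_abs_self (D - b)
      linarith
    exact le_of_sq_le_sq (le_of_mul_le_mul_left h4 hN0) hϱ.le
  have hsemi : ∀ x z, W (Y z) + N * ‖z - Y z‖ ^ 2 ≤ W (Y x) + N * ‖x - Y x‖ ^ 2
      + ⟪(2 * N) • (x - Y x), z - x⟫ + N * ‖z - x‖ ^ 2 := by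
    intro x z
    refine (hY z (Y x)).trans (le_of_eq ?_)
    have : z - Y x = (x - Y x) + (z - x) := by abel
    rw [this, norm_add_sq_real, real_inner_smul_left]
    ring
  refine ⟨Y, fun z => W (Y z) + N * ‖z - Y z‖ ^ 2, fun _ => rfl, hY, hdist, hsemi, ?_⟩
  have hone : ∀ x ∈ K, ∀ z, (W (Y z) + N * ‖z - Y z‖ ^ 2) - (W (Y x) + N * ‖x - Y x‖ ^ 2)
      ≤ 2 * N * ϱ * ‖z - x‖ + N * ‖z - x‖ ^ 2 := by
    intro x hx z
    have h1 := hsemi x z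
    have h2 := real_inner_le_norm ((2 * N) • (x - Y x)) (z - x)
    rw [norm_smul, Real.norm_of_nonneg (by positivity)] at h2
    have h3 : 2 * N * ‖x - Y x‖ * ‖z - x‖ ≤ 2 * N * ϱ * ‖z - x‖ := by
      gcongr; exact hdist x hx
    linarith
  intro x hx
  rw [ContinuousWithinAt, tendsto_iff_norm_sub_tendsto_zero]
  have hlim : Tendsto (fun z => 2 * N * ϱ * ‖z - x‖ + N * ‖z - x‖ ^ 2) (𝓝[K] x) (𝓝 0) := by
    have : Continuous fun z => 2 * N * ϱ * ‖z - x‖ + N * ‖z - x‖ ^ 2 := by fun_prop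
    have h := this.tendsto x
    simp only [sub_self, norm_zero] at h
    norm_num at h
    exact h.mono_left nhdsWithin_le_nhds
  refine squeeze_zero' (Eventually.of_forall fun _ => norm_nonneg _) ?_ hlim
  filter_upwards [self_mem_nhdsWithin] with z hz
  rw [Real.norm_eq_abs, abs_le]
  have h1 := hone x hx z
  have h2 := hone z hz x
  rw [norm_sub_rev x z] at h2
  constructor <;> linarith

end Jensen

/-! ### Touching quadratic polynomials -/

section Jets

variable {F : Type*} [NormedAddCommGroup F]

theorem exists_uniform_modulus {K : Set F} (hK : IsCompact K) {W : F → ℝ} (hW : Continuous W)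
    {κ : ℝ} (hκ : 0 < κ) :
    ∃ ϱ : ℝ, 0 < ϱ ∧ ∀ z ∈ K, ∀ y, ‖z - y‖ ≤ ϱ → |W z - W y| ≤ κ := by
  have h := hK.uniformContinuousAt_of_continuousAt W (fun a _ => hW.continuousAt)
    (Metric.dist_mem_uniformity hκ)
  obtain ⟨ϱ, hϱ, h⟩ := Metric.mem_uniformity_dist.1 h
  refine ⟨ϱ / 2, by positivity, fun z hz y hy => ?_⟩
  have h1 := @h z y (by rw [dist_eq_norm]; linarith) hz
  exact le_of_lt h1

variable [InnerProductSpace ℝ F] [FiniteDimensional ℝ F]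

/-- A substitute for the theorem on sums. If `U - W` has an interior maximum with value `0`, then
at nearby points `y₁`, `y₂` there are quadratic polynomials touching `U` from above and
`W` from below, with the same second order part (up to `η ‖h‖²`) and almost the same slope.
The bound `B` on the slopes does not depend on `η`. -/
theorem exists_touching_quadratics {K O : Set F} (hK : IsCompact K) (hOo : IsOpen O)
    (hO : ∀ z ∈ O, Metric.closedBall z 1 ⊆ K) {U W : F → ℝ} (hU : Continuous U)
    (hW : Continuous W) {b b' : ℝ} (hUb : ∀ z, U z ≤ b') (hWb : ∀ z, b ≤ W z)
    (hle : ∀ z ∈ K, U z ≤ W z) (hlt : ∀ z ∈ K \ O, U z < W z)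
    {z₀ : F} (hz₀ : z₀ ∈ K) (h₀ : U z₀ = W z₀) {κ : ℝ} (hκ : 0 < κ) :
    ∃ B : ℝ, ∀ η : ℝ, 0 < η → ∃ y₁ ∈ O, ∃ y₂ ∈ O, ∃ q₁ q₂ : F, ∃ A : F →L[ℝ] F,
      ‖q₁‖ ≤ B ∧ ‖q₂‖ ≤ B ∧ ‖q₁ - q₂‖ ≤ η ∧ |U y₁ - W y₂| ≤ κ ∧
      (∀ᶠ h in 𝓝 (0 : F), U (y₁ + h) ≤ U y₁ + ⟪q₁, h⟫ + 1 / 2 * ⟪A h, h⟫ + η * ‖h‖ ^ 2) ∧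
      (∀ᶠ h in 𝓝 (0 : F), W y₂ + ⟪q₂, h⟫ + 1 / 2 * ⟪A h, h⟫ - η * ‖h‖ ^ 2 ≤ W (y₂ + h)) := by
  obtain ⟨κ₁, hκ₁, hneg⟩ : ∃ κ₁ : ℝ, 0 < κ₁ ∧ ∀ z ∈ K \ O, U z - W z ≤ -κ₁ := by
    rcases (K \ O).eq_empty_or_nonempty with he | hne
    · exact ⟨1, one_pos, by simp [he]⟩
    · obtain ⟨x, hx, hmax⟩ := (hK.diff hOo).exists_isMaxOn hne (hU.sub hW).continuousOn
      refine ⟨W x - U x, sub_pos.2 (hlt x hx), fun z hz => ?_⟩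
      have := hmax hz
      simp only [mem_ofPred_eq, Pi.sub_apply] at this
      linarith
  obtain ⟨κ₂, hκ₂, h2κ, h2κ₁⟩ : ∃ κ₂ : ℝ, 0 < κ₂ ∧ 4 * κ₂ ≤ κ ∧ 4 * κ₂ ≤ κ₁ :=
    ⟨min κ κ₁ / 4, by positivity, by linarith [min_le_left κ κ₁], by linarith [min_le_right κ κ₁]⟩
  set Z : Set F := K ∩ {z | -(3 * κ₂) ≤ U z - W z} with hZ
  have hZc : IsCompact Z := hK.inter_right (isClosed_le continuous_const (hU.sub hW))
  have hZO : Z ⊆ O := fun z hz => by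
    by_contra hno
    have := hneg z ⟨hz.1, hno⟩
    have := hz.2
    simp only [mem_ofPred_eq] at this
    linarith
  obtain ⟨ϱ₁, hϱ₁, hthick⟩ := hZc.exists_cthickening_subset_open hOo hZO
  obtain ⟨ϱ₂, hϱ₂, hmodU⟩ := exists_uniform_modulus hK hU hκ₂
  obtain ⟨ϱ₃, hϱ₃, hmodW⟩ := exists_uniform_modulus hK hW hκ₂
  obtain ⟨ϱ, hϱ, h1, h2, h3⟩ : ∃ ϱ : ℝ, 0 < ϱ ∧ ϱ ≤ ϱ₁ ∧ ϱ ≤ ϱ₂ ∧ ϱ ≤ ϱ₃ :=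
    ⟨min ϱ₁ (min ϱ₂ ϱ₃), by positivity, min_le_left _ _, (min_le_right _ _).trans (min_le_left _ _),
      (min_le_right _ _).trans (min_le_right _ _)⟩
  obtain ⟨N₁, hN₁, hex₁⟩ := exists_infConvolution hK hW hWb hϱ
  obtain ⟨N₂, hN₂, hex₂⟩ := exists_infConvolution hK hU.neg (b := -b')
    (fun z => neg_le_neg (hUb z)) hϱ
  set N := max N₁ N₂ with hN
  have hN0 : 0 < N := lt_max_of_lt_left hN₁
  obtain ⟨Y, V, hVeq, hVle, hYd, hVs, hVc⟩ := hex₁ N (le_max_left _ _)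
  obtain ⟨Y', V', hVeq', hVle', hYd', hVs', hVc'⟩ := hex₂ N (le_max_right _ _)
  simp only [Pi.neg_apply] at hVeq' hVle'
  have hVW : ∀ z, V z ≤ W z := fun z => by simpa using hVle z z
  have hVU : ∀ z, V' z ≤ -U z := fun z => by simpa using hVle' z z
  have hVW' : ∀ z, W (Y z) ≤ V z := fun z => by
    rw [hVeq]; have : 0 ≤ N * ‖z - Y z‖ ^ 2 := by positivity
    linarith
  have hVU' : ∀ z, -U (Y' z) ≤ V' z := fun z => by
    rw [hVeq']; have : 0 ≤ N * ‖z - Y' z‖ ^ 2 := by positivity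
    linarith
  have hWY : ∀ z ∈ K, W z ≤ W (Y z) + κ₂ := fun z hz => by
    have := (abs_le.1 (hmodW z hz (Y z) ((hYd z hz).trans h3))).2
    linarith
  have hUY : ∀ z ∈ K, U (Y' z) ≤ U z + κ₂ := fun z hz => by
    have := (abs_le.1 (hmodU z hz (Y' z) ((hYd' z hz).trans h2))).1
    linarith
  refine ⟨2 * N * ϱ + 1, fun η hη => ?_⟩
  obtain ⟨η', hη', hηη, hη1, hηκ⟩ : ∃ η' : ℝ, 0 < η' ∧ η' ≤ η ∧ η' ≤ 1 ∧ η' ≤ κ₂ :=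
    ⟨min η (min 1 κ₂), by positivity, min_le_left _ _, (min_le_right _ _).trans (min_le_left _ _),
      (min_le_right _ _).trans (min_le_right _ _)⟩
  have hqB : ∀ x ∈ K, ‖(2 * N) • (x - Y x)‖ ≤ 2 * N * ϱ := fun x hx => by
    rw [norm_smul, Real.norm_of_nonneg (by positivity)]
    gcongr; exact hYd x hx
  obtain ⟨z, hzO, e, he, hze, hcontact, A, hA⟩ := exists_differentiable_contact hK hO
    (u := fun z => -V' z) (w := V) (p := fun x => -((2 * N) • (x - Y' x)))
    (q := fun x => (2 * N) • (x - Y x)) (C := N) (B := 2 * N * ϱ) (κ := 2 * κ₂) hN0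
    (fun x _ z _ => by
      have := hVs' x z
      simp only [inner_neg_left]
      linarith)
    (fun x _ z _ => hVs x z) (hVc'.neg.sub hVc) hqB (by positivity)
    (fun z hz => by
      have k1 := hneg z hz
      have k2 := hVW' z
      have k3 := hVU' z
      have k4 := hWY z hz.1
      have k5 := hUY z hz.1
      linarith) hz₀
    (by
      have k1 := hVW z₀
      have k2 := hVU z₀
      linarith) hη'
  have hzK : z ∈ K := hO z hzO (Metric.mem_closedBall_self zero_le_one)
  have hKz : K ∈ 𝓝 z := mem_of_superset (Metric.closedBall_mem_nhds _ one_pos) (hO z hzO)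
  have hzZ : z ∈ Z := by
    refine ⟨hzK, ?_⟩
    have k2 := hVW' z
    have k3 := hVU' z
    have k4 := hWY z hzK
    have k5 := hUY z hzK
    simp only [mem_ofPred_eq]
    linarith
  have hnear : ∀ y, ‖z - y‖ ≤ ϱ → y ∈ O := fun y hy => hthick
    (Metric.mem_cthickening_of_dist_le y z ϱ₁ Z hzZ (by
      rw [dist_comm, dist_eq_norm]; exact hy.trans h1))
  have htaylor := eventually_abs_taylor_le (K := K) (fun x _ z _ => hVs x z) hKz hA hη
  refine ⟨Y' z, hnear _ (hYd' z hzK), Y z, hnear _ (hYd z hzK), (2 * N) • (z - Y z) + e,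
    (2 * N) • (z - Y z), A, ?_, ?_, ?_, ?_, ?_, ?_⟩
  · exact (norm_add_le _ _).trans (add_le_add (hqB z hzK) (he.trans hη1))
  · exact (hqB z hzK).trans (by linarith)
  · rw [add_sub_cancel_left]; exact he.trans hηη
  · have k2 := hVW' z
    have k3 := hVU' z
    have k4 := hWY z hzK
    have k5 := hUY z hzK
    have k6 := hle z hzK
    rw [abs_le]
    constructor <;> linarith
  · have hmem : ∀ᶠ h in 𝓝 (0 : F), z + h ∈ K := by
      have : Tendsto (fun h : F => z + h) (𝓝 0) (𝓝 z) := by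
        simpa using (by fun_prop : Continuous fun h : F => z + h).tendsto 0
      exact this hKz
    filter_upwards [htaylor, hmem] with h k1 k2
    have k3 := hcontact _ k2
    have k4 := hVle' (z + h) (Y' z + h)
    have k5 := hVeq' z
    have k6 := (abs_le.1 k1).2
    rw [add_sub_add_right_eq_sub] at k4
    rw [add_sub_cancel_left] at k3
    rw [inner_add_left]
    linarith
  · filter_upwards [htaylor] with h k1
    have k4 := hVle (z + h) (Y z + h)
    have k5 := hVeq z
    have k6 := (abs_le.1 k1).1
    rw [add_sub_add_right_eq_sub] at k4
    linarith

end Jets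

/-! ### Calculus of the heat operator -/

section HeatCalculus

theorem gradient_eq_zero_of_even {E : Type*} [NormedAddCommGroup E] [InnerProductSpace ℝ E]
    [CompleteSpace E] {f : E → ℝ} (hf : ∀ x, f (-x) = f x) : gradient f 0 = 0 := by
  have h := fderiv_comp_smul (𝕜 := ℝ) (f := f) (x := 0) (-1)
  simp only [neg_smul, one_smul, hf, neg_zero] at h
  have h2 : fderiv ℝ f 0 = 0 := by
    ext e
    have := DFunLike.congr_fun h e
    simp only [neg_apply, zero_apply] at this ⊢
    linarith
  rw [gradient, h2, map_zero]

theorem inner_gradient {E : Type*} [NormedAddCommGroup E] [InnerProductSpace ℝ E]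
    [CompleteSpace E] (f : E → ℝ) (x e : E) : ⟪gradient f x, e⟫ = fderiv ℝ f x e := by
  rw [gradient, InnerProductSpace.toDual_symm_apply]

theorem laplacian_comp {E : Type*} [NormedAddCommGroup E] [InnerProductSpace ℝ E]
    [FiniteDimensional ℝ E] {f : E → ℝ} {H : ℝ → ℝ} (hf : ContDiff ℝ 2 f) (hH : ContDiff ℝ 2 H)
    (x : E) : Laplacian.laplacian (fun x => H (f x)) x =
      deriv H (f x) * Laplacian.laplacian f x
        + deriv (deriv H) (f x) * ‖gradient f x‖ ^ 2 := by
  have hH1 : ContDiff ℝ 1 (deriv H) := ((contDiff_succ_iff_deriv (n := 1)).1 hH).2.2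
  have hf1 : ContDiff ℝ 1 (fderiv ℝ f) := hf.fderiv_right (m := 1) le_rfl
  have hfd : Differentiable ℝ f := hf.differentiable two_ne_zero
  have hHd : Differentiable ℝ H := hH.differentiable two_ne_zero
  have e1 : fderiv ℝ (fun x => H (f x)) = fun x => deriv H (f x) • fderiv ℝ f x := by
    funext x
    exact ((hHd (f x)).hasDerivAt.comp_hasFDerivAt x (hfd x).hasFDerivAt).fderiv
  have e2 : HasFDerivAt (fun x => deriv H (f x)) (deriv (deriv H) (f x) • fderiv ℝ f x) x :=
    ((hH1.differentiable one_ne_zero (f x)).hasDerivAt.comp_hasFDerivAt x (hfd x).hasFDerivAt)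
  have e3 := e2.fun_smul (hf1.differentiable one_ne_zero x).hasFDerivAt
  rw [InnerProductSpace.laplacian_eq_iteratedFDeriv_stdOrthonormalBasis,
    InnerProductSpace.laplacian_eq_iteratedFDeriv_stdOrthonormalBasis]
  simp only [iteratedFDeriv_two_apply, Matrix.cons_val_zero, Matrix.cons_val_one]
  rw [e1, e3.fderiv, ← OrthonormalBasis.sum_sq_norm_inner_left (stdOrthonormalBasis ℝ E),
    Finset.mul_sum, Finset.mul_sum, ← Finset.sum_add_distrib]
  refine Finset.sum_congr rfl fun i _ => ?_
  rw [inner_gradient, Real.norm_eq_abs, sq_abs]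
  simp
  ring

theorem laplacian_comp_sub_right {E : Type*} [NormedAddCommGroup E] [InnerProductSpace ℝ E]
    [FiniteDimensional ℝ E] (f : E → ℝ) (a x : E) :
    Laplacian.laplacian (fun x => f (x - a)) x = Laplacian.laplacian f (x - a) := by
  simp only [InnerProductSpace.laplacian_eq_iteratedFDeriv_stdOrthonormalBasis,
    iteratedFDeriv_comp_sub]

theorem laplacian_continuousLinearMap {E : Type*} [NormedAddCommGroup E] [InnerProductSpace ℝ E]
    [FiniteDimensional ℝ E] (l : E →L[ℝ] ℝ) (x : E) :
    Laplacian.laplacian (fun x => l x) x = 0 := by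
  simp only [InnerProductSpace.laplacian_eq_iteratedFDeriv_stdOrthonormalBasis,
    iteratedFDeriv_two_apply]
  have : fderiv ℝ (fun x => l x) = fun _ => l := funext fun x => l.fderiv
  simp [this]

variable {n : ℕ}

theorem contDiff_space_slice {k : WithTop ℕ∞} {φ : Space n × ℝ → ℝ} (hφ : ContDiff ℝ k φ) (t : ℝ) :
    ContDiff ℝ k fun x => φ (x, t) :=
  hφ.comp (contDiff_id.prodMk contDiff_const)

theorem contDiff_time_slice {k : WithTop ℕ∞} {φ : Space n × ℝ → ℝ} (hφ : ContDiff ℝ k φ)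
    (x : Space n) : ContDiff ℝ k fun t => φ (x, t) :=
  hφ.comp (contDiff_const.prodMk contDiff_id)

theorem heatOp_add {f g : Space n × ℝ → ℝ} (hf : ContDiff ℝ 2 f) (hg : ContDiff ℝ 2 g)
    (z : Space n × ℝ) : heatOp (fun z => f z + g z) z = heatOp f z + heatOp g z := by
  have h1 : Laplacian.laplacian (fun x => f (x, z.2) + g (x, z.2)) z.1 = _ :=
    (contDiff_space_slice hf z.2).contDiffAt.laplacian_add
      (contDiff_space_slice hg z.2).contDiffAt
  have h2 := deriv_fun_add (((contDiff_time_slice hf z.1).differentiable two_ne_zero) z.2)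
    (((contDiff_time_slice hg z.1).differentiable two_ne_zero) z.2)
  simp only [heatOp]
  rw [h1, h2]
  ring

theorem heatOp_const_mul {f : Space n × ℝ → ℝ} (hf : ContDiff ℝ 2 f) (c : ℝ)
    (z : Space n × ℝ) : heatOp (fun z => c * f z) z = c * heatOp f z := by
  have h1 : Laplacian.laplacian (fun x => c * f (x, z.2)) z.1 = _ :=
    InnerProductSpace.laplacian_smul c (contDiff_space_slice hf z.2).contDiffAt
  simp only [heatOp]
  rw [h1, deriv_const_mul_field, smul_eq_mul]
  ring

theorem spaceGrad_add {f g : Space n × ℝ → ℝ} (hf : ContDiff ℝ 2 f) (hg : ContDiff ℝ 2 g)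
    (z : Space n × ℝ) : spaceGrad (fun z => f z + g z) z = spaceGrad f z + spaceGrad g z := by
  simp only [spaceGrad, gradient]
  rw [fderiv_fun_add (((contDiff_space_slice hf z.2).differentiable two_ne_zero) z.1)
    (((contDiff_space_slice hg z.2).differentiable two_ne_zero) z.1), map_add]

theorem heatOp_comp_sub_right (f : Space n × ℝ → ℝ) (y z : Space n × ℝ) :
    heatOp (fun z => f (z - y)) z = heatOp f (z - y) := by
  have h1 := laplacian_comp_sub_right (fun x => f (x, z.2 - y.2)) y.1 z.1
  have h2 := deriv_comp_sub_const (fun t => f (z.1 - y.1, t)) y.2 z.2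
  simp only [heatOp]
  exact congrArg₂ _ h2 h1

theorem spaceGrad_comp_sub_right (f : Space n × ℝ → ℝ) (y z : Space n × ℝ) :
    spaceGrad (fun z => f (z - y)) z = spaceGrad f (z - y) := by
  have h1 := fderiv_comp_sub (𝕜 := ℝ) (f := fun x => f (x, z.2 - y.2)) (x := z.1) y.1
  simp only [spaceGrad, gradient]
  exact congrArg _ h1

theorem heatOp_time {θ : ℝ → ℝ} (z : Space n × ℝ) :
    heatOp (fun z : Space n × ℝ => θ z.2) z = deriv θ z.2 := by
  simp only [heatOp, InnerProductSpace.laplacian_const]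
  simp

theorem spaceGrad_time {θ : ℝ → ℝ} (z : Space n × ℝ) :
    spaceGrad (fun z : Space n × ℝ => θ z.2) z = 0 := by
  simp [spaceGrad]

theorem heatOp_comp {f : Space n × ℝ → ℝ} {H : ℝ → ℝ} (hf : ContDiff ℝ 2 f)
    (hH : ContDiff ℝ 2 H) (z : Space n × ℝ) : heatOp (fun z => H (f z)) z =
      deriv H (f z) * heatOp f z - deriv (deriv H) (f z) * ‖spaceGrad f z‖ ^ 2 := by
  have h1 := laplacian_comp (contDiff_space_slice hf z.2) hH z.1
  have h2 : deriv (fun t => H (f (z.1, t))) z.2 = deriv H (f z) * deriv (fun t => f (z.1, t)) z.2 :=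
    deriv_comp (h₂ := H) (h := fun t => f (z.1, t)) z.2 (hH.differentiable two_ne_zero _)
      ((contDiff_time_slice hf z.1).differentiable two_ne_zero z.2)
  simp only [heatOp, spaceGrad]
  rw [h1, h2]
  ring

theorem spaceGrad_comp {f : Space n × ℝ → ℝ} {H : ℝ → ℝ} (hf : ContDiff ℝ 2 f)
    (hH : ContDiff ℝ 2 H) (z : Space n × ℝ) :
    spaceGrad (fun z => H (f z)) z = deriv H (f z) • spaceGrad f z := by
  have h1 := ((hH.differentiable two_ne_zero (f z)).hasDerivAt.comp_hasFDerivAt z.1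
    ((contDiff_space_slice hf z.2).differentiable two_ne_zero z.1).hasFDerivAt).fderiv
  simp only [spaceGrad, gradient]
  have h2 : fderiv ℝ (fun x => H (f (x, z.2))) z.1 =
    deriv H (f z) • fderiv ℝ (fun x => f (x, z.2)) z.1 := h1
  rw [h2, map_smulₛₗ]
  simp

/-- Space-time with its Euclidean structure. -/
abbrev SpaceTime (n : ℕ) : Type := WithLp 2 (Space n × ℝ)

/-- The identity map from `Space n × ℝ`, which carries the maximum norm, to Euclidean
space-time. -/
abbrev toSpaceTime (n : ℕ) : (Space n × ℝ) ≃L[ℝ] SpaceTime n :=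
  (WithLp.prodContinuousLinearEquiv 2 ℝ (Space n) ℝ).symm

/-- The quadratic polynomial on space-time with slope `q` and second order part
`⟪A h, h⟫ / 2 + η ‖h‖²`. -/
noncomputable def quadPoly (c : ℝ) (q : SpaceTime n) (A : SpaceTime n →L[ℝ] SpaceTime n) (η : ℝ)
    (h : Space n × ℝ) : ℝ :=
  c + (⟪q, toSpaceTime n h⟫ + (1 / 2 * ⟪A (toSpaceTime n h), toSpaceTime n h⟫
    + η * ‖toSpaceTime n h‖ ^ 2))

theorem contDiff_quadPoly (c : ℝ) (q : SpaceTime n) (A : SpaceTime n →L[ℝ] SpaceTime n) (η : ℝ) :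
    ContDiff ℝ 2 (quadPoly c q A η) := by
  unfold quadPoly
  have h := (toSpaceTime n).contDiff (n := 2)
  have hAc : ContDiff ℝ 2 fun h => A (toSpaceTime n h) := A.contDiff.comp h
  exact contDiff_const.add ((contDiff_const.inner ℝ h).add
    ((contDiff_const.mul (hAc.inner ℝ h)).add (contDiff_const.mul (h.norm_sq ℝ))))

theorem spaceGrad_quadPoly (c : ℝ) (q : SpaceTime n) (A : SpaceTime n →L[ℝ] SpaceTime n) (η : ℝ) :
    spaceGrad (quadPoly c q A η) 0 = q.fst := by
  have h := (toSpaceTime n).contDiff (n := 2)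
  have hAc : ContDiff ℝ 2 fun h => A (toSpaceTime n h) := A.contDiff.comp h
  unfold quadPoly
  rw [spaceGrad_add contDiff_const ((contDiff_const.inner ℝ h).add
    ((contDiff_const.mul (hAc.inner ℝ h)).add (contDiff_const.mul (h.norm_sq ℝ)))),
    spaceGrad_add (contDiff_const.inner ℝ h)
    ((contDiff_const.mul (hAc.inner ℝ h)).add (contDiff_const.mul (h.norm_sq ℝ))),
    spaceGrad_time (θ := fun _ => c), zero_add]
  have h2 : spaceGrad (fun z : Space n × ℝ => 1 / 2 * ⟪A (toSpaceTime n z), toSpaceTime n z⟫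
      + η * ‖toSpaceTime n z‖ ^ 2) 0 = 0 := by
    refine gradient_eq_zero_of_even fun x => ?_
    have : toSpaceTime n (-x, (0 : Space n × ℝ).2) = -toSpaceTime n (x, (0 : Space n × ℝ).2) := by
      rw [← map_neg]; simp
    simp only [this, map_neg, inner_neg_neg, norm_neg]
  rw [h2, add_zero]
  have h3 : (fun x : Space n => ⟪q, toSpaceTime n (x, (0 : Space n × ℝ).2)⟫)
      = fun x => ⟪q.fst, x⟫ := by
    funext x
    simp [WithLp.prod_inner_apply]
  simp only [spaceGrad]
  rw [h3]
  refine HasGradientAt.gradient ?_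
  rw [hasGradientAt_iff_hasFDerivAt]
  exact (InnerProductSpace.toDual ℝ (Space n) q.fst).hasFDerivAt

theorem heatOp_quadPoly (c : ℝ) (q : SpaceTime n) (A : SpaceTime n →L[ℝ] SpaceTime n) (η : ℝ) :
    heatOp (quadPoly c q A η) 0 = q.snd
      + heatOp (fun h => 1 / 2 * ⟪A (toSpaceTime n h), toSpaceTime n h⟫) 0
      + η * heatOp (fun h => ‖toSpaceTime n h‖ ^ 2) 0 := by
  have h := (toSpaceTime n).contDiff (n := 2)
  have hAc : ContDiff ℝ 2 fun h => A (toSpaceTime n h) := A.contDiff.comp h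
  have hA := (contDiff_const (c := (1 / 2 : ℝ))).mul (hAc.inner ℝ h)
  have hN := h.norm_sq ℝ
  unfold quadPoly
  rw [heatOp_add contDiff_const ((contDiff_const.inner ℝ h).add (hA.add (contDiff_const.mul hN))),
    heatOp_add (contDiff_const.inner ℝ h) (hA.add (contDiff_const.mul hN)),
    heatOp_add hA (contDiff_const.mul hN), heatOp_const_mul hN,
    heatOp_time (θ := fun _ => c)]
  have h3 : heatOp (fun z : Space n × ℝ => ⟪q, toSpaceTime n z⟫) 0 = q.snd := by
    have e1 : (fun x : Space n => ⟪q, toSpaceTime n (x, (0 : Space n × ℝ).2)⟫)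
        = fun x => InnerProductSpace.toDual ℝ (Space n) q.fst x := by
      funext x
      simp [WithLp.prod_inner_apply]
    have e2 : (fun t : ℝ => ⟪q, toSpaceTime n ((0 : Space n × ℝ).1, t)⟫)
        = fun t => t * q.snd := by
      funext x
      simp [WithLp.prod_inner_apply]
    simp only [heatOp]
    rw [e1, e2, laplacian_continuousLinearMap, sub_zero]
    simp
  rw [h3]
  simp
  ring

end HeatCalculus

/-! ### Local inverses of a change of unknown -/

section ChangeOfUnknown

/-- A `C²` function agrees with a globally defined `C²` function near a given point. -/
theorem exists_contDiff_eventuallyEq {H₀ : ℝ → ℝ} {y : ℝ} (h : ContDiffAt ℝ 2 H₀ y) :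
    ∃ H : ℝ → ℝ, ContDiff ℝ 2 H ∧ H =ᶠ[𝓝 y] H₀ := by
  obtain ⟨U, hU, hH⟩ := h.contDiffOn (m := 2) le_rfl (by simp)
  obtain ⟨r, hr, hrU⟩ := Metric.mem_nhds_iff.1 hU
  let χ : ContDiffBump y := ⟨r / 4, r / 2, by positivity, by linarith⟩
  refine ⟨fun x => χ x * H₀ x, contDiff_iff_contDiffAt.2 fun x => ?_, ?_⟩
  · rcases lt_or_ge (dist x y) r with hx | hx
    · refine χ.contDiff.contDiffAt.mul ?_
      exact (hH.mono hrU).contDiffAt (Metric.isOpen_ball.mem_nhds hx)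
    · refine contDiffAt_const (c := (0 : ℝ)) |>.congr_of_eventuallyEq ?_
      have : {x' | r / 2 < dist x' y} ∈ 𝓝 x :=
        (isOpen_lt continuous_const (continuous_id.dist continuous_const)).mem_nhds
          (by simp only [mem_ofPred_eq, id]; linarith)
      filter_upwards [this] with x' hx'
      rw [χ.zero_of_le_dist (le_of_lt hx'), zero_mul]
  · filter_upwards [χ.eventuallyEq_one] with x hx
    rw [hx]; simp

/-- Local inverse of an increasing `C²` function `G`, extended to the line, with its first two
derivatives. -/
theorem exists_contDiff_localInverse {G G₁ G₂ : ℝ → ℝ} (hG₁ : ∀ x, HasDerivAt G (G₁ x) x)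
    (hG₂ : ∀ x, HasDerivAt G₁ (G₂ x) x) (hG₂c : Continuous G₂) (hpos : ∀ x, 0 < G₁ x) (ρ : ℝ) :
    ∃ H : ℝ → ℝ, ContDiff ℝ 2 H ∧ H (G ρ) = ρ ∧ (∀ᶠ y in 𝓝 (G ρ), G (H y) = y) ∧
      deriv H (G ρ) = 1 / G₁ ρ ∧ deriv (deriv H) (G ρ) = -(G₂ ρ / G₁ ρ ^ 3) := by
  have hd1 : deriv G = G₁ := funext fun x => (hG₁ x).deriv
  have hd2 : deriv G₁ = G₂ := funext fun x => (hG₂ x).deriv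
  have hG1c : ContDiff ℝ 1 G₁ :=
    contDiff_one_iff_deriv.2 ⟨fun x => (hG₂ x).differentiableAt, by rwa [hd2]⟩
  have hGc : ContDiff ℝ 2 G :=
    (contDiff_succ_iff_deriv (n := 1)).2
      ⟨fun x => (hG₁ x).differentiableAt, by simp, by rwa [hd1]⟩
  have hmono : StrictMono G := strictMono_of_deriv_pos fun x => by rw [hd1]; exact hpos x
  set e : ℝ ≃L[ℝ] ℝ := ContinuousLinearEquiv.unitsEquivAut ℝ (Units.mk0 (G₁ ρ) (hpos ρ).ne')
  have hGf : HasFDerivAt G (e : ℝ →L[ℝ] ℝ) ρ := (hG₁ ρ).hasFDerivAt_equiv (hpos ρ).ne'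
  have hstr : HasStrictFDerivAt G (e : ℝ →L[ℝ] ℝ) ρ :=
    hGc.contDiffAt.hasStrictFDerivAt' hGf two_ne_zero
  have hloc := ContDiffAt.to_localInverse hGc.contDiffAt hGf two_ne_zero
  obtain ⟨H, hH, hHeq⟩ := exists_contDiff_eventuallyEq hloc
  have hinv : ∀ᶠ y in 𝓝 (G ρ), G (H y) = y := by
    filter_upwards [hHeq, hstr.eventually_right_inverse] with y h1 h2
    rw [h1]; exact h2
  have hHρ : H (G ρ) = ρ := hmono.injective hinv.self_of_nhds
  have hHd : Differentiable ℝ H := hH.differentiable two_ne_zero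
  have hH1 : ContDiff ℝ 1 (deriv H) := ((contDiff_succ_iff_deriv (n := 1)).1 hH).2.2
  have hderiv : ∀ᶠ y in 𝓝 (G ρ), deriv H y = (G₁ (H y))⁻¹ := by
    filter_upwards [hinv.eventually_nhds] with y hy
    have h1 : HasDerivAt (fun y => G (H y)) (G₁ (H y) * deriv H y) y :=
      (hG₁ (H y)).comp y (hHd y).hasDerivAt
    have h2 : HasDerivAt (fun y => G (H y)) 1 y :=
      (hasDerivAt_id y).congr_of_eventuallyEq hy
    have h3 := h1.unique h2
    exact eq_inv_of_mul_eq_one_right h3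
  refine ⟨H, hH, hHρ, hinv, ?_, ?_⟩
  · rw [hderiv.self_of_nhds, hHρ, one_div]
  · have h1 : HasDerivAt (fun y => (G₁ (H y))⁻¹)
        (-(G₂ (H (G ρ)) * deriv H (G ρ)) / G₁ (H (G ρ)) ^ 2) (G ρ) :=
      ((hG₂ (H (G ρ))).comp (G ρ) (hHd (G ρ)).hasDerivAt).fun_inv (hpos _).ne'
    rw [(h1.congr_of_eventuallyEq hderiv).deriv, hderiv.self_of_nhds, hHρ]
    have := (hpos ρ).ne'
    field_simp

end ChangeOfUnknown

/-! ### Comparison for pairs of viscosity inequalities -/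

section Comparison

variable {n : ℕ}

/-- A test function for `G ∘ r` gives a test function for `r`. -/
theorem exists_testFunction {G G₁ G₂ : ℝ → ℝ} (hG₁ : ∀ x, HasDerivAt G (G₁ x) x)
    (hG₂ : ∀ x, HasDerivAt G₁ (G₂ x) x) (hG₂c : Continuous G₂) (hpos : ∀ x, 0 < G₁ x)
    {ψ : Space n × ℝ → ℝ} (hψ : ContDiff ℝ 2 ψ) {y : Space n × ℝ} {ρ : ℝ} (hρ : ψ y = G ρ) :
    ∃ φ : Space n × ℝ → ℝ, ContDiff ℝ 2 φ ∧ φ y = ρ ∧ (∀ᶠ z in 𝓝 y, G (φ z) = ψ z) ∧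
      spaceGrad φ y = (1 / G₁ ρ) • spaceGrad ψ y ∧
      heatOp φ y = heatOp ψ y / G₁ ρ + G₂ ρ / G₁ ρ ^ 3 * ‖spaceGrad ψ y‖ ^ 2 := by
  obtain ⟨H, hH, hHρ, hinv, h1, h2⟩ := exists_contDiff_localInverse hG₁ hG₂ hG₂c hpos ρ
  refine ⟨fun z => H (ψ z), hH.comp hψ, (congrArg H hρ).trans hHρ, ?_, ?_, ?_⟩
  · have : Tendsto ψ (𝓝 y) (𝓝 (G ρ)) := hρ ▸ hψ.continuous.tendsto y
    exact this hinv
  · rw [spaceGrad_comp hψ hH, hρ, h1]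
  · rw [heatOp_comp hψ hH, hρ, h1, h2]
    ring

/-- A test function for `r` of value `ρ` at `y`, obtained from the quadratic polynomial with slope
`q`, plus a function of time, for `G ∘ r`. -/
theorem exists_testFunction_quadPoly {G G₁ G₂ : ℝ → ℝ} (hG₁ : ∀ x, HasDerivAt G (G₁ x) x)
    (hG₂ : ∀ x, HasDerivAt G₁ (G₂ x) x) (hG₂c : Continuous G₂) (hpos : ∀ x, 0 < G₁ x)
    (y : Space n × ℝ) (ρ : ℝ) (q : SpaceTime n) (A : SpaceTime n →L[ℝ] SpaceTime n) (η : ℝ)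
    {θ : ℝ → ℝ} (hθ : ContDiff ℝ 2 θ) :
    ∃ φ : Space n × ℝ → ℝ, ContDiff ℝ 2 φ ∧ φ y = ρ ∧
      (∀ᶠ z in 𝓝 y, G (φ z) = quadPoly (G ρ - θ y.2) q A η (z - y) + θ z.2) ∧
      spaceGrad φ y = (1 / G₁ ρ) • q.fst ∧
      heatOp φ y = (q.snd + heatOp (fun h => 1 / 2 * ⟪A (toSpaceTime n h), toSpaceTime n h⟫) 0
        + η * heatOp (fun h : Space n × ℝ => ‖toSpaceTime n h‖ ^ 2) 0 + deriv θ y.2) / G₁ ρ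
        + G₂ ρ / G₁ ρ ^ 3 * ‖q.fst‖ ^ 2 := by
  have hθd : ContDiff ℝ 2 fun z : Space n × ℝ => θ z.2 := hθ.comp contDiff_snd
  have hp : ContDiff ℝ 2 fun z : Space n × ℝ => quadPoly (G ρ - θ y.2) q A η (z - y) :=
    (contDiff_quadPoly (G ρ - θ y.2) q A η).comp (contDiff_id.sub (contDiff_const (c := y)))
  have hψy : quadPoly (G ρ - θ y.2) q A η (y - y) + θ y.2 = G ρ := by
    simp [quadPoly]
  obtain ⟨φ, hφ, hφy, hφe, hφg, hφh⟩ :=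
    exists_testFunction hG₁ hG₂ hG₂c hpos (hp.add hθd) hψy
  have hg : spaceGrad (fun z : Space n × ℝ =>
      quadPoly (G ρ - θ y.2) q A η (z - y) + θ z.2) y = q.fst := by
    rw [spaceGrad_add hp hθd, spaceGrad_time, spaceGrad_comp_sub_right, sub_self,
      spaceGrad_quadPoly, add_zero]
  rw [hg] at hφg hφh
  rw [heatOp_add hp hθd, heatOp_time, heatOp_comp_sub_right, sub_self, heatOp_quadPoly] at hφh
  exact ⟨φ, hφ, hφy, hφe, hφg, hφh⟩

theorem norm_fst_le_spaceTime (h : SpaceTime n) : ‖h.fst‖ ≤ ‖h‖ := by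
  refine le_of_sq_le_sq ?_ (norm_nonneg _)
  rw [WithLp.prod_norm_sq_eq_of_L2]
  linarith [sq_nonneg ‖h.snd‖]

theorem abs_snd_le_spaceTime (h : SpaceTime n) : |h.snd| ≤ ‖h‖ := by
  rw [← Real.norm_eq_abs]
  refine le_of_sq_le_sq ?_ (norm_nonneg _)
  rw [WithLp.prod_norm_sq_eq_of_L2]
  linarith [sq_nonneg ‖h.fst‖]

set_option maxHeartbeats 1000000 in
/-- Comparison principle for viscosity sub- and supersolutions whose equation depends on the
value, the gradient and the heat operator of the unknown only. After the change of unknown `G`,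
the inequality `hpair` says that, at equal gradients, a subsolution cannot exceed a supersolution
by more than a zeroth order term. -/
theorem le_of_viscosity_pair {T : ℝ} {G G₁ G₂ : ℝ → ℝ} (hG₁ : ∀ x, HasDerivAt G (G₁ x) x)
    (hG₂ : ∀ x, HasDerivAt G₁ (G₂ x) x) (hG₂c : Continuous G₂) (hpos : ∀ x, 0 < G₁ x)
    {r s : Space n × ℝ → ℝ} (hr : ContinuousOn r (univ ×ˢ Icc 0 T))
    (hs : ContinuousOn s (univ ×ˢ Icc 0 T)) {SubP SupP : ℝ → Space n → ℝ → Prop}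
    (hsub : ∀ φ : Space n × ℝ → ℝ, ContDiff ℝ 2 φ → ∀ z : Space n × ℝ, z.2 ∈ Ioo 0 T →
      IsLocalMax (fun y => s y - φ y) z → s z = φ z → SubP (s z) (spaceGrad φ z) (heatOp φ z))
    (hsup : ∀ φ : Space n × ℝ → ℝ, ContDiff ℝ 2 φ → ∀ z : Space n × ℝ, z.2 ∈ Ioo 0 T →
      IsLocalMin (fun y => r y - φ y) z → r z = φ z → SupP (r z) (spaceGrad φ z) (heatOp φ z))
    (hpair : ∀ R S : ℝ, ∃ L : ℝ, 0 ≤ L ∧ ∀ ρ ∈ Icc R S, ∀ σ ∈ Icc R S, ρ < σ →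
      ∀ (p p' : Space n) (τ τ' : ℝ), SubP σ p τ → SupP ρ p' τ' →
        G₁ σ * τ - G₂ σ * ‖p‖ ^ 2 ≤ G₁ ρ * τ' - G₂ ρ * ‖p'‖ ^ 2 + L * (G σ - G ρ)
          + L * |‖G₁ σ • p‖ ^ 2 - ‖G₁ ρ • p'‖ ^ 2|)
    {M m₀ : ℝ} (hout : ∀ x ∉ Metric.ball (0 : Space n) M, ∀ t ∈ Icc 0 T,
      s (x, t) ≤ m₀ ∧ m₀ ≤ r (x, t))
    (h0 : ∀ x : Space n, s (x, 0) ≤ r (x, 0)) :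
    ∀ x : Space n, ∀ t ∈ Icc 0 T, s (x, t) ≤ r (x, t) := by
  suffices hmain : ∀ x : Space n, ∀ t ∈ Ico 0 T, s (x, t) ≤ r (x, t) by
    intro x t ht
    rcases eq_or_lt_of_le (ht.1.trans ht.2) with hT | hT
    · have : t = 0 := le_antisymm (hT ▸ ht.2) ht.1
      rw [this]; exact h0 x
    have hmaps : MapsTo (fun t : ℝ => (x, t)) (Icc 0 T) (univ ×ˢ Icc 0 T) :=
      fun t ht => ⟨mem_univ _, ht⟩
    have hc : ContinuousOn (fun t : ℝ => (x, t)) (Icc 0 T) := by fun_prop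
    refine ContinuousWithinAt.closure_le (s := Ico 0 T) (f := fun t => s (x, t))
      (g := fun t => r (x, t)) (by rwa [closure_Ico hT.ne]) ?_ ?_ (fun t ht => hmain x t ht)
    · exact ((hs.comp hc hmaps) t ht).mono Ico_subset_Icc_self
    · exact ((hr.comp hc hmaps) t ht).mono Ico_subset_Icc_self
  by_contra hcon
  push Not at hcon
  obtain ⟨x₁, t₁, ht₁, hlt₁⟩ := hcon
  have hT : 0 < T := ht₁.1.trans_lt ht₁.2
  have hmono : StrictMono G := strictMono_of_deriv_pos fun x => by rw [(hG₁ x).deriv]; exact hpos x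
  have hGc : Continuous G := continuous_iff_continuousAt.2 fun x => (hG₁ x).continuousAt
  have hx₁ : x₁ ∈ Metric.ball (0 : Space n) M := by
    by_contra hx
    have := hout x₁ hx t₁ ⟨ht₁.1, ht₁.2.le⟩
    linarith
  -- extension to all times, constant before `0` and after `T`
  set cl : ℝ → ℝ := fun t => max 0 (min t T) with hcl
  have hclm : ∀ t, cl t ∈ Icc 0 T := fun t =>
    ⟨le_max_left _ _, max_le hT.le (min_le_right _ _)⟩
  have hcle : ∀ t ∈ Icc 0 T, cl t = t := fun t ht => by
    simp only [hcl]; rw [min_eq_left ht.2, max_eq_right ht.1]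
  have hclc : Continuous fun z : Space n × ℝ => (z.1, cl z.2) := by fun_prop
  set u : Space n × ℝ → ℝ := fun z => G (s (z.1, cl z.2)) with hu
  set w : Space n × ℝ → ℝ := fun z => G (r (z.1, cl z.2)) with hw
  have huc : Continuous u := hGc.comp
    (hs.comp_continuous hclc fun z => ⟨mem_univ _, hclm _⟩)
  have hwc : Continuous w := hGc.comp
    (hr.comp_continuous hclc fun z => ⟨mem_univ _, hclm _⟩)
  have hue : ∀ z : Space n × ℝ, z.2 ∈ Icc 0 T → u z = G (s z) := fun z hz => by
    simp only [hu]; rw [hcle _ hz]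
  have hwe : ∀ z : Space n × ℝ, z.2 ∈ Icc 0 T → w z = G (r z) := fun z hz => by
    simp only [hw]; rw [hcle _ hz]
  set Q : Set (Space n × ℝ) := Metric.closedBall 0 M ×ˢ Icc 0 T with hQ
  have hQc : IsCompact Q := (isCompact_closedBall _ _).prod isCompact_Icc
  have hQs : Q ⊆ univ ×ˢ Icc 0 T := fun z hz => ⟨mem_univ _, hz.2⟩
  obtain ⟨S, hS⟩ : ∃ S, ∀ x, ∀ t ∈ Icc 0 T, s (x, t) ≤ S := by
    obtain ⟨S, hS⟩ := hQc.bddAbove_image (hs.mono hQs)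
    refine ⟨max S m₀, fun x t ht => ?_⟩
    by_cases hx : x ∈ Metric.ball (0 : Space n) M
    · exact le_max_of_le_left (hS (mem_image_of_mem _ ⟨Metric.ball_subset_closedBall hx, ht⟩))
    · exact le_max_of_le_right (hout x hx t ht).1
  obtain ⟨R, hR⟩ : ∃ R, ∀ x, ∀ t ∈ Icc 0 T, R ≤ r (x, t) := by
    obtain ⟨R, hR⟩ := hQc.bddBelow_image (hr.mono hQs)
    refine ⟨min R m₀, fun x t ht => ?_⟩
    by_cases hx : x ∈ Metric.ball (0 : Space n) M
    · exact min_le_of_left_le (hR (mem_image_of_mem _ ⟨Metric.ball_subset_closedBall hx, ht⟩))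
    · exact min_le_of_right_le (hout x hx t ht).2
  have huS : ∀ z, u z ≤ G S := fun z => hmono.monotone (hS _ _ (hclm _))
  have hwR : ∀ z, G R ≤ w z := fun z => hmono.monotone (hR _ _ (hclm _))
  obtain ⟨L, hL0, hL⟩ := hpair R S
  set d := u (x₁, t₁) - w (x₁, t₁) with hd
  have hd0 : 0 < d := by
    rw [hd, hue _ ⟨ht₁.1, ht₁.2.le⟩, hwe _ ⟨ht₁.1, ht₁.2.le⟩]
    exact sub_pos.2 (hmono hlt₁)
  have hTt : 0 < T - t₁ := sub_pos.2 ht₁.2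
  -- `l` is so large that the maximum below is not attained at time `T`
  obtain ⟨l, hlL, hl⟩ : ∃ l : ℝ, L + 1 ≤ l ∧ (G S - G R) < d * Real.exp (l * (T - t₁)) := by
    refine ⟨max (L + 1) ((G S - G R) / (d * (T - t₁))), le_max_left _ _, ?_⟩
    have h1 := Real.add_one_le_exp (max (L + 1) ((G S - G R) / (d * (T - t₁))) * (T - t₁))
    have h2 := le_max_right (L + 1) ((G S - G R) / (d * (T - t₁)))
    rw [div_le_iff₀ (by positivity)] at h2
    nlinarith
  have hl0 : 0 < l := by linarith
  obtain ⟨z₀, hz₀Q, hz₀⟩ := hQc.exists_isMaxOn ⟨(x₁, t₁), Metric.ball_subset_closedBall hx₁,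
    ht₁.1, ht₁.2.le⟩ (f := fun z => Real.exp (-(l * z.2)) * (u z - w z)) (by fun_prop)
  set m := Real.exp (-(l * z₀.2)) * (u z₀ - w z₀) with hm
  have hmd : Real.exp (-(l * t₁)) * d ≤ m :=
    hz₀ (show (x₁, t₁) ∈ Q from ⟨Metric.ball_subset_closedBall hx₁, ht₁.1, ht₁.2.le⟩)
  have hm0 : 0 < m := lt_of_lt_of_le (by positivity) hmd
  set θ : ℝ → ℝ := fun t => m * Real.exp (l * t) with hθ
  have hθpos : ∀ t, 0 < θ t := fun t => by simp only [hθ]; positivity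
  have hexp : ∀ t, Real.exp (l * t) * Real.exp (-(l * t)) = 1 := fun t => by
    rw [← Real.exp_add, add_neg_cancel, Real.exp_zero]
  have hQle : ∀ z ∈ Q, u z - w z ≤ θ z.2 := fun z hz => by
    have h1 : Real.exp (-(l * z.2)) * (u z - w z) ≤ m := hz₀ hz
    have h2 := mul_le_mul_of_nonneg_left h1 (Real.exp_pos (l * z.2)).le
    rw [← mul_assoc, hexp, one_mul] at h2
    simp only [hθ]; linarith
  have hz₀e : u z₀ - w z₀ = θ z₀.2 := by
    simp only [hθ, hm]
    linear_combination (-(u z₀ - w z₀)) * hexp z₀.2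
  have hneg : ∀ z : Space n × ℝ, ¬ (z.1 ∈ Metric.ball (0 : Space n) M ∧ z.2 ∈ Ioo 0 T) →
      u z - w z < θ z.2 := by
    intro z hz
    by_cases hx : z.1 ∈ Metric.ball (0 : Space n) M
    · rcases le_or_gt z.2 0 with ht | ht
      · have h1 : cl z.2 = 0 := by
          simp only [hcl]
          rw [min_eq_left (ht.trans hT.le), max_eq_left ht]
        have h2 : u z ≤ w z := by
          simp only [hu, hw, h1]
          exact hmono.monotone (h0 _)
        linarith [hθpos z.2]
      · have ht' : T ≤ z.2 := by
          by_contra hc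
          exact hz ⟨hx, ht, not_le.1 hc⟩
        have h1 : d * Real.exp (l * (T - t₁)) ≤ θ z.2 := by
          have h3 : d * Real.exp (l * (T - t₁))
              = Real.exp (-(l * t₁)) * d * Real.exp (l * T) := by
            rw [mul_comm (Real.exp _) d, mul_assoc, ← Real.exp_add]
            ring_nf
          rw [h3]
          simp only [hθ]
          gcongr
        linarith [huS z, hwR z]
    · have h1 := hout z.1 hx (cl z.2) (hclm _)
      have h2 : u z ≤ w z := hmono.monotone (h1.1.trans h1.2)
      linarith [hθpos z.2]
  have hall : ∀ z, u z - w z ≤ θ z.2 := fun z => by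
    by_cases hz : z.1 ∈ Metric.ball (0 : Space n) M ∧ z.2 ∈ Ioo 0 T
    · exact hQle z ⟨Metric.ball_subset_closedBall hz.1, Ioo_subset_Icc_self hz.2⟩
    · exact (hneg z hz).le
  -- transfer to Euclidean space-time
  set ι := toSpaceTime n with hι
  set K : Set (SpaceTime n) := ι '' (Metric.closedBall 0 (M + 1) ×ˢ Icc (-1) (T + 1)) with hK
  set O : Set (SpaceTime n) := ι.symm ⁻¹' (Metric.ball 0 M ×ˢ Ioo 0 T) with hO
  have hKc : IsCompact K :=
    ((isCompact_closedBall _ _).prod isCompact_Icc).image ι.continuous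
  have hOo : IsOpen O :=
    (Metric.isOpen_ball.prod isOpen_Ioo).preimage ι.symm.continuous
  have hOK : ∀ z ∈ O, Metric.closedBall z 1 ⊆ K := by
    intro z hz y hy
    rw [Metric.mem_closedBall, dist_eq_norm] at hy
    refine ⟨ι.symm y, ⟨?_, ?_⟩, ι.apply_symm_apply y⟩
    · have h1 : ‖(y - z).fst‖ ≤ 1 := (norm_fst_le_spaceTime _).trans hy
      have h2 : ‖z.fst‖ < M := mem_ball_zero_iff.1 hz.1
      rw [mem_closedBall_zero_iff]
      change ‖y.fst‖ ≤ M + 1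
      have h3 : ‖y.fst‖ ≤ ‖(y - z).fst‖ + ‖z.fst‖ := by
        rw [WithLp.sub_fst]
        simpa using norm_add_le (y.fst - z.fst) z.fst
      linarith
    · have h1 := abs_le.1 ((abs_snd_le_spaceTime (y - z)).trans hy)
      rw [WithLp.sub_snd] at h1
      have h2 : z.snd ∈ Ioo 0 T := hz.2
      change y.snd ∈ Icc (-1) (T + 1)
      exact ⟨by linarith [h2.1, h1.1], by linarith [h2.2, h1.2]⟩
  set κ := m / (4 * (L + 1)) with hκ
  have hκ0 : 0 < κ := by positivity
  have hθc : Continuous θ := by fun_prop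
  obtain ⟨B, hB⟩ := exists_touching_quadratics hKc hOo hOK
    (U := fun z => u (ι.symm z) - θ (ι.symm z).2) (W := fun z => w (ι.symm z))
    ((huc.comp ι.symm.continuous).sub
      (hθc.comp (continuous_snd.comp ι.symm.continuous)))
    (hwc.comp ι.symm.continuous) (b := G R) (b' := G S)
    (fun z => by linarith [huS (ι.symm z), hθpos (ι.symm z).2]) (fun z => hwR _)
    (fun z _ => by linarith [hall (ι.symm z)])
    (fun z hz => by linarith [hneg (ι.symm z) hz.2]) (z₀ := ι z₀)
    ⟨z₀, ⟨Metric.closedBall_subset_closedBall (by linarith) hz₀Q.1,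
      ⟨by linarith [hz₀Q.2.1], by linarith [hz₀Q.2.2]⟩⟩, rfl⟩
    (by simp only [ι.symm_apply_apply]; linarith) hκ0
  set N := heatOp (fun h : Space n × ℝ => ‖toSpaceTime n h‖ ^ 2) 0 with hN
  set η := m / (4 * (1 + 2 * |N| + 2 * L * |B|)) with hη
  have hη0 : 0 < η := by positivity
  obtain ⟨y₁, hy₁, y₂, hy₂, q₁, q₂, A, hq₁, hq₂, hq, hκ', hup, hlow⟩ := hB η hη0
  set a := ι.symm y₁ with ha
  set b := ι.symm y₂ with hb
  have ha2 : a.2 ∈ Ioo 0 T := hy₁.2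
  have hb2 : b.2 ∈ Ioo 0 T := hy₂.2
  have hua := hue a (Ioo_subset_Icc_self ha2)
  have hwb := hwe b (Ioo_subset_Icc_self hb2)
  have hT0 : ∀ y : Space n × ℝ, Tendsto (fun z => ι (z - y)) (𝓝 y) (𝓝 0) := fun y => by
    have : Continuous fun z : Space n × ℝ => ι (z - y) := by fun_prop
    simpa using this.tendsto y
  have hIoo : ∀ y : Space n × ℝ, y.2 ∈ Ioo 0 T → ∀ᶠ z : Space n × ℝ in 𝓝 y, z.2 ∈ Icc 0 T :=
    fun y hy => (continuous_snd.tendsto y).eventually (Icc_mem_nhds hy.1 hy.2)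
  set KA := heatOp (fun h : Space n × ℝ => 1 / 2 * ⟪A (toSpaceTime n h), toSpaceTime n h⟫) 0
    with hKA
  -- the subsolution
  have hθd : ContDiff ℝ 2 θ := by
    simp only [hθ]; fun_prop
  have hSub : SubP (s a) ((1 / G₁ (s a)) • q₁.fst)
      ((q₁.snd + KA + η * N + l * θ a.2) / G₁ (s a)
        + G₂ (s a) / G₁ (s a) ^ 3 * ‖q₁.fst‖ ^ 2) := by
    obtain ⟨φ, hφ, hφa, hφe, hφg, hφh⟩ :=
      exists_testFunction_quadPoly hG₁ hG₂ hG₂c hpos a (s a) q₁ A η hθd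
    have hdθ : deriv θ a.2 = l * θ a.2 := by
      have : HasDerivAt θ (m * (Real.exp (l * a.2) * (l * 1))) a.2 :=
        (((hasDerivAt_id a.2).const_mul l).exp).const_mul m
      rw [this.deriv]
      simp only [hθ]; ring
    have := hsub φ hφ a ha2 ?_ hφa.symm
    · rwa [hφg, hφh, hdθ] at this
    · filter_upwards [hφe, (hT0 a).eventually hup, hIoo a ha2] with z h1 h2 h3
      rw [hφa, sub_self, sub_nonpos]
      refine hmono.le_iff_le.1 ?_
      rw [h1]
      have e1 : ι.symm (y₁ + ι (z - a)) = z := by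
        rw [map_add, ι.symm_apply_apply, ← ha]; abel
      have h4 := hue z h3
      rw [e1] at h2
      rw [quadPoly]
      linarith
  have hSup : SupP (r b) ((1 / G₁ (r b)) • q₂.fst)
      ((q₂.snd + KA + (-η) * N) / G₁ (r b)
        + G₂ (r b) / G₁ (r b) ^ 3 * ‖q₂.fst‖ ^ 2) := by
    obtain ⟨φ, hφ, hφb, hφe, hφg, hφh⟩ :=
      exists_testFunction_quadPoly hG₁ hG₂ hG₂c hpos b (r b) q₂ A (-η)
        (θ := fun _ => 0) contDiff_const
    have := hsup φ hφ b hb2 ?_ hφb.symm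
    · rwa [hφg, hφh, deriv_const, add_zero] at this
    · filter_upwards [hφe, (hT0 b).eventually hlow, hIoo b hb2] with z h1 h2 h3
      rw [hφb, sub_self, sub_nonneg]
      refine hmono.le_iff_le.1 ?_
      rw [h1]
      have e1 : ι.symm (y₂ + ι (z - b)) = z := by
        rw [map_add, ι.symm_apply_apply, ← hb]; abel
      have h4 := hwe z h3
      rw [e1] at h2
      rw [quadPoly]
      linarith
  -- the contradiction
  have hθm : m ≤ θ a.2 := by
    simp only [hθ]
    have := Real.one_le_exp (mul_nonneg hl0.le ha2.1.le)
    nlinarith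
  have hLκ : (L + 1) * κ = m / 4 := by rw [hκ]; field_simp
  obtain ⟨k1, k2⟩ := abs_le.1 hκ'
  have hκm : κ ≤ m / 4 := by linarith [mul_nonneg hL0 hκ0.le]
  have hGab : G (r b) < G (s a) := by linarith
  have hrs : r b < s a := hmono.lt_iff_lt.1 hGab
  have hbI : b.2 ∈ Icc 0 T := Ioo_subset_Icc_self hb2
  have haI : a.2 ∈ Icc 0 T := Ioo_subset_Icc_self ha2
  have hRb := hR b.1 b.2 hbI
  have hSa := hS a.1 a.2 haI
  have hfin := hL (r b) ⟨hRb, hrs.le.trans hSa⟩ (s a) ⟨hRb.trans hrs.le, hSa⟩ hrs _ _ _ _ hSub hSup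
  have hGa := (hpos (s a)).ne'
  have hGb := (hpos (r b)).ne'
  have en : ∀ (c : ℝ) (q : Space n), c ≠ 0 → c • ((1 / c) • q) = q := fun c q hc => by
    rw [smul_smul, mul_one_div_cancel hc, one_smul]
  have en2 : ∀ (c : ℝ) (q : Space n), ‖(1 / c) • q‖ ^ 2 = ‖q‖ ^ 2 / c ^ 2 := fun c q => by
    rw [norm_smul, mul_pow, Real.norm_eq_abs, sq_abs]
    ring
  rw [en _ _ hGa, en _ _ hGb, en2, en2] at hfin
  have e1 : ∀ c c₂ x n2 : ℝ, c ≠ 0 → c * (x / c + c₂ / c ^ 3 * n2) - c₂ * (n2 / c ^ 2) = x :=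
    fun c c₂ x n2 hc => by field_simp; ring
  rw [e1 _ _ _ _ hGa, e1 _ _ _ _ hGb] at hfin
  have hqf : |‖q₁.fst‖ ^ 2 - ‖q₂.fst‖ ^ 2| ≤ 2 * |B| * η := by
    have h1 : |‖q₁.fst‖ - ‖q₂.fst‖| ≤ η := by
      refine (abs_norm_sub_norm_le _ _).trans ?_
      rw [← WithLp.sub_fst]
      exact (norm_fst_le_spaceTime _).trans hq
    have h2 : |‖q₁.fst‖ + ‖q₂.fst‖| ≤ 2 * |B| := by
      rw [abs_of_nonneg (by positivity)]
      have := (norm_fst_le_spaceTime q₁).trans (hq₁.trans (le_abs_self B))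
      have := (norm_fst_le_spaceTime q₂).trans (hq₂.trans (le_abs_self B))
      linarith
    rw [sq_sub_sq, abs_mul]
    exact mul_le_mul h2 h1 (abs_nonneg _) (by positivity)
  have hsnd : |q₁.snd - q₂.snd| ≤ η := by
    rw [← WithLp.sub_snd]
    exact (abs_snd_le_spaceTime _).trans hq
  have h1 := (abs_le.1 hsnd).1
  have h2 : -(η * |N|) ≤ η * N := by nlinarith [neg_abs_le N]
  have h3 : L * |‖q₁.fst‖ ^ 2 - ‖q₂.fst‖ ^ 2| ≤ L * (2 * |B| * η) := by gcongr
  have h4 : L * (G (s a) - G (r b)) ≤ L * (θ a.2 + κ) :=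
    mul_le_mul_of_nonneg_left (by linarith) hL0
  have h5 : (L + 1) * θ a.2 ≤ l * θ a.2 := mul_le_mul_of_nonneg_right hlL (hθpos _).le
  have h6 : η * (1 + 2 * |N| + 2 * L * |B|) = m / 4 := by rw [hη]; field_simp
  linarith

end Comparison

/-! ### The third component and the kinetic energy of a control map -/

section ControlMaps

/-- The polynomial `Y² + 2 m Y + C`: for suitable `m` and `C`, the square of the common
denominator of the components of a control map, as a function of `Y = exp (2 ν ρ)`. -/
def denPoly (m C Y : ℝ) : ℝ := Y ^ 2 + 2 * m * Y + C

/-- The third component of a control map. -/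
noncomputable def profile (k ν m C ρ : ℝ) : ℝ :=
  k * Real.exp (ν * ρ) / √(denPoly m C (Real.exp (2 * ν * ρ)))

theorem hasDerivAt_exp_two_mul (ν ρ : ℝ) :
    HasDerivAt (fun ρ => Real.exp (2 * ν * ρ)) (2 * ν * Real.exp (2 * ν * ρ)) ρ := by
  refine ((hasDerivAt_id' ρ).const_mul (2 * ν)).exp.congr_deriv ?_
  ring

theorem hasDerivAt_denPoly (ν m C ρ : ℝ) :
    HasDerivAt (fun ρ => denPoly m C (Real.exp (2 * ν * ρ)))
      (4 * ν * Real.exp (2 * ν * ρ) * (Real.exp (2 * ν * ρ) + m)) ρ := by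
  have h := hasDerivAt_exp_two_mul ν ρ
  refine (((h.fun_pow 2).fun_add (h.const_mul (2 * m))).add_const C).congr_deriv ?_
  push_cast; ring

theorem hasDerivAt_sqrt_denPoly {ν m C ρ : ℝ} (hP : 0 < denPoly m C (Real.exp (2 * ν * ρ))) :
    HasDerivAt (fun ρ => √(denPoly m C (Real.exp (2 * ν * ρ))))
      (2 * ν * Real.exp (2 * ν * ρ) * (Real.exp (2 * ν * ρ) + m)
        / √(denPoly m C (Real.exp (2 * ν * ρ)))) ρ := by
  refine ((hasDerivAt_denPoly ν m C ρ).sqrt hP.ne').congr_deriv ?_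
  have := (Real.sqrt_pos.2 hP).ne'
  field_simp
  ring

theorem hasDerivAt_profile {k ν m C ρ : ℝ} (hP : 0 < denPoly m C (Real.exp (2 * ν * ρ))) :
    HasDerivAt (profile k ν m C) (profile k ν m C ρ * (ν * (C - Real.exp (2 * ν * ρ) ^ 2)
      / denPoly m C (Real.exp (2 * ν * ρ)))) ρ := by
  have h1 := ((hasDerivAt_id' ρ).const_mul ν).exp.const_mul k
  have h2 := h1.fun_div (hasDerivAt_sqrt_denPoly hP) (Real.sqrt_pos.2 hP).ne'
  have h3 := (Real.sqrt_pos.2 hP).ne'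
  have h4 := Real.sq_sqrt hP.le
  refine h2.congr_deriv ?_
  unfold profile
  set Y := Real.exp (2 * ν * ρ)
  set D := √(denPoly m C Y) with hD
  rw [← h4]
  field_simp
  rw [h4, denPoly]
  ring

theorem hasDerivAt_deriv_profile {k ν m C ρ : ℝ} (hP : ∀ Y, 0 < Y → 0 < denPoly m C Y) :
    HasDerivAt (deriv (profile k ν m C)) (profile k ν m C ρ * (ν ^ 2
      * ((C - Real.exp (2 * ν * ρ) ^ 2) ^ 2 - 4 * Real.exp (2 * ν * ρ)
        * (Real.exp (2 * ν * ρ) * denPoly m C (Real.exp (2 * ν * ρ))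
          + (C - Real.exp (2 * ν * ρ) ^ 2) * (Real.exp (2 * ν * ρ) + m)))
      / denPoly m C (Real.exp (2 * ν * ρ)) ^ 2)) ρ := by
  have hd : deriv (profile k ν m C) = fun ρ => profile k ν m C ρ
      * (ν * (C - Real.exp (2 * ν * ρ) ^ 2) / denPoly m C (Real.exp (2 * ν * ρ))) :=
    funext fun ρ => (hasDerivAt_profile (hP _ (Real.exp_pos _))).deriv
  rw [hd]
  have h0 := hP _ (Real.exp_pos (2 * ν * ρ))
  have h1 := ((((hasDerivAt_exp_two_mul ν ρ).fun_pow 2).const_sub C).const_mul ν).fun_div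
    (hasDerivAt_denPoly ν m C ρ) h0.ne'
  refine ((hasDerivAt_profile (k := k) h0).fun_mul h1).congr_deriv ?_
  push_cast
  field_simp
  ring

theorem iteratedDeriv_two_profile {k ν m C ρ : ℝ} (hP : ∀ Y, 0 < Y → 0 < denPoly m C Y) :
    iteratedDeriv 2 (profile k ν m C) ρ = profile k ν m C ρ * (ν ^ 2
      * ((C - Real.exp (2 * ν * ρ) ^ 2) ^ 2 - 4 * Real.exp (2 * ν * ρ)
        * (Real.exp (2 * ν * ρ) * denPoly m C (Real.exp (2 * ν * ρ))
          + (C - Real.exp (2 * ν * ρ) ^ 2) * (Real.exp (2 * ν * ρ) + m)))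
      / denPoly m C (Real.exp (2 * ν * ρ)) ^ 2) := by
  rw [iteratedDeriv_succ, iteratedDeriv_one]
  exact (hasDerivAt_deriv_profile hP).deriv

theorem profile_sq {k ν m C ρ : ℝ} (hP : 0 < denPoly m C (Real.exp (2 * ν * ρ))) :
    profile k ν m C ρ ^ 2
      = k ^ 2 * Real.exp (2 * ν * ρ) / denPoly m C (Real.exp (2 * ν * ρ)) := by
  rw [profile, div_pow, Real.sq_sqrt hP.le, mul_pow, ← Real.exp_nat_mul]
  congr 3
  push_cast; ring_nf

/-- The parameters of a control map: `c` and `s` are the cosine and the sine of `ε²` for the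
first map, and `1` and `0` for the second one. -/
structure IsParam (α β c s m C : ℝ) : Prop where
  sq_add_sq : c ^ 2 + s ^ 2 = 1
  m_eq : m = α + β / 2
  C_eq : C = β ^ 2 / 4 + α * (α + β) * s ^ 2

namespace IsParam
variable {α β c s m C : ℝ}

theorem denPoly_eq (h : IsParam α β c s m C) (Y : ℝ) : denPoly m C Y =
    (Y - β / 2 + (α + β) * s ^ 2) ^ 2 + (α + β) ^ 2 * s ^ 2 * c ^ 2
      + 2 * (α + β) * c ^ 2 * Y := by
  have hc : c ^ 2 = 1 - s ^ 2 := by linarith [h.sq_add_sq]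
  rw [denPoly, h.m_eq, h.C_eq, hc]
  ring

theorem denPoly_pos (h : IsParam α β c s m C) (hc : c ≠ 0) (hαβ : 0 < α + β) {Y : ℝ}
    (hY : 0 < Y) : 0 < denPoly m C Y := by
  rw [h.denPoly_eq]
  positivity

/-- The zeroth order coefficient of the second reduced equation. -/
theorem potential_eq (h : IsParam α β c s m C) (hc : c ≠ 0) (hαβ : 0 < α + β)
    {ε k μ ν ρ : ℝ} (hε : 1 / ε ^ 2 = μ ^ 2 / (α + β)) (hk : k ^ 2 = 2 * (α + β) * c ^ 2) :
    1 / ε ^ 2 * (profile k ν m C ρ * (1 - profile k ν m C ρ ^ 2)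
      * (α + β - 2 * α * profile k ν m C ρ ^ 2)) = profile k ν m C ρ * (μ ^ 2
      * (denPoly m C (Real.exp (2 * ν * ρ)) - 2 * (α + β) * c ^ 2 * Real.exp (2 * ν * ρ))
      * (denPoly m C (Real.exp (2 * ν * ρ)) - 4 * α * c ^ 2 * Real.exp (2 * ν * ρ))
      / denPoly m C (Real.exp (2 * ν * ρ)) ^ 2) := by
  have h0 := h.denPoly_pos hc hαβ (Real.exp_pos (2 * ν * ρ))
  rw [hε, profile_sq h0, hk]
  field_simp
  ring

/-- Given the kinetic energy `|v'|²`, the coefficients `b` and `c` of the second reduced equation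
agree: the control maps are stationary solutions. -/
theorem second_coefficient_eq (h : IsParam α β c s m C) (hc : c ≠ 0) (hαβ : 0 < α + β)
    {k μ ν ρ : ℝ} (hν : ν = μ * c) :
    iteratedDeriv 2 (profile k ν m C) ρ
      + μ ^ 2 * (s ^ 2 + 2 * (α + β) * c ^ 2 * Real.exp (2 * ν * ρ)
        * (denPoly m C (Real.exp (2 * ν * ρ)) - 2 * α * c ^ 2 * Real.exp (2 * ν * ρ))
        / denPoly m C (Real.exp (2 * ν * ρ)) ^ 2) * profile k ν m C ρ
      = profile k ν m C ρ * (μ ^ 2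
      * (denPoly m C (Real.exp (2 * ν * ρ)) - 2 * (α + β) * c ^ 2 * Real.exp (2 * ν * ρ))
      * (denPoly m C (Real.exp (2 * ν * ρ)) - 4 * α * c ^ 2 * Real.exp (2 * ν * ρ))
      / denPoly m C (Real.exp (2 * ν * ρ)) ^ 2) := by
  rw [iteratedDeriv_two_profile (fun Y hY => h.denPoly_pos hc hαβ hY)]
  have h0 := h.denPoly_pos hc hαβ (Real.exp_pos (2 * ν * ρ))
  set Y := Real.exp (2 * ν * ρ)
  set P := denPoly m C Y with hP
  have hs : s ^ 2 = 1 - c ^ 2 := by linarith [h.sq_add_sq]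
  have key : c ^ 2 * ((C - Y ^ 2) ^ 2 - 4 * Y * (Y * P + (C - Y ^ 2) * (Y + m))) + s ^ 2 * P ^ 2
      + 2 * (α + β) * c ^ 2 * Y * (P - 2 * α * c ^ 2 * Y)
      = (P - 2 * (α + β) * c ^ 2 * Y) * (P - 4 * α * c ^ 2 * Y) := by
    rw [hP, denPoly, h.m_eq, h.C_eq, hs]
    ring
  rw [hν]
  field_simp
  linear_combination μ ^ 2 * profile k (μ * c) m C ρ * key

end IsParam

theorem hasDerivAt_coord {v : ℝ → EuclideanSpace ℝ (Fin 3)} (hv : ContDiff ℝ 2 v) (i : Fin 3)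
    (ρ : ℝ) : HasDerivAt (fun σ => v σ i) (deriv v ρ i) ρ :=
  (EuclideanSpace.proj (𝕜 := ℝ) i).hasFDerivAt.comp_hasDerivAt ρ
    (hv.differentiable two_ne_zero ρ).hasDerivAt

theorem hasDerivAt_deriv_coord {v : ℝ → EuclideanSpace ℝ (Fin 3)} (hv : ContDiff ℝ 2 v)
    (i : Fin 3) (ρ : ℝ) :
    HasDerivAt (deriv fun σ => v σ i) (iteratedDeriv 2 (fun σ => v σ i) ρ) ρ := by
  have h1 : ContDiff ℝ 2 fun σ => v σ i := (EuclideanSpace.proj (𝕜 := ℝ) i).contDiff.comp hv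
  have h2 : ContDiff ℝ 1 (deriv fun σ => v σ i) := ((contDiff_succ_iff_deriv (n := 1)).1 h1).2.2
  rw [iteratedDeriv_succ, iteratedDeriv_one]
  exact (h2.differentiable one_ne_zero ρ).hasDerivAt

theorem norm_deriv_sq {v : ℝ → EuclideanSpace ℝ (Fin 3)} (hv : ContDiff ℝ 2 v) (ρ : ℝ) :
    ‖deriv v ρ‖ ^ 2 = deriv (fun σ => v σ 0) ρ ^ 2 + deriv (fun σ => v σ 1) ρ ^ 2
      + deriv (fun σ => v σ 2) ρ ^ 2 := by
  rw [EuclideanSpace.norm_sq_eq, Fin.sum_univ_three]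
  simp only [Real.norm_eq_abs, sq_abs, (hasDerivAt_coord hv _ ρ).deriv]

/-- If the coefficient `a` of the first reduced equation is constant, the equation is the heat
equation. -/
theorem firstEquation_b_eq_zero {v : ℝ → EuclideanSpace ℝ (Fin 3)} (hv : ContDiff ℝ 2 v) {a₀ : ℝ}
    (ha : ∀ ρ, (firstEquation v).a ρ = a₀) (ρ : ℝ) : (firstEquation v).b ρ = 0 := by
  have h : ∀ i ρ, HasDerivAt (fun σ => v σ i) (deriv (fun σ => v σ i) ρ) ρ := fun i ρ =>
    (hasDerivAt_coord hv i ρ).differentiableAt.hasDerivAt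
  have h1 := ((h 1 ρ).fun_mul (hasDerivAt_deriv_coord hv 0 ρ)).fun_sub
    ((h 0 ρ).fun_mul (hasDerivAt_deriv_coord hv 1 ρ))
  have h2 : HasDerivAt (fun ρ => v ρ 1 * deriv (fun σ => v σ 0) ρ
      - v ρ 0 * deriv (fun σ => v σ 1) ρ) 0 ρ := by
    have : (fun ρ => v ρ 1 * deriv (fun σ => v σ 0) ρ
      - v ρ 0 * deriv (fun σ => v σ 1) ρ) = fun _ => a₀ := funext ha
    rw [this]
    exact hasDerivAt_const _ _
  have h3 := h1.unique h2
  simp only [firstEquation]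
  linarith

/-- On the sphere, the kinetic energy is determined by the third component and the angular
momentum. -/
theorem one_sub_sq_mul_norm_deriv_sq {v : ℝ → EuclideanSpace ℝ (Fin 3)} (hv : ContDiff ℝ 2 v)
    (hs : ∀ ρ, ‖v ρ‖ = 1) (ρ : ℝ) : (1 - v ρ 2 ^ 2) * ‖deriv v ρ‖ ^ 2
      = (firstEquation v).a ρ ^ 2 + deriv (fun σ => v σ 2) ρ ^ 2 := by
  have hsum : ∀ ρ, v ρ 0 ^ 2 + v ρ 1 ^ 2 + v ρ 2 ^ 2 = 1 := fun ρ => by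
    have := EuclideanSpace.norm_sq_eq (v ρ)
    rw [hs ρ, Fin.sum_univ_three] at this
    simp only [Real.norm_eq_abs, sq_abs] at this
    linarith
  have h : ∀ i, HasDerivAt (fun σ => v σ i) (deriv (fun σ => v σ i) ρ) ρ := fun i =>
    (hasDerivAt_coord hv i ρ).differentiableAt.hasDerivAt
  have h1 := (((h 0).fun_pow 2).fun_add ((h 1).fun_pow 2)).fun_add ((h 2).fun_pow 2)
  have h2 := h1.unique (by
    have : (fun ρ => v ρ 0 ^ 2 + v ρ 1 ^ 2 + v ρ 2 ^ 2) = fun _ => (1 : ℝ) := funext hsum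
    rw [this]
    exact hasDerivAt_const _ _)
  rw [norm_deriv_sq hv]
  simp only [firstEquation]
  push_cast at h2
  simp only [pow_one] at h2
  have h3 := hsum ρ
  generalize deriv (fun σ => v σ 0) ρ = x at *
  generalize deriv (fun σ => v σ 1) ρ = y at *
  generalize deriv (fun σ => v σ 2) ρ = z at *
  have h4 : v ρ 0 * x + v ρ 1 * y = -(v ρ 2 * z) := by linarith
  have h5 : 1 - v ρ 2 ^ 2 = v ρ 0 ^ 2 + v ρ 1 ^ 2 := by linarith
  have h6 : (1 - v ρ 2 ^ 2) * z ^ 2 = z ^ 2 - (v ρ 0 * x + v ρ 1 * y) ^ 2 := by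
    rw [h4]; ring
  have h7 : (1 - v ρ 2 ^ 2) * (x ^ 2 + y ^ 2)
      = (v ρ 1 * x - v ρ 0 * y) ^ 2 + (v ρ 0 * x + v ρ 1 * y) ^ 2 := by
    rw [h5]; ring
  rw [mul_add, h6, h7]
  ring

end ControlMaps

/-! ### The reduced equations for the control maps -/

section ControlMapFormulas

theorem isParam_I (α β ε : ℝ) : IsParam α β (Real.cos (ε ^ 2)) (Real.sin (ε ^ 2)) (α + β / 2)
    (β ^ 2 / 4 + α * (α + β) * Real.sin (ε ^ 2) ^ 2) where
  sq_add_sq := Real.cos_sq_add_sin_sq _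
  m_eq := rfl
  C_eq := rfl

theorem isParam_II (α β : ℝ) : IsParam α β 1 0 (α + β / 2) (β ^ 2 / 4) where
  sq_add_sq := by norm_num
  m_eq := rfl
  C_eq := by ring

theorem denI_eq (α β ε ρ : ℝ) : denI α β ε ρ = √(denPoly (α + β / 2)
    (β ^ 2 / 4 + α * (α + β) * Real.sin (ε ^ 2) ^ 2)
    (Real.exp (2 * (mu α β ε * Real.cos (ε ^ 2)) * ρ))) := by
  rw [denI]
  have h1 : 2 * mu α β ε * ρ * Real.cos (ε ^ 2) = 2 * (mu α β ε * Real.cos (ε ^ 2)) * ρ := by ring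
  rw [h1, Real.cos_sq', denPoly]
  congr 1
  ring

theorem denII_eq (α β ε ρ : ℝ) : denII α β ε ρ = √(denPoly (α + β / 2) (β ^ 2 / 4)
    (Real.exp (2 * mu α β ε * ρ))) := by
  rw [denII, denPoly]
  congr 1
  ring

theorem controlMapI_two (α β ε : ℝ) : (fun σ => controlMapI α β ε σ 2)
    = profile (√(2 * (α + β)) * Real.cos (ε ^ 2)) (mu α β ε * Real.cos (ε ^ 2)) (α + β / 2)
      (β ^ 2 / 4 + α * (α + β) * Real.sin (ε ^ 2) ^ 2) := by
  funext ρ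
  rw [profile, ← denI_eq]
  simp only [controlMapI, PiLp.toLp_apply, Matrix.cons_val]
  ring_nf

theorem controlMapII_two (α β ε k : ℝ) : (fun σ => controlMapII α β ε k σ 2)
    = profile (√(2 * (α + β))) (mu α β ε) (α + β / 2) (β ^ 2 / 4) := by
  funext ρ
  rw [profile, ← denII_eq]
  simp only [controlMapII, PiLp.toLp_apply, Matrix.cons_val]

/-- The angular momentum of the plane curve `e^{iθ} (p + i E) / D`. -/
theorem angularMomentum_rotated {θ E D : ℝ → ℝ} {p θ' E' D' ρ : ℝ} (hθ : HasDerivAt θ θ' ρ)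
    (hE : HasDerivAt E E' ρ) (hD : HasDerivAt D D' ρ) (hD0 : D ρ ≠ 0) :
    (p * Real.sin (θ ρ) + Real.cos (θ ρ) * E ρ) / D ρ
        * deriv (fun σ => (p * Real.cos (θ σ) - Real.sin (θ σ) * E σ) / D σ) ρ
      - (p * Real.cos (θ ρ) - Real.sin (θ ρ) * E ρ) / D ρ
        * deriv (fun σ => (p * Real.sin (θ σ) + Real.cos (θ σ) * E σ) / D σ) ρ
      = -(θ' * (p ^ 2 + E ρ ^ 2) + E' * p) / D ρ ^ 2 := by
  have h0 := ((hθ.cos.const_mul p).fun_sub (hθ.sin.fun_mul hE)).fun_div hD hD0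
  have h1 := ((hθ.sin.const_mul p).fun_add (hθ.cos.fun_mul hE)).fun_div hD hD0
  rw [h0.deriv, h1.deriv]
  have hcs : Real.cos (θ ρ) ^ 2 = 1 - Real.sin (θ ρ) ^ 2 := by
    linarith [Real.cos_sq_add_sin_sq (θ ρ)]
  generalize Real.cos (θ ρ) = x at *
  generalize Real.sin (θ ρ) = y at *
  field_simp
  linear_combination D ρ * (-(θ' * (p ^ 2 + E ρ ^ 2)) - E' * p) * hcs

/-- The angular momentum of the first control map about the third axis is constant. -/
theorem firstEquation_a_I {α β ε : ℝ} (hαβ : 0 < α + β) (hc : Real.cos (ε ^ 2) ≠ 0) (ρ : ℝ) :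
    (firstEquation (controlMapI α β ε)).a ρ = -(mu α β ε * Real.sin (ε ^ 2)) := by
  have hpar := isParam_I α β ε
  have hP := hpar.denPoly_pos hc hαβ
    (Real.exp_pos (2 * (mu α β ε * Real.cos (ε ^ 2)) * ρ))
  have hden : denI α β ε = fun ρ => √(denPoly (α + β / 2)
    (β ^ 2 / 4 + α * (α + β) * Real.sin (ε ^ 2) ^ 2)
    (Real.exp (2 * (mu α β ε * Real.cos (ε ^ 2)) * ρ))) := funext (denI_eq α β ε)
  have hD := hasDerivAt_sqrt_denPoly hP
  rw [← hden] at hD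
  have hD2 : denI α β ε ρ ^ 2 = denPoly (α + β / 2)
    (β ^ 2 / 4 + α * (α + β) * Real.sin (ε ^ 2) ^ 2)
    (Real.exp (2 * (mu α β ε * Real.cos (ε ^ 2)) * ρ)) := by rw [hden]; exact Real.sq_sqrt hP.le
  have hD0 : denI α β ε ρ ≠ 0 := by rw [hden]; exact (Real.sqrt_pos.2 hP).ne'
  have hE := (hasDerivAt_exp_two_mul (mu α β ε * Real.cos (ε ^ 2)) ρ).sub_const
    (β / 2 - (α + β) * Real.sin (ε ^ 2) ^ 2)
  have hθ : HasDerivAt (fun σ => mu α β ε * σ * Real.sin (ε ^ 2))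
      (mu α β ε * Real.sin (ε ^ 2)) ρ := by
    simpa using ((hasDerivAt_id' ρ).const_mul (mu α β ε)).mul_const (Real.sin (ε ^ 2))
  have hsq : ∀ σ, Real.exp (mu α β ε * σ * Real.cos (ε ^ 2)) ^ 2
      = Real.exp (2 * (mu α β ε * Real.cos (ε ^ 2)) * σ) := fun σ => by
    rw [← Real.exp_nat_mul]; congr 1; push_cast; ring
  have h0 : ∀ σ, controlMapI α β ε σ 0 = ((α + β) * Real.sin (ε ^ 2) * Real.cos (ε ^ 2)
      * Real.cos (mu α β ε * σ * Real.sin (ε ^ 2)) - Real.sin (mu α β ε * σ * Real.sin (ε ^ 2))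
      * (Real.exp (2 * (mu α β ε * Real.cos (ε ^ 2)) * σ)
        - (β / 2 - (α + β) * Real.sin (ε ^ 2) ^ 2))) / denI α β ε σ := fun σ => by
    simp only [controlMapI, PiLp.toLp_apply, Matrix.cons_val, hsq, Real.cos_add]
    ring
  have h1 : ∀ σ, controlMapI α β ε σ 1 = ((α + β) * Real.sin (ε ^ 2) * Real.cos (ε ^ 2)
      * Real.sin (mu α β ε * σ * Real.sin (ε ^ 2)) + Real.cos (mu α β ε * σ * Real.sin (ε ^ 2))
      * (Real.exp (2 * (mu α β ε * Real.cos (ε ^ 2)) * σ)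
        - (β / 2 - (α + β) * Real.sin (ε ^ 2) ^ 2))) / denI α β ε σ := fun σ => by
    simp only [controlMapI, PiLp.toLp_apply, Matrix.cons_val, hsq, Real.sin_add]
    ring
  simp only [firstEquation, h0, h1]
  rw [angularMomentum_rotated hθ hE hD hD0, div_eq_iff (pow_ne_zero 2 hD0), hD2, hpar.denPoly_eq]
  ring

theorem mu_pos {α β ε : ℝ} (hαβ : 0 < α + β) (hε : 0 < ε) : 0 < mu α β ε :=
  div_pos (Real.sqrt_pos.2 hαβ) hε

theorem one_div_sq_eq {α β ε : ℝ} (hαβ : 0 < α + β) (hε : 0 < ε) :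
    1 / ε ^ 2 = mu α β ε ^ 2 / (α + β) := by
  rw [mu, div_pow, Real.sq_sqrt hαβ.le]
  field_simp

/-- The coefficients `a`, `b`, `c` of the second reduced equation for the first map. The last two
agree. -/
theorem secondEquation_I {α β ε : ℝ} (hαβ : 0 < α + β) (hε : 0 < ε) (hc : Real.cos (ε ^ 2) ≠ 0)
    (hs : Real.sin (ε ^ 2) ≠ 0) (hv : ContDiff ℝ 2 (controlMapI α β ε))
    (hsph : ∀ ρ, ‖controlMapI α β ε ρ‖ = 1) {c s m C μ ν k : ℝ} (ec : c = Real.cos (ε ^ 2))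
    (es : s = Real.sin (ε ^ 2)) (em : m = α + β / 2) (eC : C = β ^ 2 / 4 + α * (α + β) * s ^ 2)
    (eμ : μ = mu α β ε) (eν : ν = μ * c) (ek : k = √(2 * (α + β)) * c) (ρ : ℝ) :
    (secondEquation α β ε (controlMapI α β ε)).a ρ = profile k ν m C ρ
      * (ν * (C - Real.exp (2 * ν * ρ) ^ 2) / denPoly m C (Real.exp (2 * ν * ρ))) ∧
    (secondEquation α β ε (controlMapI α β ε)).b ρ = profile k ν m C ρ * (μ ^ 2
      * (denPoly m C (Real.exp (2 * ν * ρ)) - 2 * (α + β) * c ^ 2 * Real.exp (2 * ν * ρ))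
      * (denPoly m C (Real.exp (2 * ν * ρ)) - 4 * α * c ^ 2 * Real.exp (2 * ν * ρ))
      / denPoly m C (Real.exp (2 * ν * ρ)) ^ 2) ∧
    (secondEquation α β ε (controlMapI α β ε)).c ρ
      = (secondEquation α β ε (controlMapI α β ε)).b ρ := by
  have hpar : IsParam α β c s m C := by rw [ec, em, eC, es]; exact isParam_I α β ε
  have h2 : (fun σ => controlMapI α β ε σ 2) = profile k ν m C := by
    rw [controlMapI_two, ek, eν, eμ, ec, em, eC, es]
  have h2' : controlMapI α β ε ρ 2 = profile k ν m C ρ := congrFun h2 ρ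
  have hc0 : c ≠ 0 := ec ▸ hc
  have hs0 : s ≠ 0 := es ▸ hs
  have hP := hpar.denPoly_pos hc0 hαβ (Real.exp_pos (2 * ν * ρ))
  have hk : k ^ 2 = 2 * (α + β) * c ^ 2 := by
    rw [ek, mul_pow, Real.sq_sqrt (by positivity)]
  have ha : (secondEquation α β ε (controlMapI α β ε)).a ρ = profile k ν m C ρ
      * (ν * (C - Real.exp (2 * ν * ρ) ^ 2) / denPoly m C (Real.exp (2 * ν * ρ))) := by
    simp only [secondEquation]
    rw [h2, (hasDerivAt_profile hP).deriv]
  have hkin : ‖deriv (controlMapI α β ε) ρ‖ ^ 2 = μ ^ 2 * (s ^ 2 + 2 * (α + β) * c ^ 2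
      * Real.exp (2 * ν * ρ)
        * (denPoly m C (Real.exp (2 * ν * ρ)) - 2 * α * c ^ 2 * Real.exp (2 * ν * ρ))
        / denPoly m C (Real.exp (2 * ν * ρ)) ^ 2) := by
    have h3 := one_sub_sq_mul_norm_deriv_sq hv hsph ρ
    rw [firstEquation_a_I hαβ hc, h2', profile_sq hP, hk, ← es, ← eμ] at h3
    have h4 : deriv (fun σ => controlMapI α β ε σ 2) ρ = _ := ha
    rw [h4, mul_pow, profile_sq hP, hk] at h3
    have hY := Real.exp_pos (2 * ν * ρ)
    have hN : 0 < denPoly m C (Real.exp (2 * ν * ρ))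
        - 2 * (α + β) * c ^ 2 * Real.exp (2 * ν * ρ) := by
      rw [hpar.denPoly_eq]
      have : 0 < (α + β) ^ 2 * s ^ 2 * c ^ 2 := by positivity
      have := sq_nonneg (Real.exp (2 * ν * ρ) - β / 2 + (α + β) * s ^ 2)
      linarith
    set Y := Real.exp (2 * ν * ρ)
    set P := denPoly m C Y with hPd
    have hsc : s ^ 2 = 1 - c ^ 2 := by linarith [hpar.sq_add_sq]
    have key : c ^ 2 * (C - Y ^ 2) ^ 2 + s ^ 2 * P ^ 2
        = (P - 2 * (α + β) * c ^ 2 * Y) * (P - 2 * α * c ^ 2 * Y) := by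
      rw [hPd, denPoly, hpar.m_eq, hpar.C_eq, hsc]
      ring
    have h5 : 1 - 2 * (α + β) * c ^ 2 * Y / P ≠ 0 := by
      rw [one_sub_div hP.ne']
      exact (div_pos hN hP).ne'
    refine mul_left_cancel₀ h5 (h3.trans ?_)
    rw [eν]
    field_simp
    linear_combination μ ^ 2 * (2 * Y * (α + β) * c ^ 2 * key)
  have hb : (secondEquation α β ε (controlMapI α β ε)).b ρ = profile k ν m C ρ * (μ ^ 2
      * (denPoly m C (Real.exp (2 * ν * ρ)) - 2 * (α + β) * c ^ 2 * Real.exp (2 * ν * ρ))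
      * (denPoly m C (Real.exp (2 * ν * ρ)) - 4 * α * c ^ 2 * Real.exp (2 * ν * ρ))
      / denPoly m C (Real.exp (2 * ν * ρ)) ^ 2) := by
    rw [← hpar.second_coefficient_eq hc0 hαβ eν (k := k), ← hkin]
    simp only [secondEquation]
    rw [h2, h2']
  refine ⟨ha, hb, ?_⟩
  rw [hb, ← hpar.potential_eq hc0 hαβ (eμ ▸ one_div_sq_eq hαβ hε) hk]
  simp only [secondEquation]
  rw [h2']

/-- The coefficients `a`, `b`, `c` of the second reduced equation for the second map. -/
theorem secondEquation_II {α β ε k₀ : ℝ} (hαβ : 0 < α + β) (hε : 0 < ε)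
    (hv : ContDiff ℝ 2 (controlMapII α β ε k₀)) {m C μ k : ℝ}
    (em : m = α + β / 2) (eC : C = β ^ 2 / 4)
    (eμ : μ = mu α β ε) (ek : k = √(2 * (α + β))) (ρ : ℝ) :
    (secondEquation α β ε (controlMapII α β ε k₀)).a ρ = profile k μ m C ρ
      * (μ * (C - Real.exp (2 * μ * ρ) ^ 2) / denPoly m C (Real.exp (2 * μ * ρ))) ∧
    (secondEquation α β ε (controlMapII α β ε k₀)).b ρ = profile k μ m C ρ * (μ ^ 2
      * (denPoly m C (Real.exp (2 * μ * ρ)) - 2 * (α + β) * Real.exp (2 * μ * ρ))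
      * (denPoly m C (Real.exp (2 * μ * ρ)) - 4 * α * Real.exp (2 * μ * ρ))
      / denPoly m C (Real.exp (2 * μ * ρ)) ^ 2) ∧
    (secondEquation α β ε (controlMapII α β ε k₀)).c ρ
      = (secondEquation α β ε (controlMapII α β ε k₀)).b ρ := by
  have hpar : IsParam α β 1 0 m C := by rw [em, eC]; exact isParam_II α β
  have h2 : (fun σ => controlMapII α β ε k₀ σ 2) = profile k μ m C := by
    rw [controlMapII_two, ek, eμ, em, eC]
  have h2' : controlMapII α β ε k₀ ρ 2 = profile k μ m C ρ := congrFun h2 ρ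
  have hP := hpar.denPoly_pos one_ne_zero hαβ (Real.exp_pos (2 * μ * ρ))
  have hk : k ^ 2 = 2 * (α + β) * 1 ^ 2 := by
    rw [ek, Real.sq_sqrt (by positivity)]; ring
  have ha : (secondEquation α β ε (controlMapII α β ε k₀)).a ρ = profile k μ m C ρ
      * (μ * (C - Real.exp (2 * μ * ρ) ^ 2) / denPoly m C (Real.exp (2 * μ * ρ))) := by
    simp only [secondEquation]
    rw [h2, (hasDerivAt_profile hP).deriv]
  have hkin : ‖deriv (controlMapII α β ε k₀) ρ‖ ^ 2 = μ ^ 2 * (0 ^ 2 + 2 * (α + β) * 1 ^ 2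
      * Real.exp (2 * μ * ρ)
        * (denPoly m C (Real.exp (2 * μ * ρ)) - 2 * α * 1 ^ 2 * Real.exp (2 * μ * ρ))
        / denPoly m C (Real.exp (2 * μ * ρ)) ^ 2) := by
    have hden : denII α β ε = fun ρ => √(denPoly m C (Real.exp (2 * μ * ρ))) := by
      rw [em, eC, eμ]; exact funext (denII_eq α β ε)
    have hD := hasDerivAt_sqrt_denPoly hP
    rw [← hden] at hD
    have hD2 : denII α β ε ρ ^ 2 = denPoly m C (Real.exp (2 * μ * ρ)) := by
      rw [hden]; exact Real.sq_sqrt hP.le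
    have hDD : √(denPoly m C (Real.exp (2 * μ * ρ))) = denII α β ε ρ := by rw [hden]
    have hD0 : denII α β ε ρ ≠ 0 := by rw [hden]; exact (Real.sqrt_pos.2 hP).ne'
    have hsq : ∀ σ, Real.exp (mu α β ε * σ) ^ 2 = Real.exp (2 * μ * σ) := fun σ => by
      rw [← Real.exp_nat_mul, eμ]; congr 1; push_cast; ring
    have h3 := ((hasDerivAt_exp_two_mul μ ρ).sub_const (β / 2)).fun_div hD hD0
    have e0 : (fun σ => controlMapII α β ε k₀ σ 0)
        = fun σ => (Real.exp (2 * μ * σ) - β / 2) / denII α β ε σ * Real.cos k₀ := by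
      funext σ; simp [controlMapII, hsq]
    have e1 : (fun σ => controlMapII α β ε k₀ σ 1)
        = fun σ => (Real.exp (2 * μ * σ) - β / 2) / denII α β ε σ * Real.sin k₀ := by
      funext σ; simp [controlMapII, hsq]
    have h4 : deriv (fun σ => controlMapII α β ε k₀ σ 2) ρ = _ := ha
    rw [norm_deriv_sq hv, h4, mul_pow (profile k μ m C ρ), profile_sq hP, hk, e0, e1,
      (h3.mul_const (Real.cos k₀)).deriv, (h3.mul_const (Real.sin k₀)).deriv, hDD]
    set Y := Real.exp (2 * μ * ρ)
    set D := denII α β ε ρ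
    rw [← hD2]
    have hP2 : D ^ 2 = Y ^ 2 + (2 * α + β) * Y + β ^ 2 / 4 := by
      rw [hD2, denPoly, em, eC]; ring
    have hcs : ∀ x : ℝ, (x * Real.cos k₀) ^ 2 + (x * Real.sin k₀) ^ 2 = x ^ 2 := fun x => by
      linear_combination x ^ 2 * Real.cos_sq_add_sin_sq k₀
    rw [hcs]
    have e2 : (2 * μ * Y * D - (Y - β / 2) * (2 * μ * Y * (Y + m) / D)) / D ^ 2
        = 2 * μ * Y * (α + β) * (Y + β / 2) / D ^ 3 := by
      field_simp
      rw [hP2, em]; ring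
    rw [e2, eC]
    have e3 : D ^ 2 - 2 * α * 1 ^ 2 * Y = (Y + β / 2) ^ 2 := by rw [hP2]; ring
    rw [e3]
    field_simp
    rw [hP2]
    ring
  have hb : (secondEquation α β ε (controlMapII α β ε k₀)).b ρ = profile k μ m C ρ * (μ ^ 2
      * (denPoly m C (Real.exp (2 * μ * ρ)) - 2 * (α + β) * 1 ^ 2 * Real.exp (2 * μ * ρ))
      * (denPoly m C (Real.exp (2 * μ * ρ)) - 4 * α * 1 ^ 2 * Real.exp (2 * μ * ρ))
      / denPoly m C (Real.exp (2 * μ * ρ)) ^ 2) := by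
    rw [← hpar.second_coefficient_eq one_ne_zero hαβ (mul_one μ).symm (k := k), ← hkin]
    simp only [secondEquation]
    rw [h2, h2']
  refine ⟨ha, by simpa using hb, ?_⟩
  rw [hb, ← hpar.potential_eq one_ne_zero hαβ (eμ ▸ one_div_sq_eq hαβ hε) hk]
  simp only [secondEquation]
  rw [h2']

end ControlMapFormulas

/-! ### Reduced equations with `b = c` -/

section EquationsWithEqualCoefficients

variable {n : ℕ} {eq : ScalarEquation} {ρ τ : ℝ} {p : Space n}

theorem ScalarEquation.rhs_eq_mul_sub_one {f : ℝ} (hc : eq.c ρ = eq.b ρ) (hb : eq.b ρ = f * eq.a ρ)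
    (ha : eq.a ρ ≠ 0) : eq.rhs ρ p = f * (‖p‖ ^ 2 - 1) := by
  rw [ScalarEquation.rhs, hc, hb]
  field_simp

/-- If `b = c = f a` with `f` continuous, the subsolution inequality is the pointwise one for
`f (|p|² - 1)`, also at an isolated zero of `a`. -/
theorem ScalarEquation.SubIneq.le_mul {f : ℝ → ℝ} (hf : Continuous f)
    (hc : ∀ ρ, eq.c ρ = eq.b ρ) (hb : ∀ ρ, eq.b ρ = f ρ * eq.a ρ)
    (ha : eq.a ρ = 0 → ∃ᶠ ρ' in 𝓝 ρ, eq.a ρ' ≠ 0) (h : eq.SubIneq ρ p τ) :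
    τ ≤ f ρ * (‖p‖ ^ 2 - 1) := by
  by_cases h0 : eq.a ρ = 0
  · refine le_of_forall_pos_le_add fun η hη => (h.2 h0).2 (ha h0) _ ?_
    have h1 : Continuous fun z : ℝ × Space n => f z.1 * (‖z.2‖ ^ 2 - 1) := by fun_prop
    filter_upwards [(h1.tendsto (ρ, p)).eventually (gt_mem_nhds (lt_add_of_pos_right _ hη))]
      with z hz hz0
    rw [ScalarEquation.rhs_eq_mul_sub_one (hc _) (hb _) hz0]
    exact hz.le
  · exact (h.1 h0).trans_eq (ScalarEquation.rhs_eq_mul_sub_one (hc _) (hb _) h0)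

/-- Mirror image of `ScalarEquation.SubIneq.le_mul`. -/
theorem ScalarEquation.SuperIneq.mul_le {f : ℝ → ℝ} (hf : Continuous f)
    (hc : ∀ ρ, eq.c ρ = eq.b ρ) (hb : ∀ ρ, eq.b ρ = f ρ * eq.a ρ)
    (ha : eq.a ρ = 0 → ∃ᶠ ρ' in 𝓝 ρ, eq.a ρ' ≠ 0) (h : eq.SuperIneq ρ p τ) :
    f ρ * (‖p‖ ^ 2 - 1) ≤ τ := by
  by_cases h0 : eq.a ρ = 0
  · refine le_of_forall_pos_sub_le fun η hη => (h.2 h0).2 (ha h0) _ ?_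
    have h1 : Continuous fun z : ℝ × Space n => f z.1 * (‖z.2‖ ^ 2 - 1) := by fun_prop
    filter_upwards [(h1.tendsto (ρ, p)).eventually (lt_mem_nhds (sub_lt_self _ hη))]
      with z hz hz0
    rw [ScalarEquation.rhs_eq_mul_sub_one (hc _) (hb _) hz0]
    exact hz.le
  · exact (ScalarEquation.rhs_eq_mul_sub_one (hc _) (hb _) h0).symm.trans_le (h.1 h0)

theorem exists_abs_sub_le_mul_sub {G G₁ φ : ℝ → ℝ} (hG : ∀ x, HasDerivAt G (G₁ x) x)
    (hG₁ : Continuous G₁) (hpos : ∀ x, 0 < G₁ x) (hφ : ContDiff ℝ 1 φ) (R S : ℝ) :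
    ∃ L, 0 ≤ L ∧ ∀ ρ ∈ Icc R S, ∀ σ ∈ Icc R S, ρ < σ → |φ σ - φ ρ| ≤ L * (G σ - G ρ) := by
  rcases lt_or_ge S R with hRS | hRS
  · exact ⟨0, le_rfl, fun ρ hρ => absurd (hρ.1.trans hρ.2) (not_le.2 hRS)⟩
  obtain ⟨x, -, hx⟩ := (isCompact_Icc (a := R) (b := S)).exists_isMaxOn ⟨R, le_rfl, hRS⟩
    (f := fun x => |deriv φ x| / G₁ x)
    (((hφ.continuous_deriv le_rfl).abs.div hG₁ fun x => (hpos x).ne').continuousOn)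
  refine ⟨|deriv φ x| / G₁ x, div_nonneg (abs_nonneg _) (hpos x).le, fun ρ hρ σ hσ hlt => ?_⟩
  set L := |deriv φ x| / G₁ x
  have hd : ∀ y ∈ Icc R S, |deriv φ y| ≤ L * G₁ y := fun y hy => by
    have : |deriv φ y| / G₁ y ≤ L := hx hy
    rwa [div_le_iff₀ (hpos y)] at this
  have hφd : ∀ y, HasDerivAt φ (deriv φ y) y := fun y =>
    (hφ.differentiable one_ne_zero y).hasDerivAt
  have key : ∀ e : ℝ, |e| ≤ 1 → e * (φ σ - φ ρ) ≤ L * (G σ - G ρ) := fun e he => by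
    have hm : MonotoneOn (fun y => L * G y - e * φ y) (Icc R S) := by
      refine monotoneOn_of_hasDerivWithinAt_nonneg (convex_Icc R S) ?_
        (f' := fun y => L * G₁ y - e * deriv φ y)
        (fun y _ => (((hG y).const_mul L).fun_sub ((hφd y).const_mul e)).hasDerivWithinAt) ?_
      · exact fun y _ => (((hG y).const_mul L).fun_sub
          ((hφd y).const_mul e)).continuousAt.continuousWithinAt
      · intro y hy
        have h1 := hd y (interior_subset hy)
        have h2 : e * deriv φ y ≤ |deriv φ y| := (le_abs_self _).trans (by
          rw [abs_mul]; exact mul_le_of_le_one_left (abs_nonneg _) he)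
        linarith
    have := hm hρ hσ hlt.le
    simp only at this
    linarith
  refine abs_le.2 ⟨?_, ?_⟩
  · linarith [key (-1) (by norm_num)]
  · linarith [key 1 (by norm_num)]

theorem exists_hasDerivAt_of_continuous {G₁ : ℝ → ℝ} (h : Continuous G₁) :
    ∃ G : ℝ → ℝ, ∀ x, HasDerivAt G (G₁ x) x :=
  ⟨fun x => ∫ y in (0 : ℝ)..x, G₁ y, fun x => (h.integral_hasStrictDerivAt 0 x).hasDerivAt⟩

end EquationsWithEqualCoefficients

/-! ### Comparison for the second control map -/

section SecondMap

/-- Comparison for the second reduced equation when `b = c = f a` with `f` continuous: the change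
of unknown with `G'' = f G'` removes the gradient term. -/
theorem le_of_viscosity_of_gradient_removable {n : ℕ} {T : ℝ} {eq : ScalarEquation}
    {f G₁ : ℝ → ℝ} (hf : Continuous f) (hc : ∀ ρ, eq.c ρ = eq.b ρ)
    (hb : ∀ ρ, eq.b ρ = f ρ * eq.a ρ) (ha : ∀ ρ, eq.a ρ = 0 → ∃ᶠ ρ' in 𝓝 ρ, eq.a ρ' ≠ 0)
    (hG₁ : ∀ x, HasDerivAt G₁ (f x * G₁ x) x) (hpos : ∀ x, 0 < G₁ x)
    (hfG : ContDiff ℝ 1 fun x => f x * G₁ x) {r s : Space n × ℝ → ℝ}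
    (hr : ContinuousOn r (univ ×ˢ Icc 0 T)) (hs : ContinuousOn s (univ ×ˢ Icc 0 T))
    (hsub : IsViscositySub eq T univ s) (hsup : IsViscositySuper eq T univ r) {M m₀ : ℝ}
    (hout : ∀ x ∉ Metric.ball (0 : Space n) M, ∀ t ∈ Icc 0 T, s (x, t) ≤ m₀ ∧ m₀ ≤ r (x, t))
    (h0 : ∀ x, s (x, 0) ≤ r (x, 0)) : ∀ x, ∀ t ∈ Icc 0 T, s (x, t) ≤ r (x, t) := by
  have hG₁c : Continuous G₁ := continuous_iff_continuousAt.2 fun x => (hG₁ x).continuousAt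
  obtain ⟨G, hG⟩ := exists_hasDerivAt_of_continuous hG₁c
  refine le_of_viscosity_pair hG hG₁ hfG.continuous hpos hr hs
    (SubP := fun σ p τ => eq.SubIneq σ p τ) (SupP := fun ρ p τ => eq.SuperIneq ρ p τ)
    (fun φ hφ z hz h1 h2 => hsub φ hφ z hz h1 h2 (mem_univ _))
    (fun φ hφ z hz h1 h2 => hsup φ hφ z hz h1 h2 (mem_univ _)) ?_ hout h0
  intro R S
  obtain ⟨L, hL, h⟩ := exists_abs_sub_le_mul_sub hG hG₁c hpos hfG R S
  refine ⟨L, hL, fun ρ hρ σ hσ hlt p p' τ τ' h1 h2 => ?_⟩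
  have h3 := mul_le_mul_of_nonneg_left (h1.le_mul hf hc hb (ha _)) (hpos σ).le
  have h4 := mul_le_mul_of_nonneg_left (h2.mul_le hf hc hb (ha _)) (hpos ρ).le
  have h5 := (abs_le.1 (h ρ hρ σ hσ hlt)).1
  have h6 := mul_nonneg hL (abs_nonneg (‖G₁ σ • p‖ ^ 2 - ‖G₁ ρ • p'‖ ^ 2))
  linarith

/-- The second map. Here `a` vanishes only at the value with `Y = β / 2`, where `b` vanishes too,
and `b / a` extends continuously. The second reduced equation alone gives the comparison. -/
theorem le_of_isControlMapII {n : ℕ} {α β ε δ T k₀ : ℝ} (hβ : 0 < β) (hαβ : 0 < α + β)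
    (hε : 0 < ε) {r s : Space n × ℝ → ℝ}
    (hsup : IsDeltaSuper α β ε δ T (controlMapII α β ε k₀) r)
    (hsub : IsDeltaSub α β ε δ T (controlMapII α β ε k₀) s)
    (hr : ContinuousOn r (univ ×ˢ Icc 0 T)) (hs : ContinuousOn s (univ ×ˢ Icc 0 T)) {M m₀ : ℝ}
    (hout : ∀ x ∉ Metric.ball (0 : Space n) M, ∀ t ∈ Icc 0 T, s (x, t) ≤ m₀ ∧ m₀ ≤ r (x, t))
    (h0 : ∀ x, s (x, 0) ≤ r (x, 0)) : ∀ x, ∀ t ∈ Icc 0 T, s (x, t) ≤ r (x, t) := by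
  obtain ⟨m, em⟩ : ∃ m, m = α + β / 2 := ⟨_, rfl⟩
  obtain ⟨C, eC⟩ : ∃ C, C = β ^ 2 / 4 := ⟨_, rfl⟩
  obtain ⟨μ, eμ⟩ : ∃ μ, μ = mu α β ε := ⟨_, rfl⟩
  obtain ⟨k, ek⟩ : ∃ k, k = √(2 * (α + β)) := ⟨_, rfl⟩
  have hμ : 0 < μ := eμ ▸ mu_pos hαβ hε
  have hk : 0 < k := by rw [ek]; positivity
  have hpar : IsParam α β 1 0 m C := by rw [em, eC]; exact isParam_II α β
  have hP : ∀ ρ, 0 < denPoly m C (Real.exp (2 * μ * ρ)) := fun ρ =>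
    hpar.denPoly_pos one_ne_zero hαβ (Real.exp_pos _)
  have hY : ∀ ρ : ℝ, 0 < Real.exp (2 * μ * ρ) + β / 2 := fun ρ => by positivity
  have hprof : ∀ ρ, 0 < profile k μ m C ρ := fun ρ => by
    have := Real.sqrt_pos.2 (hP ρ)
    rw [profile]; positivity
  have heq := secondEquation_II hαβ hε hsub.contDiff em eC eμ ek
  set eq := secondEquation α β ε (controlMapII α β ε k₀)
  have hEc : ContDiff ℝ 1 fun ρ : ℝ => Real.exp (2 * μ * ρ) := by fun_prop
  have hPc : ContDiff ℝ 1 fun ρ : ℝ => denPoly m C (Real.exp (2 * μ * ρ)) := by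
    unfold denPoly; fun_prop
  have hfc : ContDiff ℝ 1 fun ρ : ℝ => -(μ * (Real.exp (2 * μ * ρ) - β / 2)
      * (denPoly m C (Real.exp (2 * μ * ρ)) - 4 * α * Real.exp (2 * μ * ρ)))
      / (denPoly m C (Real.exp (2 * μ * ρ)) * (Real.exp (2 * μ * ρ) + β / 2)) :=
    ContDiff.div (by fun_prop) (by fun_prop) fun ρ => (mul_pos (hP ρ) (hY ρ)).ne'
  have hGc : ContDiff ℝ 1 fun ρ : ℝ => Real.exp (μ * ρ) * (Real.exp (2 * μ * ρ) + β / 2)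
      / denPoly m C (Real.exp (2 * μ * ρ)) :=
    ContDiff.div (by fun_prop) (by fun_prop) fun ρ => (hP ρ).ne'
  refine le_of_viscosity_of_gradient_removable (eq := eq) hfc.continuous (fun ρ => (heq ρ).2.2)
    (fun ρ => ?_) (fun ρ hρ => ?_) (fun ρ => ?_) (fun ρ => ?_) (hfc.mul hGc) hr hs
    hsub.second hsup.second hout h0
  · rw [(heq ρ).1, (heq ρ).2.1]
    have h1 := (hP ρ).ne'
    have h2 := (hY ρ).ne'
    have h2' : Real.exp (2 * μ * ρ) * 2 + β ≠ 0 := by positivity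
    set Y := Real.exp (2 * μ * ρ)
    have h3 : denPoly m C Y - 2 * (α + β) * Y = (Y - β / 2) ^ 2 := by
      rw [denPoly, em, eC]; ring
    have h4 : C - Y ^ 2 = -((Y - β / 2) * (Y + β / 2)) := by rw [eC]; ring
    rw [h3, h4]
    field_simp
  · have hne : ∀ ρ', ρ' ≠ ρ → eq.a ρ' ≠ 0 := fun ρ' hne h' => by
      have aux : ∀ x, eq.a x = 0 → Real.exp (2 * μ * x) = β / 2 := fun x hx => by
        rw [(heq x).1, mul_eq_zero, div_eq_zero_iff, mul_eq_zero] at hx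
        rcases hx with hx | (hx | hx) | hx
        · exact absurd hx (hprof x).ne'
        · exact absurd hx hμ.ne'
        · rw [eC] at hx
          have : (Real.exp (2 * μ * x) - β / 2) * (Real.exp (2 * μ * x) + β / 2) = 0 := by
            linarith
          rcases mul_eq_zero.1 this with h | h
          · linarith
          · exact absurd h (hY x).ne'
        · exact absurd hx (hP x).ne'
      have h2 := Real.exp_injective ((aux ρ' h').trans (aux ρ hρ).symm)
      exact hne (mul_left_cancel₀ (by positivity) h2)
    have : ∃ᶠ ρ' in 𝓝[≠] ρ, eq.a ρ' ≠ 0 :=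
      Eventually.frequently (by
        filter_upwards [self_mem_nhdsWithin] with x hx using hne x hx)
    exact this.filter_mono nhdsWithin_le_nhds
  · have h1 := (hP ρ).ne'
    have h2 := (hY ρ).ne'
    have h2' : Real.exp (2 * μ * ρ) * 2 + β ≠ 0 := by positivity
    refine (((((hasDerivAt_id' ρ).const_mul μ).exp).fun_mul
      ((hasDerivAt_exp_two_mul μ ρ).add_const (β / 2))).fun_div
      (hasDerivAt_denPoly μ m C ρ) h1).congr_deriv ?_
    set Y := Real.exp (2 * μ * ρ)
    set P := denPoly m C Y with hPd
    have hP2 : P = Y ^ 2 + (2 * α + β) * Y + β ^ 2 / 4 := by rw [hPd, denPoly, em, eC]; ring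
    field_simp
    rw [hP2, em]
    ring
  · exact div_pos (mul_pos (Real.exp_pos _) (hY ρ)) (hP ρ)

end SecondMap

/-! ### A weight function -/

section Weight

/-- The weight `1 + dist(ρ, [-d, d])²`. -/
noncomputable def weight (d ρ : ℝ) : ℝ := 1 + (max (ρ - d) 0 ^ 2 + max (-ρ - d) 0 ^ 2)

/-- The derivative of `weight d`. -/
noncomputable def weightDeriv (d ρ : ℝ) : ℝ := 2 * max (ρ - d) 0 - 2 * max (-ρ - d) 0

theorem hasDerivAt_max_zero_sq (x : ℝ) :
    HasDerivAt (fun x : ℝ => max x 0 ^ 2) (2 * max x 0) x := by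
  have h : ∀ x : ℝ, x ≠ 0 → HasDerivAt (fun x : ℝ => max x 0 ^ 2) (2 * max x 0) x := by
    intro x hx
    rcases lt_or_gt_of_ne hx with hx | hx
    · rw [max_eq_right hx.le, mul_zero]
      refine (hasDerivAt_const x (0 : ℝ)).congr_of_eventuallyEq ?_
      filter_upwards [gt_mem_nhds hx] with y hy
      rw [max_eq_right hy.le]; norm_num
    · rw [max_eq_left hx.le]
      have h1 : HasDerivAt (fun x : ℝ => x ^ 2) (2 * x) x := by simpa using hasDerivAt_pow 2 x
      refine h1.congr_of_eventuallyEq ?_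
      filter_upwards [lt_mem_nhds hx] with y hy
      rw [max_eq_left hy.le]
  by_cases hx : x = 0
  · subst hx
    exact hasDerivAt_of_hasDerivAt_of_ne (fun y hy => h y hy) (by fun_prop) (by fun_prop)
  · exact h x hx

variable {d : ℝ}

theorem hasDerivAt_weight (d ρ : ℝ) : HasDerivAt (weight d) (weightDeriv d ρ) ρ := by
  have h1 := (hasDerivAt_max_zero_sq (ρ - d)).comp ρ ((hasDerivAt_id' ρ).sub_const d)
  have h2 := (hasDerivAt_max_zero_sq (-ρ - d)).comp ρ ((hasDerivAt_id' ρ).fun_neg.sub_const d)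
  refine ((h1.fun_add h2).const_add 1).congr_deriv ?_
  rw [weightDeriv]; ring

theorem one_le_weight (d ρ : ℝ) : 1 ≤ weight d ρ := by
  rw [weight]
  linarith [sq_nonneg (max (ρ - d) 0), sq_nonneg (max (-ρ - d) 0)]

theorem weight_pos (d ρ : ℝ) : 0 < weight d ρ := zero_lt_one.trans_le (one_le_weight d ρ)

@[fun_prop]
theorem continuous_weight : Continuous (weight d) := by unfold weight; fun_prop

@[fun_prop]
theorem continuous_weightDeriv : Continuous (weightDeriv d) := by unfold weightDeriv; fun_prop

theorem weight_neg (d ρ : ℝ) : weight d (-ρ) = weight d ρ := by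
  rw [weight, weight, neg_neg]; ring

theorem weightDeriv_neg (d ρ : ℝ) : weightDeriv d (-ρ) = -weightDeriv d ρ := by
  rw [weightDeriv, weightDeriv, neg_neg]; ring

theorem weight_of_le (hd : 0 < d) {ρ : ℝ} (h : d ≤ ρ) : weight d ρ = 1 + (ρ - d) ^ 2 := by
  rw [weight, max_eq_left (by linarith), max_eq_right (by linarith)]; ring

theorem weightDeriv_of_le (hd : 0 < d) {ρ : ℝ} (h : d ≤ ρ) : weightDeriv d ρ = 2 * (ρ - d) := by
  rw [weightDeriv, max_eq_left (by linarith), max_eq_right (by linarith)]; ring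

theorem weightDeriv_nonpos {ρ : ℝ} (h : ρ ≤ d) : weightDeriv d ρ ≤ 0 := by
  rw [weightDeriv, max_eq_right (by linarith)]
  linarith [le_max_right (-ρ - d) 0]

theorem weightDeriv_nonneg {ρ : ℝ} (h : -d ≤ ρ) : 0 ≤ weightDeriv d ρ := by
  rw [weightDeriv, max_eq_right (a := -ρ - d) (by linarith)]
  linarith [le_max_right (ρ - d) 0]

theorem weightDeriv_sub_le {ρ σ : ℝ} (h : ρ ≤ σ) :
    weightDeriv d σ - weightDeriv d ρ ≤ 4 * (σ - ρ) := by
  have h1 : max (σ - d) 0 ≤ max (ρ - d) 0 + (σ - ρ) :=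
    max_le (by linarith [le_max_left (ρ - d) 0]) (by linarith [le_max_right (ρ - d) 0])
  have h2 : max (-ρ - d) 0 ≤ max (-σ - d) 0 + (σ - ρ) :=
    max_le (by linarith [le_max_left (-σ - d) 0]) (by linarith [le_max_right (-σ - d) 0])
  rw [weightDeriv, weightDeriv]
  linarith

end Weight

/-! ### Comparison for a steep quotient `b / a` -/

section SteepCoefficient

/-- The properties of the quotient `f = b / a` for the second reduced equation of the first map
that enter the comparison: outside `(-d, d)` it is of the size of the large number `μ`, with the
sign opposite to that of `ρ`, and for `ρ ≥ 2 d` and for `ρ ≤ -2 d` it is nearly constant. -/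
structure IsSteep (d μ : ℝ) (f : ℝ → ℝ) : Prop where
  pos : 0 < d
  four_le : 4 ≤ μ
  three_le : 3 ≤ μ * d
  right : ∀ ρ, d ≤ ρ → -(3 * μ) ≤ f ρ ∧ f ρ ≤ -(μ / 2)
  left : ∀ ρ, ρ ≤ -d → μ / 2 ≤ f ρ ∧ f ρ ≤ 3 * μ
  slope_right : ∀ ρ σ, 2 * d ≤ ρ → ρ ≤ σ → |f σ - f ρ| * (1 + ρ ^ 2) ≤ σ - ρ
  slope_left : ∀ ρ σ, ρ ≤ σ → σ ≤ -(2 * d) → |f σ - f ρ| * (1 + σ ^ 2) ≤ σ - ρ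

namespace IsSteep

variable {d μ : ℝ} {f : ℝ → ℝ}

/-- The reflection `ρ ↦ -ρ`, which exchanges sub- and supersolutions. -/
theorem reflect (h : IsSteep d μ f) : IsSteep d μ fun x => -f (-x) where
  pos := h.pos
  four_le := h.four_le
  three_le := h.three_le
  right ρ hρ := by
    have := h.left (-ρ) (by linarith)
    exact ⟨by linarith, by linarith⟩
  left ρ hρ := by
    have := h.right (-ρ) (by linarith)
    exact ⟨by linarith, by linarith⟩
  slope_right ρ σ hρ hρσ := by
    have := h.slope_left (-σ) (-ρ) (by linarith) (by linarith)
    rw [neg_sq] at this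
    calc _ = |f (-ρ) - f (-σ)| * (1 + ρ ^ 2) := by congr 2; ring
      _ ≤ _ := this
      _ = _ := by ring
  slope_left ρ σ hρσ hσ := by
    have := h.slope_right (-σ) (-ρ) (by linarith) (by linarith)
    rw [neg_sq] at this
    calc _ = |f (-ρ) - f (-σ)| * (1 + σ ^ 2) := by congr 2; ring
      _ ≤ _ := this
      _ = _ := by ring

/-- The coefficient of the squared gradient in the transformed second equation. -/
noncomputable def gradCoeff (d : ℝ) (f : ℝ → ℝ) (ρ : ℝ) : ℝ := f ρ * weight d ρ + weightDeriv d ρ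

theorem gradCoeff_reflect (d : ℝ) (f : ℝ → ℝ) (ρ : ℝ) :
    gradCoeff d (fun x => -f (-x)) (-ρ) = -gradCoeff d f ρ := by
  simp only [gradCoeff, neg_neg, weight_neg, weightDeriv_neg]
  ring

/-- The steepness of `f` makes the gradient term negative for `ρ ≥ d`. -/
theorem gradCoeff_le (h : IsSteep d μ f) {ρ : ℝ} (hρ : d ≤ ρ) : gradCoeff d f ρ ≤ -(μ / 4) := by
  have h1 := (h.right ρ hρ).2
  have h4 := h.four_le
  rw [gradCoeff, weight_of_le h.pos hρ, weightDeriv_of_le h.pos hρ]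
  have h2 := mul_le_mul_of_nonneg_right h1 (by positivity : 0 ≤ 1 + (ρ - d) ^ 2)
  have h3 := sq_nonneg (ρ - d - 1)
  nlinarith [sq_nonneg (ρ - d)]

theorem le_gradCoeff (h : IsSteep d μ f) {ρ : ℝ} (hρ : ρ ≤ -d) : μ / 4 ≤ gradCoeff d f ρ := by
  have h1 := h.reflect.gradCoeff_le (ρ := -ρ) (by linarith)
  rw [gradCoeff_reflect] at h1
  linarith

/-- The growth of the weight beats the variation of `f`. -/
theorem gradCoeff_antitone (h : IsSteep d μ f) {ρ σ : ℝ} (hρ : 2 * d ≤ ρ) (hρσ : ρ ≤ σ) :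
    gradCoeff d f σ ≤ gradCoeff d f ρ := by
  have hd := h.pos
  have h1 := (h.right σ (by linarith)).2
  have h2 := h.slope_right ρ σ hρ hρσ
  have h3 := h.three_le
  rw [gradCoeff, gradCoeff, weight_of_le hd (by linarith), weight_of_le hd (by linarith),
    weightDeriv_of_le hd (by linarith), weightDeriv_of_le hd (by linarith)]
  have h4 : (f σ - f ρ) * (1 + (ρ - d) ^ 2) ≤ σ - ρ := by
    refine le_trans ?_ h2
    have h5 : (ρ - d) ^ 2 ≤ ρ ^ 2 := pow_le_pow_left₀ (by linarith) (by linarith) 2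
    exact mul_le_mul (le_abs_self _) (by linarith) (by positivity) (abs_nonneg _)
  have h5 : f σ * ((σ - ρ) * (σ + ρ - 2 * d)) ≤ -(μ / 2) * ((σ - ρ) * (2 * d)) := by
    have h6 : (σ - ρ) * (2 * d) ≤ (σ - ρ) * (σ + ρ - 2 * d) :=
      mul_le_mul_of_nonneg_left (by linarith) (by linarith)
    have h7 : 0 ≤ (σ - ρ) * (2 * d) := mul_nonneg (by linarith) (by linarith)
    have h8 := h.four_le
    nlinarith
  have h9 : (σ - ρ) * 3 ≤ (σ - ρ) * (μ * d) := mul_le_mul_of_nonneg_left h3 (by linarith)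
  nlinarith

/-- Comparison of two values on the side `ρ ≥ 2 d`, where both satisfy the second equation. -/
theorem le_of_two_mul_le (h : IsSteep d μ f) {ρ σ Q Q' Tu Tw L : ℝ} (hρ : 2 * d ≤ ρ)
    (hρσ : ρ ≤ σ) (hQ : 0 ≤ Q) (hL : |gradCoeff d f ρ| ≤ L)
    (hu : Tu ≤ gradCoeff d f σ * Q - f σ / weight d σ)
    (hw : gradCoeff d f ρ * Q' - f ρ / weight d ρ ≤ Tw) :
    Tu ≤ Tw + (σ - ρ) + L * |Q - Q'| := by
  have hd := h.pos
  have h1 := mul_le_mul_of_nonneg_right (h.gradCoeff_antitone hρ hρσ) hQ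
  have h2 : gradCoeff d f ρ * (Q - Q') ≤ L * |Q - Q'| :=
    (le_abs_self _).trans (by rw [abs_mul]; gcongr)
  have h3 : f ρ / weight d ρ - f σ / weight d σ ≤ σ - ρ := by
    have h4 : |f σ - f ρ| ≤ σ - ρ := by
      have := h.slope_right ρ σ hρ hρσ
      nlinarith [abs_nonneg (f σ - f ρ), mul_nonneg (abs_nonneg (f σ - f ρ)) (sq_nonneg ρ)]
    have h5 : weight d ρ ≤ weight d σ := by
      rw [weight_of_le hd (by linarith), weight_of_le hd (by linarith)]
      have := pow_le_pow_left₀ (by linarith) (by linarith : ρ - d ≤ σ - d) 2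
      linarith
    have h6 : f ρ / weight d ρ ≤ f ρ / weight d σ := by
      have h7 := (h.right ρ (by linarith)).2
      have h8 := h.four_le
      have := div_le_div_of_nonneg_left (by linarith : 0 ≤ -f ρ) (weight_pos d ρ) h5
      rw [neg_div, neg_div] at this
      linarith
    have h9 : (f ρ - f σ) / weight d σ ≤ σ - ρ := by
      rw [div_le_iff₀ (weight_pos d σ)]
      have := one_le_weight d σ
      have := neg_abs_le (f σ - f ρ)
      nlinarith
    rw [sub_div] at h9
    linarith
  linarith

/-- The comparison of the two reduced inequalities at different values. Between `-2 d` and `2 d`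
both values may use the heat inequality. For `Q` large, the second equation, whose gradient term
has a strict sign, is used as well. -/
theorem le_of_lt (h : IsSteep d μ f) {ρ σ Q Q' Tu Tw L : ℝ} (hρσ : ρ < σ) (hQ : 0 ≤ Q)
    (hQ' : 0 ≤ Q') (hLρ : d ≤ |ρ| → |gradCoeff d f ρ| ≤ L)
    (hLσ : d ≤ |σ| → |gradCoeff d f σ| ≤ L) (hL' : |weightDeriv d ρ| ≤ L)
    (hu₁ : σ ∉ Ioo (-(4 * d)) (-(2 * d)) → Tu ≤ weightDeriv d σ * Q)
    (hu₂ : d ≤ |σ| → Tu ≤ gradCoeff d f σ * Q - f σ / weight d σ)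
    (hw₁ : ρ ∉ Ioo (2 * d) (4 * d) → weightDeriv d ρ * Q' ≤ Tw)
    (hw₂ : d ≤ |ρ| → gradCoeff d f ρ * Q' - f ρ / weight d ρ ≤ Tw) :
    Tu ≤ Tw + 48 * (σ - ρ) + L * |Q - Q'| := by
  have hd := h.pos
  have h4 := h.four_le
  by_cases hρ : 2 * d ≤ ρ
  · have h1 : d ≤ |ρ| := by rw [abs_of_pos (by linarith)]; linarith
    have h2 : d ≤ |σ| := by rw [abs_of_pos (by linarith)]; linarith
    linarith [h.le_of_two_mul_le hρ hρσ.le hQ (hLρ h1) (hu₂ h2) (hw₂ h1)]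
  by_cases hσ : σ ≤ -(2 * d)
  · have h1 : d ≤ |ρ| := by rw [abs_of_neg (by linarith)]; linarith
    have h2 : d ≤ |σ| := by rw [abs_of_neg (by linarith)]; linarith
    have h3 := h.reflect.le_of_two_mul_le (ρ := -σ) (σ := -ρ) (Q := Q') (Q' := Q) (Tu := -Tw)
      (Tw := -Tu) (L := L) (by linarith) (by linarith) hQ'
      (by rw [gradCoeff_reflect, abs_neg]; exact hLσ h2)
      (by rw [gradCoeff_reflect, weight_neg, neg_neg, neg_div]; linarith [hw₂ h1])
      (by rw [gradCoeff_reflect, weight_neg, neg_neg, neg_div]; linarith [hu₂ h2])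
    rw [abs_sub_comm] at h3
    linarith
  push Not at hρ hσ
  have hu := hu₁ fun hm => by linarith [hm.2]
  have hw := hw₁ fun hm => by linarith [hm.1]
  -- the threshold makes `μ / 4 * Q` exceed the bound `3 μ` of `f / weight`
  rcases le_or_gt Q 12 with hQ12 | hQ12
  · have h1 : (weightDeriv d σ - weightDeriv d ρ) * Q ≤ 4 * (σ - ρ) * 12 :=
      mul_le_mul (weightDeriv_sub_le hρσ.le) hQ12 hQ (by linarith)
    have h2 : weightDeriv d ρ * (Q - Q') ≤ L * |Q - Q'| :=
      (le_abs_self _).trans (by rw [abs_mul]; gcongr)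
    linarith
  have h1 : Tu ≤ 0 := by
    rcases le_or_gt σ d with hσd | hσd
    · exact hu.trans (mul_nonpos_of_nonpos_of_nonneg (weightDeriv_nonpos hσd) hQ)
    · refine (hu₂ (hσd.le.trans (le_abs_self σ))).trans ?_
      have h5 := h.gradCoeff_le hσd.le
      have h6 := (h.right σ hσd.le).1
      have h7 : -(3 * μ) ≤ f σ / weight d σ := by
        rw [le_div_iff₀ (weight_pos d σ)]
        nlinarith [one_le_weight d σ]
      nlinarith
  have h2 : -(L * |Q - Q'|) ≤ Tw := by
    have hL0 : 0 ≤ L := (abs_nonneg _).trans hL'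
    have h3 := mul_nonneg hL0 (abs_nonneg (Q - Q'))
    rcases le_or_gt (-d) ρ with hρd | hρd
    · linarith [mul_nonneg (weightDeriv_nonneg hρd) hQ']
    · have hρa : d ≤ |ρ| := by rw [abs_of_neg (by linarith)]; linarith
      refine le_trans ?_ (hw₂ hρa)
      have h5 := h.le_gradCoeff hρd.le
      have h6 := (h.left ρ hρd.le).2
      have h7 : f ρ / weight d ρ ≤ 3 * μ := by
        rw [div_le_iff₀ (weight_pos d ρ)]
        nlinarith [one_le_weight d ρ]
      have h8 : gradCoeff d f ρ * (Q - Q') ≤ L * |Q - Q'| :=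
        (le_abs_self _).trans (by rw [abs_mul]; gcongr; exact hLρ hρa)
      nlinarith
  linarith

end IsSteep

/-- Comparison from the two reduced inequalities, for values outside an interval the heat
inequality and for values outside `(-d, d)` the second equation. -/
theorem le_of_viscosity_of_isSteep {n : ℕ} {T d μ : ℝ} {f : ℝ → ℝ} (h : IsSteep d μ f)
    {r s : Space n × ℝ → ℝ} (hr : ContinuousOn r (univ ×ˢ Icc 0 T))
    (hs : ContinuousOn s (univ ×ˢ Icc 0 T))
    (hsub : ∀ φ : Space n × ℝ → ℝ, ContDiff ℝ 2 φ → ∀ z : Space n × ℝ, z.2 ∈ Ioo 0 T →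
      IsLocalMax (fun y => s y - φ y) z → s z = φ z →
      (s z ∉ Ioo (-(4 * d)) (-(2 * d)) → heatOp φ z ≤ 0) ∧
      (d ≤ |s z| → heatOp φ z ≤ f (s z) * (‖spaceGrad φ z‖ ^ 2 - 1)))
    (hsup : ∀ φ : Space n × ℝ → ℝ, ContDiff ℝ 2 φ → ∀ z : Space n × ℝ, z.2 ∈ Ioo 0 T →
      IsLocalMin (fun y => r y - φ y) z → r z = φ z →
      (r z ∉ Ioo (2 * d) (4 * d) → 0 ≤ heatOp φ z) ∧
      (d ≤ |r z| → f (r z) * (‖spaceGrad φ z‖ ^ 2 - 1) ≤ heatOp φ z)) {M m₀ : ℝ}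
    (hout : ∀ x ∉ Metric.ball (0 : Space n) M, ∀ t ∈ Icc 0 T, s (x, t) ≤ m₀ ∧ m₀ ≤ r (x, t))
    (h0 : ∀ x, s (x, 0) ≤ r (x, 0)) : ∀ x, ∀ t ∈ Icc 0 T, s (x, t) ≤ r (x, t) := by
  have hg0 : ∀ x, weight d x ≠ 0 := fun x => (weight_pos d x).ne'
  have hG₁c : Continuous fun x => (weight d x)⁻¹ := continuous_weight.inv₀ hg0
  obtain ⟨G, hG⟩ := exists_hasDerivAt_of_continuous hG₁c
  -- in terms of `G` with `G' = 1 / weight`, the heat equation gets the gradient term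
  -- `weightDeriv d ρ |∇|²`
  refine le_of_viscosity_pair hG (fun x => (hasDerivAt_weight d x).fun_inv (hg0 x))
    (by fun_prop (disch := exact fun x => pow_ne_zero 2 (hg0 x)))
    (fun x => inv_pos.2 (weight_pos d x)) hr hs
    (SubP := fun σ p τ => (σ ∉ Ioo (-(4 * d)) (-(2 * d)) → τ ≤ 0) ∧
      (d ≤ |σ| → τ ≤ f σ * (‖p‖ ^ 2 - 1)))
    (SupP := fun ρ p τ => (ρ ∉ Ioo (2 * d) (4 * d) → 0 ≤ τ) ∧
      (d ≤ |ρ| → f ρ * (‖p‖ ^ 2 - 1) ≤ τ)) hsub hsup ?_ hout h0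
  intro R S
  obtain ⟨Γ, hΓ⟩ := (isCompact_Icc (a := R) (b := S)).exists_bound_of_continuousOn
    (f := weight d) continuous_weight.continuousOn
  obtain ⟨W, hW⟩ := (isCompact_Icc (a := R) (b := S)).exists_bound_of_continuousOn
    (f := weightDeriv d) continuous_weightDeriv.continuousOn
  obtain ⟨L₀, hL₀, hinc⟩ := exists_abs_sub_le_mul_sub hG hG₁c
    (fun x => inv_pos.2 (weight_pos d x)) contDiff_id R S
  have hμ := h.four_le
  set L := 48 * L₀ + 3 * μ * |Γ| + |W|
  have hL : 0 ≤ L := by positivity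
  have hfb : ∀ x, d ≤ |x| → |f x| ≤ 3 * μ := fun x hx => by
    rcases le_abs.1 hx with h1 | h1
    · have := h.right x h1
      exact abs_le.2 ⟨by linarith, by linarith⟩
    · have := h.left x (by linarith)
      exact abs_le.2 ⟨by linarith, by linarith⟩
  have hWL : ∀ x ∈ Icc R S, |weightDeriv d x| ≤ |W| := fun x hx =>
    (hW x hx).trans (le_abs_self W)
  have hgc : ∀ x ∈ Icc R S, d ≤ |x| → |IsSteep.gradCoeff d f x| ≤ L := fun x hx hxd => by
    have h1 : |f x * weight d x| ≤ 3 * μ * |Γ| := by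
      rw [abs_mul]
      exact mul_le_mul (hfb x hxd) ((hΓ x hx).trans (le_abs_self Γ)) (abs_nonneg _) (by linarith)
    refine (abs_add_le _ _).trans ?_
    linarith [hWL x hx]
  refine ⟨L, hL, fun ρ hρ σ hσ hlt p p' τ τ' hu hw => ?_⟩
  have hnorm : ∀ x (q : Space n), ‖q‖ ^ 2 = weight d x ^ 2 * ‖(weight d x)⁻¹ • q‖ ^ 2 :=
    fun x q => by
      rw [norm_smul, mul_pow, Real.norm_eq_abs, sq_abs, ← mul_assoc, ← mul_pow,
        mul_inv_cancel₀ (hg0 x), one_pow, one_mul]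
  have hT : ∀ x (q : Space n) t, (weight d x)⁻¹ * t - -weightDeriv d x / weight d x ^ 2 * ‖q‖ ^ 2
      = t / weight d x + weightDeriv d x * ‖(weight d x)⁻¹ • q‖ ^ 2 := fun x q t => by
    rw [hnorm x q]
    field_simp [hg0 x]
    ring
  have hE : ∀ x (q : Space n), f x * (‖q‖ ^ 2 - 1) / weight d x
      + weightDeriv d x * ‖(weight d x)⁻¹ • q‖ ^ 2
      = IsSteep.gradCoeff d f x * ‖(weight d x)⁻¹ • q‖ ^ 2 - f x / weight d x := fun x q => by
    rw [hnorm x q, IsSteep.gradCoeff]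
    field_simp [hg0 x]
    ring
  rw [hT, hT]
  have hinc' : σ - ρ ≤ L₀ * (G σ - G ρ) := (le_abs_self _).trans (hinc ρ hρ σ hσ hlt)
  have hG0 : 0 ≤ (3 * μ * |Γ| + |W|) * (G σ - G ρ) := by
    refine mul_nonneg (by positivity) (sub_nonneg.2 ?_)
    exact (strictMono_of_hasDerivAt_pos hG fun x => inv_pos.2 (weight_pos d x)).monotone hlt.le
  have key := h.le_of_lt (L := L) (Q := ‖(weight d σ)⁻¹ • p‖ ^ 2)
    (Q' := ‖(weight d ρ)⁻¹ • p'‖ ^ 2)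
    (Tu := τ / weight d σ + weightDeriv d σ * ‖(weight d σ)⁻¹ • p‖ ^ 2)
    (Tw := τ' / weight d ρ + weightDeriv d ρ * ‖(weight d ρ)⁻¹ • p'‖ ^ 2)
    hlt (by positivity) (by positivity) (hgc ρ hρ) (hgc σ hσ)
    ((hWL ρ hρ).trans (by simp only [L]; nlinarith [abs_nonneg Γ]))
    (fun hσV => by linarith [div_nonpos_of_nonpos_of_nonneg (hu.1 hσV) (weight_pos d σ).le])
    (fun hσd => by
      rw [← hE]
      linarith [div_le_div_of_nonneg_right (hu.2 hσd) (weight_pos d σ).le])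
    (fun hρV => by linarith [div_nonneg (hw.1 hρV) (weight_pos d ρ).le])
    (fun hρd => by
      rw [← hE]
      linarith [div_le_div_of_nonneg_right (hw.2 hρd) (weight_pos d ρ).le])
  have : L * (G σ - G ρ) = 48 * (L₀ * (G σ - G ρ)) + (3 * μ * |Γ| + |W|) * (G σ - G ρ) := by
    simp only [L]; ring
  linarith

end SteepCoefficient

/-! ### Functions with exponentially attained limits -/

section FirstMapAsymptotics

/-- The quotient `b / a` of the second reduced equation for the first map, up to a constant factor
and in the variable `η = Y⁻¹` or, after a division of the parameters by `C`, `η = Y`. -/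
noncomputable def nearOneRatio (m₁ m₂ m C η : ℝ) : ℝ :=
  ((1 + 2 * m₁ * η + C * η ^ 2) * (1 + 2 * m₂ * η + C * η ^ 2))
    / ((1 + 2 * m * η + C * η ^ 2) * (1 - C * η ^ 2))

theorem abs_div_sub_one_le {a b e f : ℝ} (ha : |a - 1| ≤ 3 / 100) (hb : |b - 1| ≤ 3 / 100)
    (he : |e - 1| ≤ 3 / 100) (hf : |f - 1| ≤ 3 / 100) : |a * b / (e * f) - 1| ≤ 1 / 4 := by
  rw [abs_le] at *
  have h : 0 < e * f := mul_pos (by linarith) (by linarith)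
  rw [le_sub_iff_add_le, sub_le_iff_le_add, le_div_iff₀ h, div_le_iff₀ h]
  constructor <;> nlinarith

theorem abs_div_sub_div_le {a b e f a' b' e' f' t : ℝ} (ha : |a - 1| ≤ 3 / 100)
    (hb' : |b' - 1| ≤ 3 / 100) (he : |e - 1| ≤ 3 / 100) (hf : |f - 1| ≤ 3 / 100)
    (ha' : |a' - 1| ≤ 3 / 100) (he' : |e' - 1| ≤ 3 / 100) (hf' : |f' - 1| ≤ 3 / 100)
    (hta : |a - a'| ≤ t) (htb : |b - b'| ≤ t) (hte : |e - e'| ≤ t) (htf : |f - f'| ≤ t) :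
    |a * b / (e * f) - a' * b' / (e' * f')| ≤ 10 * t := by
  have hbd : ∀ x : ℝ, |x - 1| ≤ 3 / 100 → 97 / 100 ≤ x ∧ |x| ≤ 103 / 100 := fun x hx => by
    have := abs_le.1 hx
    exact ⟨by linarith, abs_le.2 ⟨by linarith, by linarith⟩⟩
  have ht : 0 ≤ t := (abs_nonneg _).trans hta
  have hprod : ∀ x y x' y' : ℝ, |x| ≤ 103 / 100 → |y'| ≤ 103 / 100 → |x - x'| ≤ t →
      |y - y'| ≤ t → |x * y - x' * y'| ≤ 21 / 10 * t := fun x y x' y' hx hy' h1 h2 => by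
    have h3 : x * y - x' * y' = x * (y - y') + (x - x') * y' := by ring
    rw [h3]
    refine (abs_add_le _ _).trans ?_
    rw [abs_mul, abs_mul]
    have h4 := mul_le_mul hx h2 (abs_nonneg _) (by norm_num)
    have h5 := mul_le_mul h1 hy' (abs_nonneg _) ht
    linarith
  have h1 := hprod a b a' b' (hbd a ha).2 (hbd b' hb').2 hta htb
  have h2 := hprod e f e' f' (hbd e he).2 (hbd f' hf').2 hte htf
  have h3 : 9 / 10 ≤ e * f := by nlinarith [(hbd e he).1, (hbd f hf).1]
  have h4 : 9 / 10 ≤ e' * f' := by nlinarith [(hbd e' he').1, (hbd f' hf').1]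
  have h5 : |a' * b'| ≤ 11 / 10 := by
    rw [abs_mul]
    have := mul_le_mul (hbd a' ha').2 (hbd b' hb').2 (abs_nonneg _) (by norm_num)
    linarith
  have h6 : a * b / (e * f) - a' * b' / (e' * f')
      = ((a * b - a' * b') * (e' * f') - a' * b' * (e * f - e' * f')) / (e * f * (e' * f')) := by
    have := (by linarith : 0 < e * f).ne'
    have := (by linarith : 0 < e' * f').ne'
    rw [div_sub_div _ _ (by assumption) (by assumption)]
    ring
  have h7 : 81 / 100 ≤ e * f * (e' * f') := by nlinarith
  have h8 : |e' * f'| ≤ 11 / 10 := by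
    rw [abs_mul]
    have := mul_le_mul (hbd e' he').2 (hbd f' hf').2 (abs_nonneg _) (by norm_num)
    linarith
  rw [h6, abs_div, abs_of_pos (by linarith : 0 < e * f * (e' * f')), div_le_iff₀ (by linarith)]
  refine (abs_sub _ _).trans ?_
  rw [abs_mul (a * b - a' * b'), abs_mul (a' * b') (e * f - e' * f')]
  have h9 := mul_le_mul h1 h8 (abs_nonneg _) (by positivity)
  have h10 := mul_le_mul h5 h2 (abs_nonneg _) (by norm_num)
  have h11 := mul_le_mul_of_nonneg_left h7 (by positivity : 0 ≤ 10 * t)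
  linarith

/-- `nearOneRatio` is close to `1` and Lipschitz near `η = 0`, uniformly for bounded parameters. -/
theorem nearOneRatio_bounds {K m₁ m₂ m C : ℝ} (hK : 1 ≤ K) (h₁ : |m₁| ≤ K) (h₂ : |m₂| ≤ K)
    (hm : |m| ≤ K) (hC : |C| ≤ K) :
    (∀ η ∈ Icc 0 (1 / (100 * K)), 0 < 1 - C * η ^ 2 ∧ |nearOneRatio m₁ m₂ m C η - 1| ≤ 1 / 4) ∧
    ∀ η ∈ Icc 0 (1 / (100 * K)), ∀ η' ∈ Icc 0 (1 / (100 * K)),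
      |nearOneRatio m₁ m₂ m C η - nearOneRatio m₁ m₂ m C η'| ≤ 40 * K * |η - η'| := by
  have hη₁ : ∀ η ∈ Icc 0 (1 / (100 * K)), K * η ≤ 1 / 100 := fun η hη => by
    have := hη.2
    rw [le_div_iff₀ (by positivity)] at this
    linarith
  have hη₂ : ∀ η ∈ Icc 0 (1 / (100 * K)), η ≤ 1 / 100 := fun η hη => by
    nlinarith [hη₁ η hη, hη.1]
  have hCη : ∀ η ∈ Icc 0 (1 / (100 * K)), |C * η ^ 2| ≤ 1 / 100 := fun η hη => by
    rw [abs_mul, abs_of_nonneg (sq_nonneg η)]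
    have h1 := hη₁ η hη
    have h2 := hη₂ η hη
    have h3 := mul_le_mul_of_nonneg_right hC (sq_nonneg η)
    nlinarith [hη.1]
  have hq : ∀ a, |a| ≤ K → ∀ η ∈ Icc 0 (1 / (100 * K)),
      |1 + 2 * a * η + C * η ^ 2 - 1| ≤ 3 / 100 := fun a ha η hη => by
    have h1 : |2 * a * η| ≤ 2 / 100 := by
      rw [abs_mul, abs_mul, abs_two, abs_of_nonneg hη.1]
      have := mul_le_mul_of_nonneg_right ha hη.1
      linarith [hη₁ η hη]
    have h2 : 1 + 2 * a * η + C * η ^ 2 - 1 = 2 * a * η + C * η ^ 2 := by ring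
    rw [h2]
    linarith [abs_add_le (2 * a * η) (C * η ^ 2), hCη η hη]
  have hq' : ∀ η ∈ Icc 0 (1 / (100 * K)), |1 - C * η ^ 2 - 1| ≤ 3 / 100 := fun η hη => by
    have h2 : 1 - C * η ^ 2 - 1 = -(C * η ^ 2) := by ring
    rw [h2, abs_neg]
    linarith [hCη η hη]
  have hd' : ∀ η ∈ Icc 0 (1 / (100 * K)), ∀ η' ∈ Icc 0 (1 / (100 * K)),
      |C * η ^ 2 - C * η' ^ 2| ≤ K * |η - η'| := fun η hη η' hη' => by
    have h1 : C * η ^ 2 - C * η' ^ 2 = C * (η + η') * (η - η') := by ring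
    rw [h1, abs_mul, abs_mul, abs_of_nonneg (add_nonneg hη.1 hη'.1)]
    have h2 := hη₂ η hη
    have h3 := hη₂ η' hη'
    have h4 : |C| * (η + η') ≤ K * 1 :=
      mul_le_mul hC (by linarith) (add_nonneg hη.1 hη'.1) (by linarith)
    rw [mul_one] at h4
    gcongr
  have hd : ∀ a, |a| ≤ K → ∀ η ∈ Icc 0 (1 / (100 * K)), ∀ η' ∈ Icc 0 (1 / (100 * K)),
      |1 + 2 * a * η + C * η ^ 2 - (1 + 2 * a * η' + C * η' ^ 2)| ≤ 4 * K * |η - η'| :=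
    fun a ha η hη η' hη' => by
      have h1 : 1 + 2 * a * η + C * η ^ 2 - (1 + 2 * a * η' + C * η' ^ 2)
          = 2 * a * (η - η') + (C * η ^ 2 - C * η' ^ 2) := by ring
      rw [h1]
      refine (abs_add_le _ _).trans ?_
      rw [abs_mul, abs_mul, abs_two]
      have h2 := mul_le_mul_of_nonneg_right ha (abs_nonneg (η - η'))
      have h3 := mul_nonneg (by linarith : 0 ≤ K) (abs_nonneg (η - η'))
      linarith [hd' η hη η' hη']
  refine ⟨fun η hη => ⟨?_, ?_⟩, fun η hη η' hη' => ?_⟩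
  · linarith [(abs_le.1 (hCη η hη)).2]
  · exact abs_div_sub_one_le (hq m₁ h₁ η hη) (hq m₂ h₂ η hη) (hq m hm η hη) (hq' η hη)
  · refine (abs_div_sub_div_le (hq m₁ h₁ η hη) (hq m₂ h₂ η' hη') (hq m hm η hη) (hq' η hη)
      (hq m₁ h₁ η' hη') (hq m hm η' hη') (hq' η' hη') (hd m₁ h₁ η hη η' hη')
      (hd m₂ h₂ η hη η' hη') (hd m hm η hη η' hη') ?_).trans_eq (by ring)
    have h1 : 1 - C * η ^ 2 - (1 - C * η' ^ 2) = -(C * η ^ 2 - C * η' ^ 2) := by ring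
    rw [h1, abs_neg]
    have h3 := mul_nonneg (by linarith : 0 ≤ K) (abs_nonneg (η - η'))
    linarith [hd' η hη η' hη']

/-- A function that tends exponentially fast, at a rate proportional to `μ`, to limits of size `μ`
is steep when `μ` is large. -/
theorem isSteep_of_exp {d μ c K₀ η₀ : ℝ} {f Φ₁ Φ₂ : ℝ → ℝ} (hd : 0 < d) (h4 : 4 ≤ μ)
    (h3 : 3 ≤ μ * d) (hc : 1 / 2 ≤ c) (hc1 : c ≤ 1) (hη₀ : 0 < η₀) (hμη : 1 ≤ μ * d * η₀)
    (hK₀ : 0 ≤ K₀) (hμK : 48 * K₀ * (1 / (2 * d) ^ 4 + 1 / (2 * d) ^ 2) ≤ μ ^ 2)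
    (hΦ₁ : ∀ η ∈ Icc 0 η₀, |Φ₁ η - 1| ≤ 1 / 4) (hΦ₂ : ∀ η ∈ Icc 0 η₀, |Φ₂ η - 1| ≤ 1 / 4)
    (hL₁ : ∀ η ∈ Icc 0 η₀, ∀ η' ∈ Icc 0 η₀, |Φ₁ η - Φ₁ η'| ≤ K₀ * |η - η'|)
    (hL₂ : ∀ η ∈ Icc 0 η₀, ∀ η' ∈ Icc 0 η₀, |Φ₂ η - Φ₂ η'| ≤ K₀ * |η - η'|)
    (hf₁ : ∀ ρ, d ≤ ρ → f ρ = -(μ / c * Φ₁ (Real.exp (-(2 * (μ * c) * ρ)))))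
    (hf₂ : ∀ ρ, ρ ≤ -d → f ρ = μ / c * Φ₂ (Real.exp (2 * (μ * c) * ρ))) :
    IsSteep d μ f := by
  have hμ : 0 < μ := by linarith
  have hc0 : 0 < c := by linarith
  have hμc : μ ≤ 2 * (μ * c) := by nlinarith
  have hmem : ∀ x, d ≤ x → Real.exp (-(2 * (μ * c) * x)) ∈ Icc 0 η₀ := fun x hx => by
    refine ⟨(Real.exp_pos _).le, ?_⟩
    rw [Real.exp_neg, inv_le_comm₀ (Real.exp_pos _) hη₀]
    have h1 := Real.add_one_le_exp (2 * (μ * c) * x)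
    have h2 : μ * d ≤ 2 * (μ * c) * x := mul_le_mul hμc hx hd.le (by positivity)
    have h5 : η₀⁻¹ ≤ μ * d := by rwa [inv_le_iff_one_le_mul₀ hη₀]
    linarith
  have hsize : ∀ y : ℝ, |y - 1| ≤ 1 / 4 → μ / 2 ≤ μ / c * y ∧ μ / c * y ≤ 3 * μ := fun y hy => by
    have h1 := abs_le.1 hy
    rw [div_mul_eq_mul_div, le_div_iff₀ hc0, div_le_iff₀ hc0]
    constructor <;> nlinarith
  have hslope : ∀ Φ : ℝ → ℝ,
      (∀ η ∈ Icc 0 η₀, ∀ η' ∈ Icc 0 η₀, |Φ η - Φ η'| ≤ K₀ * |η - η'|) →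
      ∀ x y, 2 * d ≤ x → x ≤ y → μ / c * |Φ (Real.exp (-(2 * (μ * c) * y)))
        - Φ (Real.exp (-(2 * (μ * c) * x)))| * (1 + x ^ 2) ≤ y - x := by
    intro Φ hΦ x y hx hxy
    have hx0 : 0 < x := by linarith
    have h1 := hΦ _ (hmem y (by linarith)) _ (hmem x (by linarith))
    have h2 : |Real.exp (-(2 * (μ * c) * y)) - Real.exp (-(2 * (μ * c) * x))|
        ≤ Real.exp (-(μ * x)) * (2 * (μ * c) * (y - x)) := by
      have e1 : Real.exp (-(2 * (μ * c) * y))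
          = Real.exp (-(2 * (μ * c) * x)) * Real.exp (-(2 * (μ * c) * (y - x))) := by
        rw [← Real.exp_add]; ring_nf
      have e2 : 0 ≤ 2 * (μ * c) * (y - x) := mul_nonneg (by positivity) (by linarith)
      have e3 := Real.add_one_le_exp (-(2 * (μ * c) * (y - x)))
      have e4 : Real.exp (-(2 * (μ * c) * x)) ≤ Real.exp (-(μ * x)) :=
        Real.exp_le_exp.2 (by nlinarith)
      have e5 : Real.exp (-(2 * (μ * c) * (y - x))) ≤ 1 := Real.exp_le_one_iff.2 (by linarith)
      rw [e1, abs_sub_comm, ← mul_one_sub, abs_mul, abs_of_pos (Real.exp_pos _),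
        abs_of_nonneg (by linarith)]
      exact mul_le_mul e4 (by linarith) (by linarith) (Real.exp_pos _).le
    have h5 : 2 * μ ^ 2 * K₀ * (1 + x ^ 2) ≤ Real.exp (μ * x) := by
      -- the fourth power in `exp x ≥ x ^ 4 / 24` leaves a factor `μ ^ 2` to spare
      have e1 := Real.pow_div_factorial_le_exp (μ * x) (by positivity) 4
      refine le_trans ?_ e1
      have e2 : 1 / x ^ 4 + 1 / x ^ 2 ≤ 1 / (2 * d) ^ 4 + 1 / (2 * d) ^ 2 := by gcongr
      have e3 : 48 * K₀ * (1 / x ^ 4 + 1 / x ^ 2) ≤ μ ^ 2 := le_trans (by gcongr) hμK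
      have e4 : 48 * K₀ * (1 + x ^ 2) ≤ μ ^ 2 * x ^ 4 := by
        have := mul_le_mul_of_nonneg_right e3 (by positivity : 0 ≤ x ^ 4)
        refine le_trans (le_of_eq ?_) this
        field_simp
      have e5 : ((4).factorial : ℝ) = 24 := by norm_num [Nat.factorial]
      rw [e5, le_div_iff₀ (by norm_num)]
      have := mul_le_mul_of_nonneg_left e4 (sq_nonneg μ)
      nlinarith
    have h6 : Real.exp (-(μ * x)) * (2 * μ ^ 2 * K₀ * (1 + x ^ 2)) ≤ 1 := by
      rw [Real.exp_neg, inv_mul_le_iff₀ (Real.exp_pos _), mul_one]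
      exact h5
    calc μ / c * |Φ (Real.exp (-(2 * (μ * c) * y)))
          - Φ (Real.exp (-(2 * (μ * c) * x)))| * (1 + x ^ 2)
        ≤ μ / c * (K₀ * (Real.exp (-(μ * x)) * (2 * (μ * c) * (y - x)))) * (1 + x ^ 2) := by
          gcongr
          exact h1.trans (mul_le_mul_of_nonneg_left h2 hK₀)
      _ = Real.exp (-(μ * x)) * (2 * μ ^ 2 * K₀ * (1 + x ^ 2)) * (y - x) := by
          field_simp
      _ ≤ 1 * (y - x) := mul_le_mul_of_nonneg_right h6 (by linarith)
      _ = y - x := one_mul _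
  have hneg : ∀ x : ℝ, 2 * (μ * c) * x = -(2 * (μ * c) * -x) := fun x => by ring
  have hμc0 : 0 ≤ μ / c := by positivity
  refine ⟨hd, h4, h3, fun ρ hρ => ?_, fun ρ hρ => ?_, fun ρ σ hρ hρσ => ?_, fun ρ σ hρσ hσ => ?_⟩
  · rw [hf₁ ρ hρ]
    have := hsize _ (hΦ₁ _ (hmem ρ hρ))
    exact ⟨by linarith, by linarith⟩
  · rw [hf₂ ρ hρ, hneg]
    exact hsize _ (hΦ₂ _ (hmem (-ρ) (by linarith)))
  · rw [hf₁ ρ (by linarith), hf₁ σ (by linarith), neg_sub_neg, ← mul_sub, abs_mul,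
      abs_of_nonneg hμc0, abs_sub_comm]
    exact hslope Φ₁ hL₁ ρ σ hρ hρσ
  · rw [hf₂ ρ (by linarith), hf₂ σ (by linarith), ← mul_sub, abs_mul, abs_of_nonneg hμc0,
      hneg ρ, hneg σ, abs_sub_comm]
    have := hslope Φ₂ hL₂ (-σ) (-ρ) (by linarith) (by linarith)
    rw [neg_sq] at this
    linarith

end FirstMapAsymptotics

/-! ### Comparison for the first control map -/

section FirstMap

/-- The quotient `b / a` of the second reduced equation for the first map. -/
noncomputable def firstMapQuotient (α β μ c m C ρ : ℝ) : ℝ :=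
  μ / c * (denPoly (m - (α + β) * c ^ 2) C (Real.exp (2 * (μ * c) * ρ))
    * denPoly (m - 2 * α * c ^ 2) C (Real.exp (2 * (μ * c) * ρ))
    / (denPoly m C (Real.exp (2 * (μ * c) * ρ)) * (C - Real.exp (2 * (μ * c) * ρ) ^ 2)))

theorem firstMapQuotient_eq_neg {α β μ c m C : ℝ} (ρ : ℝ) : firstMapQuotient α β μ c m C ρ
    = -(μ / c * nearOneRatio (m - (α + β) * c ^ 2) (m - 2 * α * c ^ 2) m C
      (Real.exp (-(2 * (μ * c) * ρ)))) := by
  have hY := Real.exp_pos (2 * (μ * c) * ρ)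
  rw [firstMapQuotient, nearOneRatio, Real.exp_neg]
  set Y := Real.exp (2 * (μ * c) * ρ)
  have h : ∀ a, denPoly a C Y = Y ^ 2 * (1 + 2 * a * Y⁻¹ + C * Y⁻¹ ^ 2) := fun a => by
    rw [denPoly]; field_simp
  have h' : C - Y ^ 2 = -(Y ^ 2 * (1 - C * Y⁻¹ ^ 2)) := by field_simp; ring
  rw [h, h, h, h', mul_neg, div_neg, mul_neg, mul_mul_mul_comm, mul_mul_mul_comm (Y ^ 2) _ (Y ^ 2),
    mul_div_mul_left _ _ (by positivity)]

theorem firstMapQuotient_eq {α β μ c m C : ℝ} (hC : 0 < C) (ρ : ℝ) :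
    firstMapQuotient α β μ c m C ρ
      = μ / c * nearOneRatio ((m - (α + β) * c ^ 2) / C) ((m - 2 * α * c ^ 2) / C) (m / C) (1 / C)
        (Real.exp (2 * (μ * c) * ρ)) := by
  rw [firstMapQuotient, nearOneRatio]
  set Y := Real.exp (2 * (μ * c) * ρ)
  have h : ∀ a, denPoly a C Y = C * (1 + 2 * (a / C) * Y + 1 / C * Y ^ 2) := fun a => by
    rw [denPoly]; field_simp; ring
  have h' : C - Y ^ 2 = C * (1 - 1 / C * Y ^ 2) := by field_simp
  rw [h, h, h, h', mul_mul_mul_comm, mul_mul_mul_comm C _ C, mul_div_mul_left _ _ (by positivity)]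

/-- For `μ` large in terms of bounds `K` on the parameters, the quotient `b / a` is steep and `a`
does not vanish away from `ρ = 0`. -/
theorem isSteep_firstMapQuotient {α β μ c m C K d : ℝ} (hd : 0 < d) (h4 : 4 ≤ μ)
    (h3 : 3 ≤ μ * d) (hc : 1 / 2 ≤ c) (hc1 : c ≤ 1) (hC : 0 < C) (hK : 1 ≤ K)
    (hK₁ : |m - (α + β) * c ^ 2| ≤ K) (hK₂ : |m - 2 * α * c ^ 2| ≤ K) (hK₃ : |m| ≤ K) (hK₄ : C ≤ K)
    (hK₁' : |m - (α + β) * c ^ 2| / C ≤ K) (hK₂' : |m - 2 * α * c ^ 2| / C ≤ K)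
    (hK₃' : |m| / C ≤ K) (hK₄' : 1 / C ≤ K) (hμη : 100 * K ≤ μ * d)
    (hμK : 48 * (40 * K) * (1 / (2 * d) ^ 4 + 1 / (2 * d) ^ 2) ≤ μ ^ 2) :
    IsSteep d μ (firstMapQuotient α β μ c m C) ∧
      ∀ ρ, d ≤ |ρ| → C - Real.exp (2 * (μ * c) * ρ) ^ 2 ≠ 0 := by
  have hdiv : ∀ x, |x| / C ≤ K → |x / C| ≤ K := fun x hx => by rwa [abs_div, abs_of_pos hC]
  obtain ⟨b₁, l₁⟩ := nearOneRatio_bounds hK hK₁ hK₂ hK₃ ((abs_of_pos hC).trans_le hK₄)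
  obtain ⟨b₂, l₂⟩ := nearOneRatio_bounds hK (hdiv _ hK₁') (hdiv _ hK₂') (hdiv _ hK₃')
    (hdiv 1 (by rwa [abs_one]))
  have hμη' : 1 ≤ μ * d * (1 / (100 * K)) := by
    rw [mul_one_div, le_div_iff₀ (by positivity)]; linarith
  refine ⟨isSteep_of_exp hd h4 h3 hc hc1 (by positivity) hμη' (by positivity) hμK
    (fun η hη => (b₁ η hη).2) (fun η hη => (b₂ η hη).2) l₁ l₂
    (fun ρ _ => firstMapQuotient_eq_neg ρ) (fun ρ _ => firstMapQuotient_eq hC ρ), ?_⟩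
  have hmem : ∀ x, d ≤ x → Real.exp (-(2 * (μ * c) * x)) ∈ Icc 0 (1 / (100 * K)) := fun x hx => by
    refine ⟨(Real.exp_pos _).le, ?_⟩
    rw [Real.exp_neg, ← one_div]
    refine one_div_le_one_div_of_le (by positivity) ?_
    have h1 := Real.add_one_le_exp (2 * (μ * c) * x)
    have h2 : μ * d ≤ 2 * (μ * c) * x := mul_le_mul (by nlinarith) hx hd.le (by nlinarith)
    linarith
  intro ρ hρ h0
  rcases le_abs.1 hρ with h | h
  · have h1 := (b₁ _ (hmem ρ h)).1
    rw [Real.exp_neg] at h1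
    have hY := Real.exp_pos (2 * (μ * c) * ρ)
    have h2 : C = Real.exp (2 * (μ * c) * ρ) ^ 2 := by linarith
    rw [h2, ← mul_pow, mul_inv_cancel₀ hY.ne'] at h1
    norm_num at h1
  · have h1 := (b₂ _ (hmem (-ρ) h)).1
    have e : -(2 * (μ * c) * -ρ) = 2 * (μ * c) * ρ := by ring
    have h2 : Real.exp (2 * (μ * c) * ρ) ^ 2 = C := by linarith
    rw [e, h2, one_div_mul_cancel hC.ne'] at h1
    norm_num at h1

/-- The first map, whose first reduced equation is the heat equation, and whose second one has a
steep quotient `b / a`. -/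
theorem le_of_isControlMapI {n : ℕ} {α β ε d T c m C μ : ℝ} (hαβ : 0 < α + β)
    (hε : 0 < ε) (hs0 : Real.sin (ε ^ 2) ≠ 0) (hc0 : 0 < c) (ec : c = Real.cos (ε ^ 2))
    (em : m = α + β / 2) (eC : C = β ^ 2 / 4 + α * (α + β) * Real.sin (ε ^ 2) ^ 2)
    (eμ : μ = mu α β ε) (hst : IsSteep d μ (firstMapQuotient α β μ c m C))
    (hne : ∀ ρ, d ≤ |ρ| → C - Real.exp (2 * (μ * c) * ρ) ^ 2 ≠ 0) {r s : Space n × ℝ → ℝ}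
    (hsup : IsDeltaSuper α β ε (8 * d) T (controlMapI α β ε) r)
    (hsub : IsDeltaSub α β ε (8 * d) T (controlMapI α β ε) s)
    (hr : ContinuousOn r (univ ×ˢ Icc 0 T)) (hs : ContinuousOn s (univ ×ˢ Icc 0 T)) {M m₀ : ℝ}
    (hout : ∀ x ∉ Metric.ball (0 : Space n) M, ∀ t ∈ Icc 0 T, s (x, t) ≤ m₀ ∧ m₀ ≤ r (x, t))
    (h0 : ∀ x, s (x, 0) ≤ r (x, 0)) : ∀ x, ∀ t ∈ Icc 0 T, s (x, t) ≤ r (x, t) := by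
  have hμ : 0 < μ := eμ ▸ mu_pos hαβ hε
  have hcos : Real.cos (ε ^ 2) ≠ 0 := ec ▸ hc0.ne'
  have ha₁ := firstEquation_a_I hαβ hcos
  have ha₁0 : ∀ ρ, (firstEquation (controlMapI α β ε)).a ρ ≠ 0 := fun ρ => by
    rw [ha₁, ← eμ]; exact neg_ne_zero.2 (mul_ne_zero hμ.ne' hs0)
  have hrhs : ∀ ρ (p : Space n), (firstEquation (controlMapI α β ε)).rhs ρ p = 0 := fun ρ p => by
    have hc : (firstEquation (controlMapI α β ε)).c ρ = 0 := rfl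
    rw [ScalarEquation.rhs, firstEquation_b_eq_zero hsub.contDiff ha₁, hc]
    simp
  have hpar : IsParam α β c (Real.sin (ε ^ 2)) m C := by rw [ec, em, eC]; exact isParam_I α β ε
  obtain ⟨k, ek⟩ : ∃ k, k = √(2 * (α + β)) * c := ⟨_, rfl⟩
  have hk : 0 < k := by rw [ek]; positivity
  have heq := secondEquation_I hαβ hε hcos hs0 hsub.contDiff hsub.sphere ec rfl em eC eμ
    (ν := μ * c) rfl ek
  set eq := secondEquation α β ε (controlMapI α β ε)
  have hP : ∀ ρ, 0 < denPoly m C (Real.exp (2 * (μ * c) * ρ)) := fun ρ =>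
    hpar.denPoly_pos hc0.ne' hαβ (Real.exp_pos _)
  have ha₂0 : ∀ ρ, d ≤ |ρ| → eq.a ρ ≠ 0 := fun ρ hρ => by
    rw [(heq ρ).1]
    have h1 := Real.sqrt_pos.2 (hP ρ)
    have h2 : profile k (μ * c) m C ρ ≠ 0 := by rw [profile]; positivity
    exact mul_ne_zero h2 (div_ne_zero (mul_ne_zero (by positivity) (hne ρ hρ)) (hP ρ).ne')
  have hb : ∀ ρ, d ≤ |ρ| → eq.b ρ = firstMapQuotient α β μ c m C ρ * eq.a ρ := fun ρ hρ => by
    rw [(heq ρ).1, (heq ρ).2.1, firstMapQuotient]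
    have h1 := (hP ρ).ne'
    have h2 := hne ρ hρ
    set Y := Real.exp (2 * (μ * c) * ρ)
    have h5 : denPoly m C Y - 2 * (α + β) * c ^ 2 * Y = denPoly (m - (α + β) * c ^ 2) C Y := by
      rw [denPoly, denPoly]; ring
    have h6 : denPoly m C Y - 4 * α * c ^ 2 * Y = denPoly (m - 2 * α * c ^ 2) C Y := by
      rw [denPoly, denPoly]; ring
    rw [h5, h6]
    field_simp
  refine le_of_viscosity_of_isSteep hst hr hs (fun φ hφ z hz h1 h2 => ⟨fun hV => ?_, fun hd => ?_⟩)
    (fun φ hφ z hz h1 h2 => ⟨fun hV => ?_, fun hd => ?_⟩) hout h0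
  · have h3 := hsub.first φ hφ z hz h1 h2 (by
      rwa [show 8 * d / 2 = 4 * d by ring, show 8 * d / 4 = 2 * d by ring])
    exact (h3.1 (ha₁0 _)).trans_eq (hrhs _ _)
  · have h3 := hsub.second φ hφ z hz h1 h2 (mem_univ _)
    exact (h3.1 (ha₂0 _ hd)).trans_eq
      (ScalarEquation.rhs_eq_mul_sub_one (heq _).2.2 (hb _ hd) (ha₂0 _ hd))
  · have h3 := hsup.first φ hφ z hz h1 h2 (by
      rwa [show 8 * d / 2 = 4 * d by ring, show 8 * d / 4 = 2 * d by ring])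
    exact (hrhs _ _).symm.trans_le (h3.1 (ha₁0 _))
  · have h3 := hsup.second φ hφ z hz h1 h2 (mem_univ _)
    exact (ScalarEquation.rhs_eq_mul_sub_one (heq _).2.2 (hb _ hd) (ha₂0 _ hd)).symm.trans_le
      (h3.1 (ha₂0 _ hd))

/-- For small `ε`, the quotient `b / a` for the first map is steep: the parameters stay bounded,
`C` stays away from zero, and `μ` tends to infinity. -/
theorem exists_isSteep_firstMapQuotient {α β d : ℝ} (hβ : 0 < β) (hαβ : 0 < α + β) (hd : 0 < d) :
    ∃ ε₀ : ℝ, 0 < ε₀ ∧ ∀ ε, 0 < ε → ε ≤ ε₀ → ∀ c m C μ, c = Real.cos (ε ^ 2) → m = α + β / 2 →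
      C = β ^ 2 / 4 + α * (α + β) * Real.sin (ε ^ 2) ^ 2 → μ = mu α β ε →
      0 < Real.sin (ε ^ 2) ∧ 0 < c ∧ IsSteep d μ (firstMapQuotient α β μ c m C) ∧
      ∀ ρ, d ≤ |ρ| → C - Real.exp (2 * (μ * c) * ρ) ^ 2 ≠ 0 := by
  set K₁ := 3 * |α| + 2 * β + (α + β) + β ^ 2 / 4 + |α| * (α + β) + 1 with hK₁
  set K := K₁ * (1 + 8 / β ^ 2) with hK
  have hα := abs_nonneg α
  have hαA : 0 ≤ |α| * (α + β) := by positivity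
  have hβ2 : 0 ≤ β ^ 2 / 4 := by positivity
  have hK₁1 : 1 ≤ K₁ := by linarith
  clear_value K₁
  have hK₁K : K₁ ≤ K := by
    have h8 : 0 < 8 / β ^ 2 := by positivity
    rw [hK]; exact le_mul_of_one_le_right (by linarith) (by linarith)
  clear_value K
  set μ₀ := 4 + 3 / d + 100 * K / d + 48 * (40 * K) * (1 / (2 * d) ^ 4 + 1 / (2 * d) ^ 2) with hμ₀
  have hK0 : 0 < K := by linarith
  have e1 : 0 < 3 / d := by positivity
  have e2 : 0 < 100 * K / d := by positivity
  have e3 : 0 < 48 * (40 * K) * (1 / (2 * d) ^ 4 + 1 / (2 * d) ^ 2) := by positivity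
  have hμ₀p : 0 < μ₀ := by linarith
  clear_value μ₀
  refine ⟨min 1 (min (β ^ 2 / (8 * (|α| * (α + β) + 1))) (√(α + β) / μ₀)),
    by have := Real.sqrt_pos.2 hαβ; positivity, ?_⟩
  intro ε hε hle c m C μ ec em eC eμ
  have hε1 : ε ≤ 1 := hle.trans (min_le_left _ _)
  have hε2 : ε ≤ β ^ 2 / (8 * (|α| * (α + β) + 1)) :=
    hle.trans ((min_le_right _ _).trans (min_le_left _ _))
  have hε3 : ε ≤ √(α + β) / μ₀ := hle.trans ((min_le_right _ _).trans (min_le_right _ _))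
  have hμμ₀ : μ₀ ≤ μ := by
    rw [le_div_iff₀ hμ₀p] at hε3
    rw [eμ, mu, le_div_iff₀ hε]
    linarith
  have hεsq : ε ^ 2 ≤ ε := by nlinarith
  have hsin : 0 < Real.sin (ε ^ 2) :=
    Real.sin_pos_of_pos_of_le_one (by positivity) (by linarith)
  have hsin' : Real.sin (ε ^ 2) ^ 2 ≤ ε := by
    have h1 := Real.sin_le (by positivity : 0 ≤ ε ^ 2)
    exact (pow_le_of_le_one hsin.le (Real.sin_le_one _) two_ne_zero).trans (h1.trans hεsq)
  have hsin1 : Real.sin (ε ^ 2) ^ 2 ≤ 1 := hsin'.trans hε1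
  have hc : 1 / 2 ≤ c := by
    rw [ec]
    have h1 := Real.one_sub_sq_div_two_le_cos (x := ε ^ 2)
    have h2 : (ε ^ 2) ^ 2 ≤ 1 := pow_le_one₀ (by positivity) (by linarith)
    linarith
  have hc1 : c ≤ 1 := ec ▸ Real.cos_le_one _
  have hc2 : c ^ 2 ≤ 1 := pow_le_one₀ (by linarith) hc1
  have hα1 : |α * (α + β) * Real.sin (ε ^ 2) ^ 2| ≤ |α| * (α + β) * Real.sin (ε ^ 2) ^ 2 := by
    rw [abs_mul, abs_mul, abs_of_pos hαβ, abs_of_nonneg (sq_nonneg (Real.sin (ε ^ 2)))]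
  have hα2 : |α| * (α + β) * Real.sin (ε ^ 2) ^ 2 ≤ β ^ 2 / 8 := by
    rw [le_div_iff₀ (by positivity)] at hε2
    have := mul_le_mul_of_nonneg_left hsin' hαA
    linarith
  have hCl : β ^ 2 / 8 ≤ C := by linarith [(abs_le.1 hα1).1]
  have hCp : 0 < C := lt_of_lt_of_le (by positivity) hCl
  have hCu : C ≤ K₁ := by
    have := mul_le_mul_of_nonneg_left hsin1 hαA
    linarith [(abs_le.1 hα1).2]
  have hm : |m| ≤ K₁ := by
    rw [em]
    refine (abs_add_le _ _).trans ?_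
    rw [abs_of_pos (by positivity : 0 < β / 2)]
    linarith
  have hm₁ : |m - (α + β) * c ^ 2| ≤ K₁ := by
    refine (abs_sub _ _).trans ?_
    have h1 : |m| ≤ |α| + β / 2 := by
      rw [em]
      refine (abs_add_le _ _).trans ?_
      rw [abs_of_pos (by positivity : 0 < β / 2)]
    rw [abs_of_nonneg (by positivity : 0 ≤ (α + β) * c ^ 2)]
    have h2 := mul_le_mul_of_nonneg_left hc2 hαβ.le
    linarith
  have hm₂ : |m - 2 * α * c ^ 2| ≤ K₁ := by
    refine (abs_sub _ _).trans ?_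
    have h1 : |m| ≤ |α| + β / 2 := by
      rw [em]
      refine (abs_add_le _ _).trans ?_
      rw [abs_of_pos (by positivity : 0 < β / 2)]
    rw [abs_mul, abs_mul, abs_two, abs_of_nonneg (sq_nonneg c)]
    have h2 := mul_le_mul_of_nonneg_left hc2 hα
    linarith
  have hdiv : ∀ x, x ≤ K₁ → x / C ≤ K := fun x hx => by
    rw [div_le_iff₀ hCp]
    have h1 : 1 ≤ 8 / β ^ 2 * C := by
      rw [div_mul_eq_mul_div, le_div_iff₀ (by positivity)]; linarith
    have h2 : K₁ * 1 ≤ K₁ * (8 / β ^ 2 * C) := mul_le_mul_of_nonneg_left h1 (by linarith)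
    have h3 : K * C = K₁ * C + K₁ * (8 / β ^ 2 * C) := by rw [hK]; ring
    have h4 : 0 ≤ K₁ * C := by positivity
    linarith
  refine ⟨hsin, by linarith, ?_⟩
  have h4 : 4 ≤ μ := by linarith
  refine isSteep_firstMapQuotient hd h4 ?_ hc hc1 hCp (by linarith) (hm₁.trans hK₁K)
    (hm₂.trans hK₁K) (hm.trans hK₁K) (hCu.trans hK₁K) (hdiv _ hm₁) (hdiv _ hm₂) (hdiv _ hm)
    (hdiv _ hK₁1) ?_ ?_
  · have h5 : 3 / d ≤ μ := by linarith
    rwa [div_le_iff₀ hd] at h5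
  · have h5 : 100 * K / d ≤ μ := by linarith
    rwa [div_le_iff₀ hd] at h5
  · have h5 : 48 * (40 * K) * (1 / (2 * d) ^ 4 + 1 / (2 * d) ^ 2) ≤ μ := by linarith
    exact h5.trans (le_self_pow₀ (by linarith) two_ne_zero)

end FirstMap

end LandauLifshitz

theorem theorem6p2 (α β δ : ℝ) (hβ : 0 < β) (hαβ : 0 < α + β) (hδ : 0 < δ) :
    ∃ ε₀ : ℝ, 0 < ε₀ ∧ ∀ ε : ℝ, 0 < ε → ε ≤ ε₀ →
      ∀ v : ℝ → EuclideanSpace ℝ (Fin 3), LandauLifshitz.IsControlMap α β ε v →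
      ∀ T : ℝ, 0 < T → δ < 2 * √(6 * T) →
      ∀ (n : ℕ) (r s : LandauLifshitz.Space n × ℝ → ℝ),
        LandauLifshitz.IsDeltaSuper α β ε δ T v r →
        LandauLifshitz.IsDeltaSub α β ε δ T v s →
        ContinuousOn r (Set.univ ×ˢ Set.Icc 0 T) →
        ContinuousOn s (Set.univ ×ˢ Set.Icc 0 T) →
        (∃ M : ℝ, 0 < M ∧ ∃ x₀ ∈ Metric.ball (0 : LandauLifshitz.Space n) M,
          ∃ t₀ ∈ Set.Icc 0 T, ∀ x ∉ Metric.ball (0 : LandauLifshitz.Space n) M,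
            ∀ t ∈ Set.Icc 0 T, s (x, t) ≤ r (x₀, t₀) ∧ r (x₀, t₀) ≤ r (x, t)) →
        (∀ x : LandauLifshitz.Space n, s (x, 0) ≤ r (x, 0)) →
        ∀ (x : LandauLifshitz.Space n), ∀ t ∈ Set.Icc 0 T,
          r (x, t) ∉ Set.Icc (δ / 4) (δ / 2) →
          s (x, t) ∉ Set.Icc (-(δ / 2)) (-(δ / 4)) →
          s (x, t) ≤ r (x, t) := by
  obtain ⟨d, rfl⟩ : ∃ d, δ = 8 * d := ⟨δ / 8, by ring⟩
  obtain ⟨ε₀, hε₀, h⟩ := LandauLifshitz.exists_isSteep_firstMapQuotient hβ hαβ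
    (by linarith : 0 < d)
  refine ⟨ε₀, hε₀, fun ε hε hle v hv T _ _ n r s hsup hsub hr hs ⟨M, _, x₀, _, t₀, _, hout⟩ h0
    x t ht _ _ => ?_⟩
  rcases hv with rfl | ⟨k, rfl⟩
  · obtain ⟨hsin, hc, hst, hne⟩ := h ε hε hle _ _ _ _ rfl rfl rfl rfl
    exact LandauLifshitz.le_of_isControlMapI hαβ hε hsin.ne' hc rfl rfl rfl rfl hst hne hsup hsub
      hr hs hout h0 x t ht
  · exact LandauLifshitz.le_of_isControlMapII hβ hαβ hε hsup hsub hr hs hout h0 x t ht
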